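/- Let $-1\le a_1<a_2<a_3<a_4\le 1$, $\Gamma=[-1,a_1]\cup[a_2,a_3]\cup[a_4,1]$, and let $R(z)=\sqrt{\prod_{j=1}^4(z-a_j)}$ be the branch that is holomorphic off the bands $[a_1,a_2]\cup[a_3,a_4]$ with $R(z)\sim z^2$ as $z\to\infty$; on the bands $R$ takes its boundary values from the upper half plane. Let $H[f](x)=\frac1\pi\,\mathrm{p.v.}\!\int_\Gamma\frac{f(w)}{w-x}\,dw$ be the finite Hilbert transform on $\Gamma$. For $g:\mathbb R\to\mathbb R$, consider functions $u$ that are holomorphic on $\mathbb C\setminus([a_1,a_2]\cup[a_3,a_4])$, whose values on the open bands are their boundary values from the upper half plane, that are integrable on $[-1,1]$, and that satisfy $$\pi H\big[u(w)\sqrt{1-w^2}\big](x)=g(x)\quad (x\in\operatorname{int}\Gamma),\qquad \int_{a_1}^{a_2}u(x)\,dx=\int_{a_3}^{a_4}u(x)\,dx=0 .\qquad (*)$$ Put $l_1=\sum_{j}a_j$, $l_2=\sum_{i<j}a_ia_j$, $m=\frac{(a_4-a_3)(a_2-a_1)}{(a_4-a_2)(a_3-a_1)}$, let $K(m)=\int_0^{\pi/2}\frac{dy}{\sqrt{1-m\sin^2y}}$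 and $E(m)=\int_0^{\pi/2}\sqrt{1-m\sin^2y}\,dy$ be the complete elliptic integrals of the first and second kind, and $$A=-\tfrac{E(m)}{2K(m)}(a_3-a_1)(a_4-a_2)+\tfrac12(a_3a_4+a_2a_1),$$ $$B=-\tfrac{E(m)}{2K(m)}(a_3-a_1)(a_4-a_2)\,l_1+\tfrac12(a_4a_3-a_2a_1)(a_4+a_3-a_2-a_1),$$ $$C=-\tfrac{2E(m)}{K(m)}(a_3-a_1)(a_4-a_2)+\tfrac12(a_3+a_4-a_2-a_1)^2 .$$ Then, up to arbitrary values at the four points $a_j$: 1. (*) with $g(x)=-x$ has exactly one solution, the density of states $$u(z)=\frac1\pi\,\frac{z^2-\frac12l_1z+A}{R(z)} .$$ 2. (*) with $g(x)=2-4x^2$ has exactly one solution, the density of fluxes $$v(z)=\frac1\pi\,\frac{4z^3-2l_1z^2+(2l_2-\frac12l_1^2)z+B}{R(z)} .$$ 3. The polynomial $z^2-\frac12l_1z+A$ has no zero on $\Gamma$, and for $z\in\Gamma\setminus\{a_1,a_2,a_3,a_4\}$ one has $u(z)\neq0$ and the effective velocity $s=v/u$ is $$s(z)=4z-\frac{Cz-B}{z^2-\frac12l_1z+A}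 .$$ -/

import Mathlib

open Set Filter Topology MeasureTheory

namespace DefNLS

/-- The complete elliptic integral of the first kind, as a function of the parameter `m`. -/
noncomputable def ellipticK (m : ℝ) : ℝ :=
  ∫ y in (0 : ℝ)..(Real.pi / 2), 1 / Real.sqrt (1 - m * Real.sin y ^ 2)

/-- The complete elliptic integral of the second kind, as a function of the parameter `m`. -/
noncomputable def ellipticE (m : ℝ) : ℝ :=
  ∫ y in (0 : ℝ)..(Real.pi / 2), Real.sqrt (1 - m * Real.sin y ^ 2)

/-- The branch of `√((z - a)(z - b))` (for `a < b`) that is holomorphic off `[a, b]` and behaves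
like `z` at infinity. On the cut itself it takes its boundary values from the upper half plane. -/
noncomputable def cutRoot (a b : ℝ) (z : ℂ) : ℂ :=
  (z - a) * ((z - b) / (z - a)) ^ (1 / 2 : ℂ)

/-- The radical `R(z) = √((z - a₁)(z - a₂)(z - a₃)(z - a₄))` with branch cuts `[a₁, a₂]` and
`[a₃, a₄]`, normalized by `R(z) ~ z²` at infinity; on the cuts it takes its boundary values from
the upper half plane. -/
noncomputable def surfaceRoot (a₁ a₂ a₃ a₄ : ℝ) (z : ℂ) : ℂ :=
  cutRoot a₁ a₂ z * cutRoot a₃ a₄ z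

theorem cutRoot_sq (a b : ℝ) (z : ℂ) : cutRoot a b z ^ 2 = (z - a) * (z - b) := by
  unfold cutRoot
  by_cases h : z - a = 0
  · simp [h]
  · rw [mul_pow, ← Complex.cpow_nat_mul]
    norm_num
    field_simp

theorem surfaceRoot_sq (a₁ a₂ a₃ a₄ : ℝ) (z : ℂ) :
    surfaceRoot a₁ a₂ a₃ a₄ z ^ 2 = (z - a₁) * (z - a₂) * (z - a₃) * (z - a₄) := by
  unfold surfaceRoot
  rw [mul_pow, cutRoot_sq, cutRoot_sq]
  ring

theorem tendsto_cutRoot_div (a b : ℝ) :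
    Tendsto (fun z : ℂ => cutRoot a b z / z) (Bornology.cobounded ℂ) (𝓝 1) := by
  have h0 : Tendsto (fun z : ℂ => z⁻¹) (Bornology.cobounded ℂ) (𝓝 0) :=
    tendsto_inv₀_cobounded
  have hne : ∀ c : ℂ, ∀ᶠ z : ℂ in Bornology.cobounded ℂ, z ≠ c := fun c =>
    Bornology.eventually_ne_cobounded c
  have h1 : ∀ c : ℂ, Tendsto (fun z : ℂ => 1 - c * z⁻¹) (Bornology.cobounded ℂ) (𝓝 1) := by
    intro c
    simpa using tendsto_const_nhds.sub (h0.const_mul c)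
  have h2 : Tendsto (fun z : ℂ => (1 - b * z⁻¹) / (1 - a * z⁻¹))
      (Bornology.cobounded ℂ) (𝓝 1) := by
    have h := (h1 b).div (h1 a) one_ne_zero
    rw [div_one] at h
    exact h
  have h3 : Tendsto (fun z : ℂ => ((1 - b * z⁻¹) / (1 - a * z⁻¹)) ^ (1 / 2 : ℂ))
      (Bornology.cobounded ℂ) (𝓝 1) := by
    have := (continuousAt_cpow_const (b := (1 / 2 : ℂ)) Complex.one_mem_slitPlane).tendsto.comp h2
    simpa [Function.comp_def] using this
  have h4 := (h1 a).mul h3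
  rw [one_mul] at h4
  refine h4.congr' ?_
  filter_upwards [hne 0, hne a] with z hz hza
  have hza' : z - a ≠ 0 := sub_ne_zero.2 hza
  have e : (1 - b * z⁻¹) / (1 - a * z⁻¹) = (z - b) / (z - a) := by
    have : (1 - a * z⁻¹ : ℂ) ≠ 0 := by
      intro h
      apply hza'
      have e : z - a = z * (1 - a * z⁻¹) := by field_simp
      rw [e, h, mul_zero]
    rw [div_eq_div_iff this hza']
    field_simp
  rw [e, cutRoot]
  field_simp

/-- The normalization `R(z) ~ z²` at infinity. -/
theorem tendsto_surfaceRoot_div (a₁ a₂ a₃ a₄ : ℝ) :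
    Tendsto (fun z : ℂ => surfaceRoot a₁ a₂ a₃ a₄ z / z ^ 2) (Bornology.cobounded ℂ) (𝓝 1) := by
  have h := (tendsto_cutRoot_div a₁ a₂).mul (tendsto_cutRoot_div a₃ a₄)
  rw [one_mul] at h
  refine h.congr fun z => ?_
  rw [surfaceRoot, div_mul_div_comm, sq]

/-- The spectral support `Γ = [-1, a₁] ∪ [a₂, a₃] ∪ [a₄, 1]` of the genus one condensate. -/
def spectralSupport (a₁ a₂ a₃ a₄ : ℝ) : Set ℝ :=
  Icc (-1) a₁ ∪ Icc a₂ a₃ ∪ Icc a₄ 1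

/-- The bands `[a₁, a₂]` and `[a₃, a₄]`, as a subset of the complex plane. -/
def bandSet (a₁ a₂ a₃ a₄ : ℝ) : Set ℂ :=
  (fun x : ℝ => (x : ℂ)) '' (Icc a₁ a₂ ∪ Icc a₃ a₄)

/-- The set of the four branch points. -/
def branchPoints (a₁ a₂ a₃ a₄ : ℝ) : Set ℂ :=
  {(a₁ : ℂ), (a₂ : ℂ), (a₃ : ℂ), (a₄ : ℂ)}

/-- The finite Hilbert transform `H[f](x) = (1/π) p.v. ∫_Γ f(w) / (w - x) dw` exists at `x` and
equals `h`. -/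
def HasFiniteHilbertTransform (Γ : Set ℝ) (f : ℝ → ℂ) (x : ℝ) (h : ℂ) : Prop :=
  Tendsto (fun ε : ℝ => (1 / (Real.pi : ℂ)) *
      ∫ w in Γ \ Metric.ball x ε, f w / ((w - x : ℝ) : ℂ)) (𝓝[>] 0) (𝓝 h)

/-- `u` solves the condensate equation `π H[u |R₀|] = g` on `Γ`, where
`|R₀(w)| = |√(w² - 1)| = √(1 - w²)`, together with the band vanishing conditions
`∫_{a₁}^{a₂} u = ∫_{a₃}^{a₄} u = 0`. The values of `u` on the bands, which these conditions need,
are those of the analytic continuation of `u` off the bands, taken from the upper half plane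
(those from the lower half plane are their negatives for the solutions in question).
The values of `u` at the four branch points play no role. -/
structure IsCondensateSolution (a₁ a₂ a₃ a₄ : ℝ) (g : ℝ → ℝ) (u : ℂ → ℂ) : Prop where
  differentiableOn : DifferentiableOn ℂ u (bandSet a₁ a₂ a₃ a₄)ᶜ
  boundaryValue : ∀ x ∈ Ioo a₁ a₂ ∪ Ioo a₃ a₄,
    Tendsto u (𝓝[{z : ℂ | 0 < z.im}] (x : ℂ)) (𝓝 (u (x : ℂ)))
  integrableOn : IntegrableOn (fun x : ℝ => u (x : ℂ)) (Icc (-1) 1)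
  hilbert : ∀ x ∈ interior (spectralSupport a₁ a₂ a₃ a₄), ∃ h : ℂ,
    HasFiniteHilbertTransform (spectralSupport a₁ a₂ a₃ a₄)
      (fun w => u (w : ℂ) * (Real.sqrt (1 - w ^ 2) : ℂ)) x h ∧ (Real.pi : ℂ) * h = (g x : ℂ)
  vanish_left : ∫ x in a₁..a₂, u (x : ℂ) = 0
  vanish_right : ∫ x in a₃..a₄, u (x : ℂ) = 0

/-- `l₁`, the sum of the branch points. -/
def l₁ (a₁ a₂ a₃ a₄ : ℝ) : ℝ := a₁ + a₂ + a₃ + a₄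

/-- `l₂`, the second elementary symmetric polynomial of the branch points. -/
def l₂ (a₁ a₂ a₃ a₄ : ℝ) : ℝ :=
  a₁ * a₂ + a₁ * a₃ + a₁ * a₄ + a₂ * a₃ + a₂ * a₄ + a₃ * a₄

/-- The elliptic parameter `m`. -/
noncomputable def ellipticParameter (a₁ a₂ a₃ a₄ : ℝ) : ℝ :=
  ((a₄ - a₃) * (a₂ - a₁)) / ((a₄ - a₂) * (a₃ - a₁))

/-- The ratio `E(m) / K(m)`. -/
noncomputable def ellipticRatio (a₁ a₂ a₃ a₄ : ℝ) : ℝ :=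
  ellipticE (ellipticParameter a₁ a₂ a₃ a₄) / ellipticK (ellipticParameter a₁ a₂ a₃ a₄)

/-- The constant `A`. -/
noncomputable def constA (a₁ a₂ a₃ a₄ : ℝ) : ℝ :=
  -(ellipticRatio a₁ a₂ a₃ a₄ / 2) * (a₃ - a₁) * (a₄ - a₂) + (1 / 2) * (a₃ * a₄ + a₂ * a₁)

/-- The constant `B`. -/
noncomputable def constB (a₁ a₂ a₃ a₄ : ℝ) : ℝ :=
  -(ellipticRatio a₁ a₂ a₃ a₄ / 2) * (a₃ - a₁) * (a₄ - a₂) * l₁ a₁ a₂ a₃ a₄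
    + (1 / 2) * (a₄ * a₃ - a₂ * a₁) * (a₄ + a₃ - a₂ - a₁)

/-- The constant `C`. -/
noncomputable def constC (a₁ a₂ a₃ a₄ : ℝ) : ℝ :=
  -(2 * ellipticRatio a₁ a₂ a₃ a₄) * (a₃ - a₁) * (a₄ - a₂)
    + (1 / 2) * (a₃ + a₄ - a₂ - a₁) ^ 2

/-- The explicit density of states
`u₁(z) = (1/π) (z² - l₁ z / 2 + A) / R(z)`. -/
noncomputable def genusOneDOS (a₁ a₂ a₃ a₄ : ℝ) (z : ℂ) : ℂ :=
  (1 / (Real.pi : ℂ)) *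
    ((z ^ 2 - (1 / 2) * (l₁ a₁ a₂ a₃ a₄ : ℂ) * z + (constA a₁ a₂ a₃ a₄ : ℂ))
      / surfaceRoot a₁ a₂ a₃ a₄ z)

/-- The explicit density of fluxes
`v₁(z) = (1/π) (4 z³ - 2 l₁ z² + (2 l₂ - l₁² / 2) z + B) / R(z)`. -/
noncomputable def genusOneDOF (a₁ a₂ a₃ a₄ : ℝ) (z : ℂ) : ℂ :=
  (1 / (Real.pi : ℂ)) *
    ((4 * z ^ 3 - 2 * (l₁ a₁ a₂ a₃ a₄ : ℂ) * z ^ 2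
        + (2 * (l₂ a₁ a₂ a₃ a₄ : ℂ) - (l₁ a₁ a₂ a₃ a₄ : ℂ) ^ 2 / 2) * z
        + (constB a₁ a₂ a₃ a₄ : ℂ))
      / surfaceRoot a₁ a₂ a₃ a₄ z)

/-- The effective velocity `s = v / u`. -/
noncomputable def effectiveVelocity (u v : ℂ → ℂ) (z : ℂ) : ℂ := v z / u z

end DefNLS

/-!
Write `Φ(z) = ∫_Γ u(w) √(1 - w²) / (w - z) dw`. By Plemelj's formula the condensate equation says
that the continuation of `Φ` from one side of the interior of `Γ` to the other is governed by `g`.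

*Existence.* If `p √(z² - 1) / R - q → 0` at infinity for polynomials `p` and `q`, then `Φ` for
`u = p / (π R)` equals `p √(z² - 1) / R - q`: the difference of the two sides continues across the
real line, its singularities at the finitely many exceptional points are removable because it grows
there more slowly than `1 / |im z|`, and it vanishes at infinity. Taking boundary values gives
`π H[u √(1 - w²)] = -q`. The coefficients that remain free are fixed by the band conditions, in
which Legendre's substitution and exact differentials of `√|R²|` leave only `E(m)` and `K(m)`.

*Uniqueness.* For a solution `φ` of the homogeneous equation, `Φ` coincides with `π φ √(z² - 1)` off
the real line. Hence `φ R` continues across `Γ` as well as across the bands, is entire and bounded,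
and so is a constant `k`. The condition on `[a₁, a₂]` reads `k ∫ 1 / R = 0`, and the integral is not
zero because `1 / R` has constant phase on a band.
-/

namespace DefNLS

section ParametricIntegral

variable {α : Type*} [MeasurableSpace α] {μ : Measure α} {E : Type*} [NormedAddCommGroup E]
  [NormedSpace ℂ E]

theorem aestronglyMeasurable_deriv_of_eventually {F : ℂ → α → E} {z : ℂ}
    (hF : ∀ᶠ ζ in 𝓝 z, AEStronglyMeasurable (F ζ) μ)
    (hd : ∀ᵐ t ∂μ, DifferentiableAt ℂ (fun ζ => F ζ t) z) :
    AEStronglyMeasurable (fun t => deriv (fun ζ => F ζ t) z) μ := by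
  obtain ⟨s, hs⟩ := exists_seq_forall_of_frequently
    ((hF.filter_mono nhdsWithin_le_nhds).and self_mem_nhdsWithin : ∀ᶠ ζ in 𝓝[≠] z,
      AEStronglyMeasurable (F ζ) μ ∧ ζ ∈ ({z}ᶜ : Set ℂ)).frequently
  have hslope : ∀ n, AEStronglyMeasurable (fun t => slope (fun ζ => F ζ t) z (s n)) μ := fun n =>
    ((hs.2 n).1.sub hF.self_of_nhds).const_smul (s n - z)⁻¹
  refine aestronglyMeasurable_of_tendsto_ae atTop hslope ?_
  filter_upwards [hd] with t ht
  exact (hasDerivAt_iff_tendsto_slope.1 ht.hasDerivAt).comp hs.1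

theorem differentiableOn_integral_of_norm_le {U : Set ℂ} (hU : IsOpen U) {F : ℂ → α → E}
    {bound : α → ℝ} (hmeas : ∀ z ∈ U, AEStronglyMeasurable (F z) μ)
    (hF : ∀ᵐ t ∂μ, DifferentiableOn ℂ (fun z => F z t) U)
    (hle : ∀ᵐ t ∂μ, ∀ z ∈ U, ‖F z t‖ ≤ bound t) (hbound : Integrable bound μ) :
    DifferentiableOn ℂ (fun z => ∫ t, F z t ∂μ) U := by
  intro z hz
  obtain ⟨r, hr, hball⟩ := Metric.isOpen_iff.1 hU z hz
  have hclosedBall : ∀ ζ ∈ Metric.ball z (r / 2), Metric.closedBall ζ (r / 2) ⊆ U := by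
    refine fun ζ hζ => (Metric.closedBall_subset_ball' ?_).trans hball
    rw [Metric.mem_ball] at hζ
    linarith
  have hUz : ∀ᶠ ζ in 𝓝 z, AEStronglyMeasurable (F ζ) μ :=
    (hU.eventually_mem hz).mono hmeas
  refine (hasDerivAt_integral_of_dominated_loc_of_deriv_le (F := F)
    (F' := fun ζ t => deriv (fun η => F η t) ζ) (bound := fun t => bound t / (r / 2))
    (Metric.ball_mem_nhds z (half_pos hr)) hUz (hbound.mono' (hmeas z hz) ?_)
    (aestronglyMeasurable_deriv_of_eventually hUz ?_) ?_ (hbound.div_const _)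
    ?_).2.differentiableAt.differentiableWithinAt
  · filter_upwards [hle] with t ht using ht z hz
  · filter_upwards [hF] with t ht using ht.differentiableAt (hU.mem_nhds hz)
  · filter_upwards [hF, hle] with t ht hb ζ hζ
    refine Complex.norm_deriv_le_of_forall_mem_sphere_norm_le (half_pos hr) ?_ fun η hη =>
      hb η (hclosedBall ζ hζ (Metric.sphere_subset_closedBall hη))
    exact (ht.mono (hclosedBall ζ hζ)).diffContOnCl_ball subset_rfl
  · filter_upwards [hF] with t ht ζ hζ
    exact (ht.differentiableAt (hU.mem_nhds
      (hclosedBall ζ hζ (Metric.mem_closedBall_self (half_pos hr).le)))).hasDerivAt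

end ParametricIntegral

/-- The Cauchy transform `∫_Γ f(w) / (w - z) dw` of a function on a subset of the real line. -/
noncomputable def cauchyTransform (Γ : Set ℝ) (f : ℝ → ℂ) (z : ℂ) : ℂ :=
  ∫ w in Γ, f w / ((w : ℂ) - z)

section CauchyTransform

variable {Γ : Set ℝ} {f : ℝ → ℂ}

theorem aestronglyMeasurable_div_ofReal_sub (hf : IntegrableOn f Γ) (z : ℂ) :
    AEStronglyMeasurable (fun w : ℝ => f w / ((w : ℂ) - z)) (volume.restrict Γ) :=
  hf.aestronglyMeasurable.div₀ (by fun_prop)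

theorem isOpen_setOf_forall_ofReal_ne (hΓ : IsClosed Γ) :
    IsOpen {z : ℂ | ∀ w ∈ Γ, (w : ℂ) ≠ z} := by
  convert (Complex.isometry_ofReal.isClosedEmbedding.isClosedMap Γ hΓ).isOpen_compl using 1
  ext z
  simp

theorem differentiableAt_cauchyTransform (hΓ : IsClosed Γ) (hf : IntegrableOn f Γ) {z : ℂ}
    (hz : ∀ w ∈ Γ, (w : ℂ) ≠ z) : DifferentiableAt ℂ (cauchyTransform Γ f) z := by
  obtain ⟨r, hr, hball⟩ := Metric.isOpen_iff.1 (isOpen_setOf_forall_ofReal_ne hΓ) z hz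
  have hdist : ∀ w ∈ Γ, ∀ ζ ∈ Metric.ball z (r / 2), r / 2 ≤ ‖(w : ℂ) - ζ‖ := by
    intro w hw ζ hζ
    have hwz : r ≤ dist (w : ℂ) z := not_lt.1 fun h => hball h w hw rfl
    rw [Metric.mem_ball] at hζ
    rw [← dist_eq_norm]
    linarith [dist_triangle (w : ℂ) ζ z]
  have hmem : ∀ᵐ w ∂volume.restrict Γ, w ∈ Γ := ae_restrict_mem hΓ.measurableSet
  refine (differentiableOn_integral_of_norm_le Metric.isOpen_ball
    (F := fun ζ (w : ℝ) => f w / ((w : ℂ) - ζ)) (bound := fun w => ‖f w‖ / (r / 2))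
    (fun ζ _ => aestronglyMeasurable_div_ofReal_sub hf ζ) ?_ ?_
    (hf.norm.div_const _)).differentiableAt (Metric.ball_mem_nhds z (half_pos hr))
  · filter_upwards [hmem] with w hw ζ hζ
    refine DifferentiableAt.differentiableWithinAt ?_
    have hne : (w : ℂ) - ζ ≠ 0 := norm_pos_iff.1 ((half_pos hr).trans_le (hdist w hw ζ hζ))
    fun_prop (disch := exact hne)
  · filter_upwards [hmem] with w hw ζ hζ
    rw [norm_div]
    gcongr
    exact hdist w hw ζ hζ

theorem abs_im_le_norm_ofReal_sub (w : ℝ) (z : ℂ) : |z.im| ≤ ‖(w : ℂ) - z‖ := by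
  simpa using Complex.abs_im_le_norm ((w : ℂ) - z)

theorem ofReal_ne_of_im_ne_zero {z : ℂ} (hz : z.im ≠ 0) (w : ℝ) : (w : ℂ) ≠ z := by
  rintro rfl
  exact hz (Complex.ofReal_im w)

theorem tendsto_im_ofReal_nhds (a : ℝ) :
    Tendsto (fun z : ℂ => (z.im : ℂ)) (𝓝 (a : ℂ)) (𝓝 0) := by
  have hcont : Continuous fun z : ℂ => (z.im : ℂ) := by fun_prop
  simpa using hcont.tendsto (a : ℂ)

theorem tendsto_im_mul_cauchyTransform (hf : IntegrableOn f Γ) (a : ℝ) :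
    Tendsto (fun z : ℂ => (z.im : ℂ) * cauchyTransform Γ f z) (𝓝 (a : ℂ)) (𝓝 0) := by
  have key : Tendsto (fun z : ℂ => ∫ w in Γ, (z.im : ℂ) * (f w / ((w : ℂ) - z)))
      (𝓝 (a : ℂ)) (𝓝 (∫ _ in Γ, (0 : ℂ))) := by
    refine tendsto_integral_filter_of_dominated_convergence (fun w => ‖f w‖)
      (Eventually.of_forall fun z => (aestronglyMeasurable_div_ofReal_sub hf z).const_mul _)
      (Eventually.of_forall fun z => Eventually.of_forall fun w => ?_) hf.norm ?_
    · rw [norm_mul, norm_div, Complex.norm_real, Real.norm_eq_abs, mul_div_left_comm]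
      exact mul_le_of_le_one_right (norm_nonneg _)
        (div_le_one_of_le₀ (abs_im_le_norm_ofReal_sub w z) (norm_nonneg _))
    · filter_upwards [Measure.ae_ne (volume.restrict Γ) a] with w hw
      have hwa : (w : ℂ) - a ≠ 0 := sub_ne_zero.2 (by exact_mod_cast hw)
      have hquot : Tendsto (fun z : ℂ => f w / ((w : ℂ) - z)) (𝓝 (a : ℂ)) (𝓝 (f w / (w - a))) :=
        tendsto_const_nhds.div (tendsto_const_nhds.sub tendsto_id) hwa
      simpa using (tendsto_im_ofReal_nhds a).mul hquot
  simp only [integral_zero, integral_const_mul] at key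
  exact key

theorem norm_cauchyTransform_le (hΓ : MeasurableSet Γ) (hf : IntegrableOn f Γ) {r : ℝ}
    (hr : ∀ w ∈ Γ, |w| ≤ r) {z : ℂ} (hz : r < ‖z‖) :
    ‖cauchyTransform Γ f z‖ ≤ (∫ w in Γ, ‖f w‖) / (‖z‖ - r) := by
  rw [cauchyTransform, ← integral_div]
  refine norm_integral_le_of_norm_le (hf.norm.div_const _) ?_
  filter_upwards [ae_restrict_mem hΓ] with w hw
  have hdist : ‖z‖ - ‖(w : ℂ)‖ ≤ ‖(w : ℂ) - z‖ := norm_sub_rev (w : ℂ) z ▸ norm_sub_norm_le _ _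
  rw [Complex.norm_real, Real.norm_eq_abs] at hdist
  have : 0 < ‖z‖ - r := sub_pos.2 hz
  rw [norm_div]
  gcongr
  linarith [hr w hw]

open Asymptotics in
theorem cauchyTransform_isBigO_inv (hΓ : MeasurableSet Γ) (hf : IntegrableOn f Γ) {r : ℝ}
    (hr : ∀ w ∈ Γ, |w| ≤ r) :
    cauchyTransform Γ f =O[Bornology.cobounded ℂ] fun z => z⁻¹ := by
  refine IsBigO.of_bound ((∫ w in Γ, ‖f w‖) * 2) ?_
  filter_upwards [tendsto_norm_cobounded_atTop.eventually_gt_atTop 0,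
    tendsto_norm_cobounded_atTop.eventually_ge_atTop (2 * r)] with z hz₀ hz
  refine (norm_cauchyTransform_le hΓ hf hr (by linarith)).trans ?_
  rw [norm_inv, mul_assoc, div_eq_mul_inv]
  refine mul_le_mul_of_nonneg_left ?_ (integral_nonneg fun w => norm_nonneg _)
  rw [← div_eq_mul_inv, inv_eq_one_div, div_le_div_iff₀ (by linarith) hz₀]
  linarith

end CauchyTransform

section Dslope

variable {h : ℂ → ℂ}

theorem dslope_comm (h : ℂ → ℂ) (a b : ℂ) : dslope h a b = dslope h b a := by
  rcases eq_or_ne a b with rfl | hab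
  · rfl
  · rw [dslope_of_ne h hab, dslope_of_ne h hab.symm, slope_comm]

theorem norm_dslope_le {s : Set ℂ} (hs : Convex ℝ s) (hh : ∀ z ∈ s, DifferentiableAt ℂ h z) {C : ℝ}
    (hC : ∀ z ∈ s, ‖deriv h z‖ ≤ C) {a b : ℂ} (ha : a ∈ s) (hb : b ∈ s) : ‖dslope h a b‖ ≤ C := by
  rcases eq_or_ne b a with rfl | hab
  · rw [dslope_same]
    exact hC b hb
  · rw [dslope_of_ne h hab, slope_def_field, norm_div, div_le_iff₀ (norm_sub_pos_iff.2 hab)]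
    exact hs.norm_image_sub_le_of_norm_deriv_le hh hC ha hb

theorem div_ofReal_sub_eq_dslope_add (h : ℂ → ℂ) {w z : ℂ} (hwz : w ≠ z) :
    h w / (w - z) = dslope h w z + h z * (1 / (w - z)) := by
  rw [dslope_comm, dslope_of_ne h hwz, slope_def_field]
  ring

variable {x δ C : ℝ}

theorem ofReal_mem_ball {w : ℝ} (hw : w ∈ Metric.ball x δ) : (w : ℂ) ∈ Metric.ball (x : ℂ) δ := by
  rwa [Metric.mem_ball, Complex.isometry_ofReal.dist_eq]

theorem integrableOn_dslope (hh : DifferentiableOn ℂ h (Metric.ball (x : ℂ) δ))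
    (hC : ∀ z ∈ Metric.ball (x : ℂ) δ, ‖deriv h z‖ ≤ C) {z : ℂ}
    (hz : z ∈ Metric.ball (x : ℂ) δ) :
    IntegrableOn (fun w : ℝ => dslope h w z) (Metric.ball x δ) := by
  have hU : Metric.ball (x : ℂ) δ ∈ 𝓝 z := Metric.isOpen_ball.mem_nhds hz
  have hcont : ContinuousOn (fun w : ℝ => dslope h w z) (Metric.ball x δ) := by
    simp only [fun w : ℝ => dslope_comm h w z]
    exact ((Complex.differentiableOn_dslope hU).2 hh).continuousOn.comp
      Complex.continuous_ofReal.continuousOn fun w hw => ofReal_mem_ball hw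
  refine IntegrableOn.of_bound measure_ball_lt_top
    (hcont.aestronglyMeasurable measurableSet_ball) C ?_
  filter_upwards [ae_restrict_mem measurableSet_ball] with w hw
  exact norm_dslope_le (convex_ball _ _)
    (fun ζ hζ => hh.differentiableAt (Metric.isOpen_ball.mem_nhds hζ)) hC (ofReal_mem_ball hw) hz

theorem differentiableOn_integral_dslope (hh : DifferentiableOn ℂ h (Metric.ball (x : ℂ) δ))
    (hC : ∀ z ∈ Metric.ball (x : ℂ) δ, ‖deriv h z‖ ≤ C) :
    DifferentiableOn ℂ (fun z => ∫ w in Metric.ball x δ, dslope h (w : ℂ) z)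
      (Metric.ball (x : ℂ) δ) := by
  refine differentiableOn_integral_of_norm_le Metric.isOpen_ball (bound := fun _ => C)
    (fun z hz => (integrableOn_dslope hh hC hz).aestronglyMeasurable) ?_ ?_
    (integrableOn_const measure_ball_lt_top.ne)
  · filter_upwards [ae_restrict_mem measurableSet_ball] with w hw
    exact (Complex.differentiableOn_dslope (Metric.isOpen_ball.mem_nhds (ofReal_mem_ball hw))).2 hh
  · filter_upwards [ae_restrict_mem measurableSet_ball] with w hw z hz
    exact norm_dslope_le (convex_ball _ _)
      (fun ζ hζ => hh.differentiableAt (Metric.isOpen_ball.mem_nhds hζ)) hC (ofReal_mem_ball hw) hz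

end Dslope

section LogarithmicKernel

theorem log_neg_of_im_pos {z : ℂ} (hz : 0 < z.im) :
    Complex.log (-z) = Complex.log z - Real.pi * Complex.I := by
  rw [Complex.log, Complex.log, norm_neg, Complex.arg_neg_eq_arg_sub_pi_of_im_pos hz]
  push_cast
  ring

theorem log_neg_of_im_neg {z : ℂ} (hz : z.im < 0) :
    Complex.log (-z) = Complex.log z + Real.pi * Complex.I := by
  rw [Complex.log, Complex.log, norm_neg, Complex.arg_neg_eq_arg_add_pi_of_im_neg hz]
  push_cast
  ring

theorem integral_one_div_ofReal_sub (c d : ℝ) {z : ℂ} (hz : z.im ≠ 0) :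
    ∫ w : ℝ in c..d, 1 / ((w : ℂ) - z) = Complex.log (d - z) - Complex.log (c - z) := by
  have hslit : ∀ w : ℝ, (w : ℂ) - z ∈ Complex.slitPlane := fun w =>
    Complex.mem_slitPlane_iff.2 (Or.inr (by simpa using hz))
  refine intervalIntegral.integral_eq_sub_of_hasDerivAt
    (f := fun w : ℝ => Complex.log ((w : ℂ) - z)) (fun w _ => ?_) ?_
  · exact (((hasDerivAt_id (w : ℂ)).sub_const z).clog (hslit w)).comp_ofReal
  · refine Continuous.intervalIntegrable ?_ c d
    exact continuous_const.div (by fun_prop) fun w => Complex.slitPlane_ne_zero (hslit w)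

theorem setIntegral_ball_one_div_ofReal_sub {x δ : ℝ} (hδ : 0 < δ) {z : ℂ} (hz : z.im ≠ 0) :
    ∫ w in Metric.ball x δ, 1 / ((w : ℂ) - z) =
      Complex.log ((x + δ : ℝ) - z) - Complex.log ((x - δ : ℝ) - z) := by
  rw [Real.ball_eq_Ioo, ← integral_Ioc_eq_integral_Ioo,
    ← intervalIntegral.integral_of_le (by linarith), integral_one_div_ofReal_sub _ _ hz]

theorem integral_annulus_one_div_sub (x δ ε : ℝ) :
    ∫ w in Metric.ball x δ \ Metric.ball x ε, 1 / ((w : ℂ) - x) = 0 := by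
  set A : Set ℝ := Metric.ball x δ \ Metric.ball x ε
  have hA : MeasurableSet A := measurableSet_ball.diff measurableSet_ball
  set k : ℝ → ℂ := A.indicator fun w : ℝ => 1 / ((w : ℂ) - x)
  have hmem : ∀ w, 2 * x - w ∈ A ↔ w ∈ A := by
    have hdist : ∀ w, dist (2 * x - w) x = dist w x := fun w => by
      rw [Real.dist_eq, Real.dist_eq, abs_sub_comm w x]
      ring_nf
    exact fun w => by simp only [A, Set.mem_sdiff, Metric.mem_ball, hdist]
  have hodd : ∀ w, k (2 * x - w) = -k w := by
    intro w
    by_cases hw : w ∈ A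
    · simp only [k]
      rw [indicator_of_mem ((hmem w).2 hw), indicator_of_mem hw, ← one_div_neg_eq_neg_one_div]
      push_cast
      ring_nf
    · simp only [k]
      rw [indicator_of_notMem (mt (hmem w).1 hw), indicator_of_notMem hw, neg_zero]
  have hreflect : ∫ w, k w = -∫ w, k w := by
    rw [← integral_neg, ← integral_sub_left_eq_self k volume (2 * x)]
    simp only [hodd]
  rw [← integral_indicator hA]
  exact self_eq_neg.1 hreflect

end LogarithmicKernel

theorem tendsto_setIntegral_diff_ball {g : ℝ → ℂ} {S : Set ℝ} (hg : IntegrableOn g S) (x : ℝ) :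
    Tendsto (fun ε : ℝ => ∫ w in S \ Metric.ball x ε, g w) (𝓝[>] 0) (𝓝 (∫ w in S, g w)) := by
  have hcover : AECover (volume.restrict S) (𝓝[>] (0 : ℝ)) fun ε => (Metric.ball x ε)ᶜ := by
    refine ⟨?_, fun ε => measurableSet_ball.compl⟩
    filter_upwards [Measure.ae_ne (volume.restrict S) x] with w hw
    filter_upwards [mem_nhdsWithin_of_mem_nhds (eventually_lt_nhds (dist_pos.2 hw))] with ε hε
    simpa using hε.le
  refine (hcover.integral_tendsto_of_countably_generated hg).congr fun ε => ?_
  rw [Measure.restrict_restrict measurableSet_ball.compl, inter_comm, sdiff_eq]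

/-- The common part of the two analytic continuations of `cauchyTransform Γ f` across
`Metric.ball x δ ⊆ Γ`, when `f` agrees there with the holomorphic function `h`: the continuations
from the upper and the lower half plane are `plemeljMean ± π i h`. -/
noncomputable def plemeljMean (Γ : Set ℝ) (f : ℝ → ℂ) (h : ℂ → ℂ) (x δ : ℝ) (z : ℂ) : ℂ :=
  cauchyTransform (Γ \ Metric.ball x δ) f z + (∫ w in Metric.ball x δ, dslope h (w : ℂ) z) +
    h z * (Complex.log ((x + δ : ℝ) - z) - Complex.log (z - (x - δ : ℝ)))

section Plemelj

variable {Γ : Set ℝ} {f : ℝ → ℂ} {h : ℂ → ℂ} {x δ C : ℝ}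

theorem analyticAt_plemeljMean (hΓ : IsClosed Γ) (hf : IntegrableOn f Γ) (hδ : 0 < δ)
    (hh : DifferentiableOn ℂ h (Metric.ball (x : ℂ) δ))
    (hC : ∀ z ∈ Metric.ball (x : ℂ) δ, ‖deriv h z‖ ≤ C) :
    AnalyticAt ℂ (plemeljMean Γ f h x δ) x := by
  have hball : Metric.ball (x : ℂ) δ ∈ 𝓝 (x : ℂ) := Metric.ball_mem_nhds _ hδ
  have hcauchy : ∀ z ∈ Metric.ball (x : ℂ) δ,
      DifferentiableAt ℂ (cauchyTransform (Γ \ Metric.ball x δ) f) z := by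
    refine fun z hz => differentiableAt_cauchyTransform (hΓ.sdiff Metric.isOpen_ball)
      (hf.mono_set sdiff_subset) ?_
    rintro w hw rfl
    exact hw.2 (by rwa [Metric.mem_ball, Complex.isometry_ofReal.dist_eq] at hz)
  have hlog : AnalyticAt ℂ
      (fun z : ℂ => Complex.log ((x + δ : ℝ) - z) - Complex.log (z - (x - δ : ℝ))) x := by
    refine ((analyticAt_const.sub analyticAt_id).clog ?_).sub
      ((analyticAt_id.sub analyticAt_const).clog ?_)
    all_goals
      simp only [id, Pi.sub_apply, ← Complex.ofReal_sub, Complex.ofReal_mem_slitPlane]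
      linarith
  have hreg : DifferentiableOn ℂ (fun z => cauchyTransform (Γ \ Metric.ball x δ) f z +
      ∫ w in Metric.ball x δ, dslope h (w : ℂ) z) (Metric.ball (x : ℂ) δ) :=
    DifferentiableOn.add (fun z hz => (hcauchy z hz).differentiableWithinAt)
      (differentiableOn_integral_dslope hh hC)
  exact (hreg.analyticAt hball).add ((hh.analyticAt hball).mul hlog)

theorem integrableOn_div_ofReal_sub {A : Set ℝ} (hA : MeasurableSet A) (hf : IntegrableOn f A)
    {z : ℂ} {ρ : ℝ} (hρ : 0 < ρ) (hdist : ∀ w ∈ A, ρ ≤ ‖(w : ℂ) - z‖) :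
    IntegrableOn (fun w : ℝ => f w / ((w : ℂ) - z)) A := by
  refine (hf.norm.div_const ρ).mono' (aestronglyMeasurable_div_ofReal_sub hf z) ?_
  filter_upwards [ae_restrict_mem hA] with w hw
  rw [norm_div]
  gcongr
  exact hdist w hw

theorem setIntegral_div_ofReal_sub_eq_add (hΓ : MeasurableSet Γ) (hf : IntegrableOn f Γ)
    (hΓx : Metric.ball x δ ⊆ Γ) (hh : DifferentiableOn ℂ h (Metric.ball (x : ℂ) δ))
    (hC : ∀ z ∈ Metric.ball (x : ℂ) δ, ‖deriv h z‖ ≤ C)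
    (hfh : ∀ w ∈ Metric.ball x δ, f w = h w) {B : Set ℝ} (hB : MeasurableSet B)
    (hBx : B ⊆ Metric.ball x δ) {z : ℂ} (hz : z ∈ Metric.ball (x : ℂ) δ) {ρ : ℝ} (hρ : 0 < ρ)
    (hdist : ∀ w ∉ B, ρ ≤ ‖(w : ℂ) - z‖) :
    ∫ w in Γ \ B, f w / ((w : ℂ) - z) =
      cauchyTransform (Γ \ Metric.ball x δ) f z + (∫ w in Metric.ball x δ \ B, dslope h (w : ℂ) z) +
        h z * ∫ w in Metric.ball x δ \ B, 1 / ((w : ℂ) - z) := by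
  have hunion : Γ \ B = Γ \ Metric.ball x δ ∪ Metric.ball x δ \ B := by
    rw [sdiff_union_sdiff_cancel hΓx hBx]
  have hmeas : MeasurableSet (Metric.ball x δ \ B) := measurableSet_ball.diff hB
  have hint : IntegrableOn (fun w : ℝ => f w / ((w : ℂ) - z)) (Γ \ B) :=
    integrableOn_div_ofReal_sub (hΓ.diff hB) (hf.mono_set sdiff_subset) hρ
      fun w hw => hdist w hw.2
  have hinv : IntegrableOn (fun w : ℝ => 1 / ((w : ℂ) - z)) (Metric.ball x δ \ B) :=
    integrableOn_div_ofReal_sub hmeas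
      (integrableOn_const ((measure_mono sdiff_subset).trans_lt measure_ball_lt_top).ne) hρ
      fun w hw => hdist w hw.2
  have hsplit : EqOn (fun w : ℝ => f w / ((w : ℂ) - z))
      (fun w : ℝ => dslope h (w : ℂ) z + h z * (1 / ((w : ℂ) - z))) (Metric.ball x δ \ B) := by
    intro w hw
    have hwz : (w : ℂ) ≠ z := sub_ne_zero.1 (norm_pos_iff.1 (hρ.trans_le (hdist w hw.2)))
    simp only [hfh w hw.1, div_ofReal_sub_eq_dslope_add h hwz]
  rw [hunion] at hint ⊢
  rw [setIntegral_union (disjoint_sdiff_left.mono_right sdiff_subset) hmeas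
    hint.left_of_union hint.right_of_union, setIntegral_congr_fun hmeas hsplit,
    integral_add ((integrableOn_dslope hh hC hz).mono_set sdiff_subset) (hinv.const_mul _),
    integral_const_mul, ← add_assoc, cauchyTransform]

theorem cauchyTransform_eq_plemeljMean_add (hΓ : MeasurableSet Γ) (hf : IntegrableOn f Γ)
    (hΓx : Metric.ball x δ ⊆ Γ) (hh : DifferentiableOn ℂ h (Metric.ball (x : ℂ) δ))
    (hC : ∀ z ∈ Metric.ball (x : ℂ) δ, ‖deriv h z‖ ≤ C)
    (hfh : ∀ w ∈ Metric.ball x δ, f w = h w) {z : ℂ} (hz : z ∈ Metric.ball (x : ℂ) δ)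
    (hz0 : z.im ≠ 0) :
    cauchyTransform Γ f z = plemeljMean Γ f h x δ z +
      h z * (Complex.log (z - (x - δ : ℝ)) - Complex.log (-(z - (x - δ : ℝ)))) := by
  have hδ : 0 < δ := dist_nonneg.trans_lt (Metric.mem_ball.1 hz)
  have hsplit := setIntegral_div_ofReal_sub_eq_add hΓ hf hΓx hh hC hfh MeasurableSet.empty
    (empty_subset _) hz (abs_pos.2 hz0) fun w _ => abs_im_le_norm_ofReal_sub w z
  simp only [sdiff_empty, setIntegral_ball_one_div_ofReal_sub hδ hz0] at hsplit
  rw [cauchyTransform, hsplit, plemeljMean, neg_sub]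
  ring

theorem hasFiniteHilbertTransform_plemeljMean (hΓ : MeasurableSet Γ) (hf : IntegrableOn f Γ)
    (hδ : 0 < δ) (hΓx : Metric.ball x δ ⊆ Γ) (hh : DifferentiableOn ℂ h (Metric.ball (x : ℂ) δ))
    (hC : ∀ z ∈ Metric.ball (x : ℂ) δ, ‖deriv h z‖ ≤ C)
    (hfh : ∀ w ∈ Metric.ball x δ, f w = h w) :
    HasFiniteHilbertTransform Γ f x (1 / Real.pi * plemeljMean Γ f h x δ x) := by
  have hx : (x : ℂ) ∈ Metric.ball (x : ℂ) δ := Metric.mem_ball_self hδ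
  have htruncated : ∀ᶠ ε in 𝓝[>] (0 : ℝ), ∫ w in Γ \ Metric.ball x ε, f w / ((w - x : ℝ) : ℂ) =
      cauchyTransform (Γ \ Metric.ball x δ) f x +
        ∫ w in Metric.ball x δ \ Metric.ball x ε, dslope h (w : ℂ) x := by
    filter_upwards [self_mem_nhdsWithin, mem_nhdsWithin_of_mem_nhds (eventually_lt_nhds hδ)]
      with ε hε hεδ
    have hdist : ∀ w ∉ Metric.ball x ε, ε ≤ ‖(w : ℂ) - x‖ := fun w hw => by
      rwa [← dist_eq_norm, Complex.isometry_ofReal.dist_eq, ← not_lt]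
    simp only [Complex.ofReal_sub, setIntegral_div_ofReal_sub_eq_add hΓ hf hΓx hh hC hfh
      measurableSet_ball (Metric.ball_subset_ball hεδ.le) hx hε hdist,
      integral_annulus_one_div_sub, mul_zero, add_zero]
  have hmean : plemeljMean Γ f h x δ x =
      cauchyTransform (Γ \ Metric.ball x δ) f x + ∫ w in Metric.ball x δ, dslope h (w : ℂ) x := by
    rw [plemeljMean, ← Complex.ofReal_sub, ← Complex.ofReal_sub, add_sub_cancel_left,
      sub_sub_cancel, sub_self, mul_zero, add_zero]
  rw [HasFiniteHilbertTransform, hmean]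
  refine Tendsto.const_mul _ ((tendsto_const_nhds.add
    (tendsto_setIntegral_diff_ball (integrableOn_dslope hh hC hx) x)).congr' ?_)
  filter_upwards [htruncated] with ε hε using hε.symm

theorem exists_ball_differentiableOn_norm_deriv_le (hh : AnalyticAt ℂ h x) (hΓx : Γ ∈ 𝓝 x)
    (hfh : ∀ᶠ w in 𝓝 x, f w = h w) :
    ∃ δ > 0, ∃ C, Metric.ball x δ ⊆ Γ ∧ (∀ w ∈ Metric.ball x δ, f w = h w) ∧
      DifferentiableOn ℂ h (Metric.ball (x : ℂ) δ) ∧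
      ∀ z ∈ Metric.ball (x : ℂ) δ, ‖deriv h z‖ ≤ C := by
  have hderiv : ∀ᶠ z in 𝓝 (x : ℂ), ‖deriv h z‖ ≤ ‖deriv h x‖ + 1 := by
    filter_upwards [hh.deriv.continuousAt.norm.eventually_lt_const (lt_add_one _)] with z hz
      using hz.le
  obtain ⟨r, hr, hreal⟩ := Metric.eventually_nhds_iff_ball.1 (hfh.and hΓx)
  obtain ⟨s, hs, hcomplex⟩ :=
    Metric.eventually_nhds_iff_ball.1 (hh.eventually_analyticAt.and hderiv)
  have hsub_r : Metric.ball x (min r s) ⊆ Metric.ball x r :=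
    Metric.ball_subset_ball (min_le_left r s)
  have hsub_s : Metric.ball (x : ℂ) (min r s) ⊆ Metric.ball (x : ℂ) s :=
    Metric.ball_subset_ball (min_le_right r s)
  exact ⟨min r s, lt_min hr hs, ‖deriv h x‖ + 1, fun w hw => (hreal w (hsub_r hw)).2,
    fun w hw => (hreal w (hsub_r hw)).1,
    fun z hz => (hcomplex z (hsub_s hz)).1.differentiableAt.differentiableWithinAt,
    fun z hz => (hcomplex z (hsub_s hz)).2⟩

theorem exists_analyticAt_cauchyTransform_eq (hΓ : IsClosed Γ) (hΓx : Γ ∈ 𝓝 x)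
    (hf : IntegrableOn f Γ) (hh : AnalyticAt ℂ h x) (hfh : ∀ᶠ w in 𝓝 x, f w = h w) :
    ∃ H : ℂ → ℂ, AnalyticAt ℂ H x ∧ HasFiniteHilbertTransform Γ f x (1 / Real.pi * H x) ∧
      ∀ᶠ z in 𝓝 (x : ℂ),
        (0 < z.im → cauchyTransform Γ f z = H z + Real.pi * Complex.I * h z) ∧
        (z.im < 0 → cauchyTransform Γ f z = H z - Real.pi * Complex.I * h z) := by
  obtain ⟨δ, hδ, C, hball, hfh, hd, hC⟩ := exists_ball_differentiableOn_norm_deriv_le hh hΓx hfh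
  refine ⟨plemeljMean Γ f h x δ, analyticAt_plemeljMean hΓ hf hδ hd hC,
    hasFiniteHilbertTransform_plemeljMean hΓ.measurableSet hf hδ hball hd hC hfh, ?_⟩
  filter_upwards [Metric.ball_mem_nhds (x : ℂ) hδ] with z hz
  have him : (z - (x - δ : ℝ)).im = z.im := by simp
  constructor <;> intro hz0
  · rw [cauchyTransform_eq_plemeljMean_add hΓ.measurableSet hf hball hd hC hfh hz hz0.ne',
      log_neg_of_im_pos (him.symm ▸ hz0)]
    ring
  · rw [cauchyTransform_eq_plemeljMean_add hΓ.measurableSet hf hball hd hC hfh hz hz0.ne,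
      log_neg_of_im_neg (him.symm ▸ hz0)]
    ring

end Plemelj

section RemovableSingularity

theorem norm_sub_sq_sub_sq_of_norm_sub_eq {c ρ : ℝ} {w : ℂ} (hw : ‖w - c‖ = ρ) :
    ‖(w - c) ^ 2 - (ρ : ℂ) ^ 2‖ = 2 * ρ * |w.im| := by
  have hconj : (ρ : ℂ) ^ 2 = (w - c) * (starRingEnd ℂ) (w - c) := by rw [Complex.mul_conj', hw]
  have hfactor : (w - c) ^ 2 - (ρ : ℂ) ^ 2 = (w - c) * ((2 * w.im : ℝ) * Complex.I) := by
    rw [hconj, sq, ← mul_sub, Complex.sub_conj]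
    simp
  rw [hfactor, norm_mul, norm_mul, hw, Complex.norm_I, Complex.norm_real, Real.norm_eq_abs,
    abs_mul, abs_two]
  ring

theorem norm_mul_norm_sub_sq_sub_sq_le {g : ℂ → ℂ} {c ρ ε : ℝ} (hρ : 0 < ρ)
    (hg : DifferentiableOn ℂ g (Metric.closedBall (c : ℂ) ρ))
    (hε : ∀ w : ℂ, ‖w - c‖ = ρ → |w.im| * ‖g w‖ ≤ ε) {z : ℂ} (hz : ‖z - c‖ ≤ ρ) :
    ‖g z‖ * ‖(z - c) ^ 2 - (ρ : ℂ) ^ 2‖ ≤ 2 * ρ * ε := by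
  -- On the circle the second factor has modulus `2ρ|im w|`, which cancels the admissible growth
  -- of `g` at the two real points.
  have hclosure := closure_ball (c : ℂ) hρ.ne'
  rw [← norm_mul]
  refine Complex.norm_le_of_forall_mem_frontier_norm_le
    (f := fun w => g w * ((w - c) ^ 2 - (ρ : ℂ) ^ 2)) Metric.isBounded_ball
    (DifferentiableOn.diffContOnCl ?_) (fun w hw => ?_) (hclosure ▸ mem_closedBall_iff_norm.2 hz)
  · exact hclosure ▸ hg.mul (by fun_prop)
  · rw [frontier_ball _ hρ.ne', mem_sphere_iff_norm] at hw
    rw [norm_mul, norm_sub_sq_sub_sq_of_norm_sub_eq hw]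
    calc ‖g w‖ * (2 * ρ * |w.im|) = 2 * ρ * (|w.im| * ‖g w‖) := by ring
      _ ≤ 2 * ρ * ε := by gcongr; exact hε w hw

theorem norm_mul_norm_sub_le_of_abs_im_mul_le {g : ℂ → ℂ} {c r ε : ℝ}
    (hg : DifferentiableOn ℂ g (Metric.ball (c : ℂ) r \ {(c : ℂ)}))
    (hε : ∀ z ∈ Metric.ball (c : ℂ) r, |z.im| * ‖g z‖ ≤ ε) {z : ℂ} (hz : ‖z - c‖ < r / 2) :
    ‖g z‖ * ‖z - c‖ ≤ 6 * ε := by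
  have hε0 : 0 ≤ ε := (by positivity : 0 ≤ |z.im| * ‖g z‖).trans
    (hε z (mem_ball_iff_norm.2 (by linarith [norm_nonneg (z - c)])))
  have hre : |z.re - c| ≤ ‖z - c‖ := by simpa using Complex.abs_re_le_norm (z - c)
  have hnorm : ‖z - c‖ ≤ |z.re - c| + |z.im| := by
    simpa using Complex.norm_le_abs_re_add_abs_im (z - c)
  have hz_sub : z - z.re = z.im * Complex.I := by apply Complex.ext <;> simp
  have hcenter : ‖(z.re : ℂ) - c‖ = |z.re - c| := by
    rw [← Complex.ofReal_sub, Complex.norm_real, Real.norm_eq_abs]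
  set ρ : ℝ := |z.re - c| / 2 with hρ
  rcases le_or_gt ρ |z.im| with him | him
  · calc ‖g z‖ * ‖z - c‖ ≤ ‖g z‖ * (3 * |z.im|) := by gcongr; linarith
      _ = 3 * (|z.im| * ‖g z‖) := by ring
      _ ≤ 3 * ε := by gcongr; exact hε z (mem_ball_iff_norm.2 (by linarith [norm_nonneg (z - c)]))
      _ ≤ 6 * ε := by linarith
  · have hρ0 : 0 < ρ := (abs_nonneg _).trans_lt him
    have hsub : Metric.closedBall (z.re : ℂ) ρ ⊆ Metric.ball (c : ℂ) r \ {(c : ℂ)} := by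
      intro w hw
      rw [mem_closedBall_iff_norm] at hw
      refine ⟨mem_ball_iff_norm.2 ?_, ?_⟩
      · linarith [norm_sub_le_norm_sub_add_norm_sub w (z.re : ℂ) (c : ℂ)]
      · rintro rfl
        rw [norm_sub_rev, hcenter] at hw
        linarith
    have hmax := norm_mul_norm_sub_sq_sub_sq_le hρ0 (hg.mono hsub) (z := z)
      (fun w hw => hε w (hsub (mem_closedBall_iff_norm.2 hw.le)).1)
      (by rw [hz_sub]; simpa using him.le)
    have hfactor : (z - z.re) ^ 2 - (ρ : ℂ) ^ 2 = ((-(z.im ^ 2 + ρ ^ 2) : ℝ) : ℂ) := by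
      rw [hz_sub, mul_pow, Complex.I_sq]
      push_cast
      ring
    rw [hfactor, Complex.norm_real, norm_neg, Real.norm_of_nonneg (by positivity)] at hmax
    have hgρ : ‖g z‖ * ρ ≤ 2 * ε := by
      refine le_of_mul_le_mul_right ?_ hρ0
      linarith [mul_nonneg (norm_nonneg (g z)) (sq_nonneg z.im)]
    calc ‖g z‖ * ‖z - c‖ ≤ ‖g z‖ * (3 * ρ) := by gcongr; linarith
      _ ≤ 6 * ε := by linarith

theorem tendsto_sub_mul_of_tendsto_im_mul {g : ℂ → ℂ} {c : ℝ}
    (hg : ∀ᶠ z in 𝓝[≠] (c : ℂ), DifferentiableAt ℂ g z)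
    (him : Tendsto (fun z : ℂ => (z.im : ℂ) * g z) (𝓝 (c : ℂ)) (𝓝 0)) :
    Tendsto (fun z : ℂ => (z - c) * g z) (𝓝 (c : ℂ)) (𝓝 0) := by
  rw [NormedAddGroup.tendsto_nhds_zero] at him ⊢
  intro ε hε
  obtain ⟨r, hr, hball⟩ := Metric.eventually_nhds_iff_ball.1
    ((him (ε / 12) (by positivity)).and (eventually_nhdsWithin_iff.1 hg))
  have hle : ∀ z ∈ Metric.ball (c : ℂ) r, |z.im| * ‖g z‖ ≤ ε / 12 := fun z hz => by
    simpa using (hball z hz).1.le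
  filter_upwards [Metric.ball_mem_nhds (c : ℂ) (half_pos hr)] with z hz
  have := norm_mul_norm_sub_le_of_abs_im_mul_le
    (fun w hw => ((hball w hw.1).2 hw.2).differentiableWithinAt) hle (mem_ball_iff_norm.1 hz)
  rw [norm_mul, mul_comm]
  linarith

theorem exists_analyticAt_of_tendsto_im_mul {g : ℂ → ℂ} {c : ℝ}
    (hg : ∀ᶠ z in 𝓝[≠] (c : ℂ), DifferentiableAt ℂ g z)
    (him : Tendsto (fun z : ℂ => (z.im : ℂ) * g z) (𝓝 (c : ℂ)) (𝓝 0)) :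
    ∃ H : ℂ → ℂ, AnalyticAt ℂ H c ∧ ∀ z : ℂ, z ≠ c → g z = H z := by
  set k : ℂ → ℂ := fun z => (z - c) * g z
  have hk : AnalyticAt ℂ k c := by
    refine Complex.analyticAt_of_differentiable_on_punctured_nhds_of_continuousAt ?_ ?_
    · filter_upwards [hg] with z hz
      exact (differentiableAt_id.sub_const _).mul hz
    · simpa [ContinuousAt, k] using tendsto_sub_mul_of_tendsto_im_mul hg him
  obtain ⟨p, hp⟩ := hk
  refine ⟨dslope k c, hp.has_fpower_series_dslope_fslope.analyticAt, fun z hz => ?_⟩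
  rw [dslope_of_ne k hz, slope_def_field]
  simp only [k, sub_self, zero_mul, sub_zero]
  exact (mul_div_cancel_left₀ _ (sub_ne_zero.2 hz)).symm

end RemovableSingularity

/-- `D` agrees off the real line, near `z`, with a function that is analytic at `z`. The values of
`D` on the real line play no role, so `D` may have a removable jump there. -/
def ExtendsAnalyticallyAt (D : ℂ → ℂ) (z : ℂ) : Prop :=
  ∃ H : ℂ → ℂ, AnalyticAt ℂ H z ∧ ∀ᶠ w in 𝓝 z, w.im ≠ 0 → D w = H w

/-- The value at `z` of the analytic extension of `D` across the real line, a junk value unless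
`ExtendsAnalyticallyAt D z`. -/
noncomputable def acrossReal (D : ℂ → ℂ) (z : ℂ) : ℂ :=
  limUnder (𝓝[{w : ℂ | w.im ≠ 0}] z) D

section AnalyticExtension

variable {D : ℂ → ℂ} {z : ℂ}

instance neBot_nhdsWithin_im_ne_zero (z : ℂ) : (𝓝[{w : ℂ | w.im ≠ 0}] z).NeBot :=
  mem_closure_iff_nhdsWithin_neBot.1
    ((dense_compl_singleton (0 : ℝ)).preimage Complex.isOpenMap_im z)

theorem acrossReal_eventuallyEq {H : ℂ → ℂ} (hH : AnalyticAt ℂ H z)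
    (hDH : ∀ᶠ w in 𝓝 z, w.im ≠ 0 → D w = H w) : acrossReal D =ᶠ[𝓝 z] H := by
  filter_upwards [hH.eventually_analyticAt, hDH.eventually_nhds] with w hw hDw
  refine Tendsto.limUnder_eq ((hw.continuousAt.tendsto.mono_left nhdsWithin_le_nhds).congr' ?_)
  filter_upwards [eventually_nhdsWithin_iff.2 hDw] with v hv using hv.symm

theorem ExtendsAnalyticallyAt.analyticAt_acrossReal (hD : ExtendsAnalyticallyAt D z) :
    AnalyticAt ℂ (acrossReal D) z := by
  obtain ⟨H, hH, hDH⟩ := hD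
  exact hH.congr (acrossReal_eventuallyEq hH hDH).symm

theorem ExtendsAnalyticallyAt.acrossReal_eq (hD : ExtendsAnalyticallyAt D z) (hz : z.im ≠ 0) :
    acrossReal D z = D z := by
  obtain ⟨H, hH, hDH⟩ := hD
  rw [(acrossReal_eventuallyEq hH hDH).self_of_nhds, hDH.self_of_nhds hz]

theorem extendsAnalyticallyAt_of_tendsto_im_mul {c : ℝ}
    (hD : ∀ᶠ z in 𝓝[≠] (c : ℂ), ExtendsAnalyticallyAt D z)
    (him : Tendsto (fun z : ℂ => (z.im : ℂ) * D z) (𝓝 (c : ℂ)) (𝓝 0)) :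
    ExtendsAnalyticallyAt D c := by
  have heq : ∀ᶠ z in 𝓝 (c : ℂ), z.im ≠ 0 → acrossReal D z = D z := by
    filter_upwards [eventually_nhdsWithin_iff.1 hD] with z hz him
    exact (hz (ofReal_ne_of_im_ne_zero him c).symm).acrossReal_eq him
  obtain ⟨H, hH, hHeq⟩ := exists_analyticAt_of_tendsto_im_mul
    (hD.mono fun z hz => hz.analyticAt_acrossReal.differentiableAt) (him.congr' (by
      filter_upwards [heq] with z hz
      rcases eq_or_ne z.im 0 with him | him
      · simp only [him, Complex.ofReal_zero, zero_mul]
      · rw [hz him]))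
  refine ⟨H, hH, ?_⟩
  filter_upwards [heq] with z hz him
  rw [← hz him, hHeq z (ofReal_ne_of_im_ne_zero him c).symm]

theorem extendsAnalyticallyAt_of_finite {S : Set ℝ} (hS : S.Finite)
    (hD : ∀ z ∉ ((↑) '' S : Set ℂ), ExtendsAnalyticallyAt D z)
    (him : ∀ c ∈ S, Tendsto (fun z : ℂ => (z.im : ℂ) * D z) (𝓝 (c : ℂ)) (𝓝 0)) (z : ℂ) :
    ExtendsAnalyticallyAt D z := by
  by_cases hz : z ∈ ((↑) '' S : Set ℂ)
  · obtain ⟨c, hc, rfl⟩ := hz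
    refine extendsAnalyticallyAt_of_tendsto_im_mul ?_ (him c hc)
    have hclosed : IsClosed (((↑) '' S : Set ℂ) \ {(c : ℂ)}) :=
      ((hS.image _).subset sdiff_subset).isClosed
    filter_upwards [mem_nhdsWithin_of_mem_nhds (hclosed.isOpen_compl.mem_nhds fun h => h.2 rfl),
      self_mem_nhdsWithin] with w hw hwc
    exact hD w fun hwS => hw ⟨hwS, hwc⟩
  · exact hD z hz

theorem exists_eqOn_const_of_norm_le (hD : ∀ z, ExtendsAnalyticallyAt D z) {C : ℝ}
    (hC : ∀ᶠ z in Bornology.cobounded ℂ, z.im ≠ 0 → ‖D z‖ ≤ C) :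
    ∃ c, ∀ z, z.im ≠ 0 → D z = c := by
  have hE : Differentiable ℂ (acrossReal D) := fun z =>
    (hD z).analyticAt_acrossReal.differentiableAt
  obtain ⟨r, -, hr⟩ := hasBasis_cobounded_norm.eventually_iff.1 hC
  have hout : ∀ z : ℂ, r < ‖z‖ → ‖acrossReal D z‖ ≤ C := by
    intro z hz
    refine le_of_tendsto ((hE z).continuousAt.norm.tendsto.mono_left
      (nhdsWithin_le_nhds (s := {w : ℂ | w.im ≠ 0}))) ?_
    filter_upwards [self_mem_nhdsWithin, mem_nhdsWithin_of_mem_nhds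
      (continuous_norm.continuousAt.eventually_const_lt hz)] with w hw0 hw
    exact (hD w).acrossReal_eq hw0 ▸ hr hw.le hw0
  have hrange : range (acrossReal D) ⊆
      acrossReal D '' Metric.closedBall 0 r ∪ Metric.closedBall 0 C := by
    rintro _ ⟨z, rfl⟩
    rcases le_or_gt ‖z‖ r with hz | hz
    · exact Or.inl ⟨z, by simpa using hz, rfl⟩
    · exact Or.inr (by simpa using hout z hz)
  obtain ⟨c, hc⟩ := hE.exists_const_forall_eq_of_bounded
    ((((isCompact_closedBall 0 r).image hE.continuous).isBounded.union
      Metric.isBounded_closedBall).subset hrange)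
  exact ⟨c, fun z hz => (hD z).acrossReal_eq hz ▸ hc z⟩

end AnalyticExtension

section SquareRoots

theorem complexSqrt_sq (z : ℂ) : z.sqrt ^ 2 = z :=
  Complex.cpow_ofNat_inv_pow z 2

theorem complexSqrt_eq_zero_iff {z : ℂ} : z.sqrt = 0 ↔ z = 0 := by
  refine ⟨fun h => ?_, fun h => by rw [h, Complex.sqrt_zero]⟩
  rw [← complexSqrt_sq z, h, zero_pow two_ne_zero]

theorem complexSqrt_eq_exp {z : ℂ} (hz : z ≠ 0) : z.sqrt = Complex.exp (Complex.log z / 2) := by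
  rw [Complex.sqrt, Complex.cpow_def_of_ne_zero hz, div_eq_mul_inv]

theorem complexSqrt_div {z w : ℂ} (hz : z ≠ 0) (hw : w ≠ 0)
    (h : z.arg - w.arg ∈ Ioc (-Real.pi) Real.pi) : (z / w).sqrt = z.sqrt / w.sqrt := by
  have hlog : Complex.log (z / w) = Complex.log z - Complex.log w := by
    rw [← Complex.log_exp (x := Complex.log z - Complex.log w), Complex.exp_sub,
      Complex.exp_log hz, Complex.exp_log hw]
    · simpa only [Complex.sub_im, Complex.log_im] using h.1
    · simpa only [Complex.sub_im, Complex.log_im] using h.2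
  rw [complexSqrt_eq_exp (div_ne_zero hz hw), hlog, sub_div, Complex.exp_sub,
    complexSqrt_eq_exp hz, complexSqrt_eq_exp hw]

theorem complexSqrt_ofReal {x : ℝ} (hx : 0 ≤ x) : (x : ℂ).sqrt = (√x : ℂ) :=
  Complex.sqrt_of_nonneg (by exact_mod_cast hx)

theorem complexSqrt_ofReal_of_nonpos {x : ℝ} (hx : x ≤ 0) :
    (x : ℂ).sqrt = Complex.I * (-x : ℂ).sqrt := by
  have h := Complex.sqrt_neg_of_nonneg (a := -x) (by exact_mod_cast neg_nonneg.2 hx)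
  rwa [neg_neg] at h

theorem complexSqrt_of_im_pos {z : ℂ} (hz : 0 < z.im) : z.sqrt = Complex.I * (-z).sqrt := by
  have hz0 : z ≠ 0 := by rintro rfl; exact hz.ne rfl
  rw [complexSqrt_eq_exp hz0, complexSqrt_eq_exp (neg_ne_zero.2 hz0), log_neg_of_im_pos hz,
    sub_div, Complex.exp_sub, mul_div_right_comm, Complex.exp_pi_div_two_mul_I,
    mul_div_cancel₀ _ Complex.I_ne_zero]

theorem complexSqrt_of_im_neg {z : ℂ} (hz : z.im < 0) : z.sqrt = -Complex.I * (-z).sqrt := by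
  have h := complexSqrt_of_im_pos (z := -z) (by simpa using hz)
  rw [neg_neg] at h
  rw [h, ← mul_assoc, neg_mul, Complex.I_mul_I, neg_neg, one_mul]

theorem tendsto_complexSqrt_upper (x : ℝ) :
    Tendsto Complex.sqrt (𝓝[{z : ℂ | 0 < z.im}] (x : ℂ)) (𝓝 (x : ℂ).sqrt) := by
  rcases le_or_gt 0 x with hx | hx
  · exact (Complex.continuousAt_sqrt (Or.inl (by simpa using hx))).mono_left nhdsWithin_le_nhds
  · have hcont : ContinuousAt (fun z : ℂ => (-z).sqrt) (x : ℂ) :=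
      (Complex.continuousAt_sqrt (Or.inl (by simpa using hx.le))).comp continuousAt_neg
    rw [complexSqrt_ofReal_of_nonpos hx.le]
    refine Tendsto.congr' ?_ ((hcont.mono_left nhdsWithin_le_nhds).const_mul Complex.I)
    filter_upwards [self_mem_nhdsWithin] with z hz using (complexSqrt_of_im_pos hz).symm

theorem arg_sub_sub_arg_sub_mem_Ioc {a b : ℝ} (hab : a ≤ b) (z : ℂ) :
    (z - b).arg - (z - a).arg ∈ Ioc (-Real.pi) Real.pi := by
  have hpi := Real.pi_pos
  have him (c : ℝ) : (z - c).im = z.im := by simp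
  rcases lt_or_ge z.im 0 with h | h
  · have ha := Complex.arg_neg_iff.2 ((him a).trans_lt h)
    have hb := Complex.arg_neg_iff.2 ((him b).trans_lt h)
    constructor <;> linarith [Complex.neg_pi_lt_arg (z - a), Complex.neg_pi_lt_arg (z - b)]
  have ha := Complex.arg_nonneg_iff.2 (h.trans_eq (him a).symm)
  have hb := Complex.arg_nonneg_iff.2 (h.trans_eq (him b).symm)
  rcases (Complex.arg_le_pi (z - a)).eq_or_lt with h_eq | hlt
  · obtain ⟨hre, him0⟩ := Complex.arg_eq_pi_iff.1 h_eq
    have hb_pi : (z - b).arg = Real.pi := by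
      refine Complex.arg_eq_pi_iff.2 ⟨?_, (him b).trans ((him a).symm.trans him0)⟩
      simp only [Complex.sub_re, Complex.ofReal_re] at hre ⊢
      linarith
    rw [h_eq, hb_pi, sub_self]
    exact ⟨neg_neg_of_pos hpi, hpi.le⟩
  · constructor <;> linarith [Complex.arg_le_pi (z - b)]

theorem cutRoot_eq_complexSqrt_mul {a b : ℝ} (hab : a ≤ b) (z : ℂ) :
    cutRoot a b z = (z - a).sqrt * (z - b).sqrt := by
  rcases eq_or_ne (z - a) 0 with ha | ha
  · simp only [cutRoot, ha, Complex.sqrt_zero, zero_mul]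
  rcases eq_or_ne (z - b) 0 with hb | hb
  · simp only [cutRoot, hb, Complex.sqrt_zero, zero_div, mul_zero]
    rw [Complex.zero_cpow (by norm_num), mul_zero]
  have hsqrt : (z - a).sqrt ≠ 0 := complexSqrt_eq_zero_iff.not.2 ha
  rw [cutRoot, one_div, ← Complex.sqrt, complexSqrt_div hb ha (arg_sub_sub_arg_sub_mem_Ioc hab z),
    mul_div_assoc', div_eq_iff hsqrt]
  linear_combination (-(z - b).sqrt) * complexSqrt_sq (z - a)

theorem sub_div_sub_mem_slitPlane {a b : ℝ} (hab : a ≤ b) {z : ℂ}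
    (hz : ∀ x ∈ Icc a b, (x : ℂ) ≠ z) : (z - b) / (z - a) ∈ Complex.slitPlane := by
  have hza : z - a ≠ 0 := sub_ne_zero.2 (hz a (left_mem_Icc.2 hab)).symm
  by_contra hslit
  rw [Complex.mem_slitPlane_iff, not_or, not_lt, not_not] at hslit
  -- `(z - b) / (z - a) = -t` with `t ≥ 0` exhibits `z` as a convex combination of `a` and `b`.
  obtain ⟨t, ht, hzt⟩ : ∃ t : ℝ, 0 ≤ t ∧ (z - b) / (z - a) = -t :=
    ⟨_, neg_nonneg.2 hslit.1, by simp [Complex.ext_iff, hslit.2]⟩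
  rw [div_eq_iff hza] at hzt
  have ht1 : (1 : ℂ) + t ≠ 0 := by exact_mod_cast (by positivity : 1 + t ≠ 0)
  refine hz ((b + t * a) / (1 + t)) ⟨?_, ?_⟩ ?_
  · rw [le_div_iff₀ (by positivity)]; nlinarith
  · rw [div_le_iff₀ (by positivity)]; nlinarith
  · push_cast
    rw [div_eq_iff ht1]
    linear_combination -hzt

theorem differentiableAt_cutRoot {a b : ℝ} (hab : a ≤ b) {z : ℂ}
    (hz : ∀ x ∈ Icc a b, (x : ℂ) ≠ z) : DifferentiableAt ℂ (cutRoot a b) z := by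
  have hza : z - a ≠ 0 := sub_ne_zero.2 (hz a (left_mem_Icc.2 hab)).symm
  have hdiv : DifferentiableAt ℂ (fun w : ℂ => (w - b) / (w - a)) z :=
    (by fun_prop : DifferentiableAt ℂ (fun w : ℂ => w - b) z).div (by fun_prop) hza
  exact (differentiableAt_id.sub_const (a : ℂ)).mul
    (hdiv.cpow_const (sub_div_sub_mem_slitPlane hab hz))

/-- The branch of `√(1 - z²)` that is holomorphic off `(-∞, -1] ∪ [1, ∞)`. It continues the
weight `√(1 - w²)` of the condensate equation off the interval `(-1, 1)`. -/
noncomputable def circleRoot (z : ℂ) : ℂ :=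
  (1 - z).sqrt * (1 + z).sqrt

theorem circleRoot_ofReal {x : ℝ} (hx : x ∈ Icc (-1 : ℝ) 1) :
    circleRoot x = (√(1 - x ^ 2) : ℂ) := by
  have hminus : 0 ≤ 1 - x := by linarith [hx.2]
  have hplus : 0 ≤ 1 + x := by linarith [hx.1]
  have h1 := complexSqrt_ofReal hminus
  have h2 := complexSqrt_ofReal hplus
  push_cast at h1 h2
  rw [circleRoot, h1, h2, ← Complex.ofReal_mul, ← Real.sqrt_mul hminus]
  ring_nf

theorem differentiableAt_circleRoot {z : ℂ} (hz : z.re ∈ Ioo (-1 : ℝ) 1) :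
    DifferentiableAt ℂ circleRoot z := by
  have hminus : 1 - z ∈ Complex.slitPlane := Or.inl (by simpa using hz.2)
  have hplus : 1 + z ∈ Complex.slitPlane :=
    Or.inl (by rw [Complex.add_re, Complex.one_re]; linarith [hz.1])
  exact ((Complex.differentiableAt_sqrt hminus).comp z (by fun_prop)).mul
    ((Complex.differentiableAt_sqrt hplus).comp z (by fun_prop))

theorem cutRoot_unit_of_im_pos {z : ℂ} (hz : 0 < z.im) :
    cutRoot (-1) 1 z = Complex.I * circleRoot z := by
  rw [cutRoot_eq_complexSqrt_mul (by norm_num), circleRoot,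
    complexSqrt_of_im_pos (z := z - (1 : ℝ)) (by simpa using hz)]
  push_cast
  rw [neg_sub, sub_neg_eq_add, add_comm z]
  ring

theorem cutRoot_unit_of_im_neg {z : ℂ} (hz : z.im < 0) :
    cutRoot (-1) 1 z = -Complex.I * circleRoot z := by
  rw [cutRoot_eq_complexSqrt_mul (by norm_num), circleRoot,
    complexSqrt_of_im_neg (z := z - (1 : ℝ)) (by simpa using hz)]
  push_cast
  rw [neg_sub, sub_neg_eq_add, add_comm z]
  ring

theorem cutRoot_unit_sq (z : ℂ) : cutRoot (-1) 1 z ^ 2 = z ^ 2 - 1 := by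
  rw [cutRoot_sq]
  push_cast
  ring

theorem sq_sub_one_ne_zero_of_im_ne_zero {z : ℂ} (hz : z.im ≠ 0) : z ^ 2 - 1 ≠ 0 := by
  have h1 := ofReal_ne_of_im_ne_zero hz 1
  have h2 := ofReal_ne_of_im_ne_zero hz (-1)
  push_cast at h1 h2
  rw [show z ^ 2 - 1 = (z - 1) * (z - -1) by ring]
  exact mul_ne_zero (sub_ne_zero.2 h1.symm) (sub_ne_zero.2 h2.symm)

end SquareRoots

section Surface

variable {a₁ a₂ a₃ a₄ : ℝ}

theorem ofReal_mem_branchPoints {x : ℝ} :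
    (x : ℂ) ∈ branchPoints a₁ a₂ a₃ a₄ ↔ x = a₁ ∨ x = a₂ ∨ x = a₃ ∨ x = a₄ := by
  simp only [branchPoints, mem_insert_iff, mem_singleton_iff, Complex.ofReal_inj]

theorem branchPoints_subset_bandSet (h₁ : a₁ ≤ a₂) (h₃ : a₃ ≤ a₄) :
    branchPoints a₁ a₂ a₃ a₄ ⊆ bandSet a₁ a₂ a₃ a₄ := by
  rintro z (rfl | rfl | rfl | rfl)
  · exact ⟨a₁, Or.inl ⟨le_rfl, h₁⟩, rfl⟩
  · exact ⟨a₂, Or.inl ⟨h₁, le_rfl⟩, rfl⟩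
  · exact ⟨a₃, Or.inr ⟨le_rfl, h₃⟩, rfl⟩
  · exact ⟨a₄, Or.inr ⟨h₃, le_rfl⟩, rfl⟩

theorem isClosed_bandSet : IsClosed (bandSet a₁ a₂ a₃ a₄) :=
  Complex.isometry_ofReal.isClosedEmbedding.isClosedMap _ (isClosed_Icc.union isClosed_Icc)

theorem notMem_bandSet_of_im_ne_zero {z : ℂ} (hz : z.im ≠ 0) : z ∉ bandSet a₁ a₂ a₃ a₄ := by
  rintro ⟨x, -, rfl⟩
  exact hz (Complex.ofReal_im x)

theorem isClosed_spectralSupport : IsClosed (spectralSupport a₁ a₂ a₃ a₄) :=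
  (isClosed_Icc.union isClosed_Icc).union isClosed_Icc

theorem spectralSupport_subset_Icc (h₀ : -1 ≤ a₁) (h₁ : a₁ < a₂) (h₂ : a₂ < a₃) (h₃ : a₃ < a₄)
    (h₄ : a₄ ≤ 1) : spectralSupport a₁ a₂ a₃ a₄ ⊆ Icc (-1) 1 := by
  rintro x ((hx | hx) | hx) <;> constructor <;> linarith [hx.1, hx.2]

theorem surfaceRoot_eq_complexSqrt_mul (h₁ : a₁ ≤ a₂) (h₃ : a₃ ≤ a₄) (z : ℂ) :
    surfaceRoot a₁ a₂ a₃ a₄ z =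
      (z - a₁).sqrt * (z - a₂).sqrt * ((z - a₃).sqrt * (z - a₄).sqrt) := by
  rw [surfaceRoot, cutRoot_eq_complexSqrt_mul h₁, cutRoot_eq_complexSqrt_mul h₃]

theorem surfaceRoot_ne_zero {z : ℂ} (hz : z ∉ branchPoints a₁ a₂ a₃ a₄) :
    surfaceRoot a₁ a₂ a₃ a₄ z ≠ 0 := by
  simp only [branchPoints, mem_insert_iff, mem_singleton_iff, not_or] at hz
  refine (pow_ne_zero_iff two_ne_zero).1 ?_
  simp only [surfaceRoot_sq, mul_ne_zero_iff, sub_ne_zero]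
  tauto

theorem differentiableAt_surfaceRoot (h₁ : a₁ ≤ a₂) (h₃ : a₃ ≤ a₄) {z : ℂ}
    (hz : z ∉ bandSet a₁ a₂ a₃ a₄) : DifferentiableAt ℂ (surfaceRoot a₁ a₂ a₃ a₄) z :=
  (differentiableAt_cutRoot h₁ fun x hx he => hz ⟨x, Or.inl hx, he⟩).mul
    (differentiableAt_cutRoot h₃ fun x hx he => hz ⟨x, Or.inr hx, he⟩)

theorem measurable_surfaceRoot : Measurable (surfaceRoot a₁ a₂ a₃ a₄) := by
  unfold surfaceRoot cutRoot
  fun_prop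

theorem tendsto_surfaceRoot_upper (h₁ : a₁ ≤ a₂) (h₃ : a₃ ≤ a₄) (x : ℝ) :
    Tendsto (surfaceRoot a₁ a₂ a₃ a₄) (𝓝[{z : ℂ | 0 < z.im}] (x : ℂ))
      (𝓝 (surfaceRoot a₁ a₂ a₃ a₄ x)) := by
  have hsqrt (a : ℝ) : Tendsto (fun z : ℂ => (z - a).sqrt)
      (𝓝[{z : ℂ | 0 < z.im}] (x : ℂ)) (𝓝 ((x : ℂ) - a).sqrt) := by
    have h := tendsto_complexSqrt_upper (x - a)
    rw [Complex.ofReal_sub] at h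
    refine h.comp (tendsto_nhdsWithin_of_tendsto_nhds_of_eventually_within _ ?_ ?_)
    · exact ((continuous_sub_right (a : ℂ)).tendsto (x : ℂ)).mono_left nhdsWithin_le_nhds
    · filter_upwards [self_mem_nhdsWithin] with z hz
      simpa using hz
  rw [funext (surfaceRoot_eq_complexSqrt_mul h₁ h₃)]
  exact ((hsqrt a₁).mul (hsqrt a₂)).mul ((hsqrt a₃).mul (hsqrt a₄))

/-- The branch of `√((z² - 1) ∏ (z - aⱼ))` that is holomorphic off the spectral support: the cuts
of `surfaceRoot` and of `cutRoot (-1) 1` cancel on the bands. -/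
noncomputable def supportRoot (a₁ a₂ a₃ a₄ : ℝ) (z : ℂ) : ℂ :=
  cutRoot (-1) a₁ z * cutRoot a₂ a₃ z * cutRoot a₄ 1 z

theorem surfaceRoot_mul_cutRoot_unit (h₀ : -1 ≤ a₁) (h₁ : a₁ ≤ a₂) (h₂ : a₂ ≤ a₃) (h₃ : a₃ ≤ a₄)
    (h₄ : a₄ ≤ 1) (z : ℂ) :
    surfaceRoot a₁ a₂ a₃ a₄ z * cutRoot (-1) 1 z = supportRoot a₁ a₂ a₃ a₄ z := by
  rw [surfaceRoot_eq_complexSqrt_mul h₁ h₃, supportRoot, cutRoot_eq_complexSqrt_mul h₀,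
    cutRoot_eq_complexSqrt_mul h₂, cutRoot_eq_complexSqrt_mul h₄,
    cutRoot_eq_complexSqrt_mul (by norm_num)]
  ring

theorem differentiableAt_supportRoot (h₀ : -1 ≤ a₁) (h₂ : a₂ ≤ a₃) (h₄ : a₄ ≤ 1) {z : ℂ}
    (hz : ∀ x ∈ spectralSupport a₁ a₂ a₃ a₄, (x : ℂ) ≠ z) :
    DifferentiableAt ℂ (supportRoot a₁ a₂ a₃ a₄) z :=
  ((differentiableAt_cutRoot h₀ fun x hx => hz x (Or.inl (Or.inl hx))).mul
    (differentiableAt_cutRoot h₂ fun x hx => hz x (Or.inl (Or.inr hx)))).mul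
    (differentiableAt_cutRoot h₄ fun x hx => hz x (Or.inr hx))

end Surface

theorem intervalIntegrable_inv_sqrt (c d : ℝ) :
    IntervalIntegrable (fun x : ℝ => (√x)⁻¹) volume c d := by
  refine (intervalIntegral.intervalIntegrable_rpow' (a := c) (b := d)
    (show (-1 : ℝ) < -(1 / 2) by norm_num)).congr_ae (Eventually.of_forall fun x => ?_)
  rcases le_or_gt 0 x with hx | hx
  · simp only [Real.rpow_neg hx, Real.sqrt_eq_rpow]
  · have harg : -(1 / 2) * Real.pi = -(Real.pi / 2) := by ring
    simp only [Real.rpow_def_of_neg hx, Real.sqrt_eq_zero_of_nonpos hx.le, harg, Real.cos_neg,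
      Real.cos_pi_div_two, mul_zero, inv_zero]

theorem intervalIntegrable_inv_sqrt_abs_sub (a c d : ℝ) :
    IntervalIntegrable (fun x : ℝ => (√|x - a|)⁻¹) volume c d := by
  have hright := (intervalIntegrable_inv_sqrt (c - a) (d - a)).comp_sub_right a
  have hleft := (intervalIntegrable_inv_sqrt (a - c) (a - d)).comp_sub_left a
  simp only [sub_add_cancel, sub_sub_cancel] at hright hleft
  refine (hright.add hleft).congr_ae (Eventually.of_forall fun x => ?_)
  beta_reduce
  rcases le_total 0 (x - a) with hx | hx
  · rw [abs_of_nonneg hx, Real.sqrt_eq_zero_of_nonpos (show a - x ≤ 0 by linarith), inv_zero,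
      add_zero]
  · rw [abs_of_nonpos hx, Real.sqrt_eq_zero_of_nonpos hx, inv_zero, zero_add, neg_sub]

theorem inv_sqrt_abs_sub_mul_le {a b : ℝ} (hab : a ≠ b) (x : ℝ) :
    (√|x - a|)⁻¹ * (√|x - b|)⁻¹ ≤
      (√(|a - b| / 2))⁻¹ * ((√|x - a|)⁻¹ + (√|x - b|)⁻¹) := by
  have : 0 < |a - b| / 2 := half_pos (abs_pos.2 (sub_ne_zero.2 hab))
  have htri : |a - b| ≤ |x - a| + |x - b| := abs_sub_comm x a ▸ abs_sub_le a x b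
  rw [mul_add]
  rcases le_or_gt (|a - b| / 2) |x - a| with hfar | hnear
  · have hle : (√|x - a|)⁻¹ ≤ (√(|a - b| / 2))⁻¹ := by gcongr
    exact (mul_le_mul_of_nonneg_right hle (by positivity)).trans
      (le_add_of_nonneg_left (by positivity))
  · have hle : (√|x - b|)⁻¹ ≤ (√(|a - b| / 2))⁻¹ := by
      gcongr
      linarith
    rw [mul_comm]
    exact (mul_le_mul_of_nonneg_right hle (by positivity)).trans
      (le_add_of_nonneg_right (by positivity))

theorem intervalIntegrable_inv_sqrt_abs_sub_mul {a b : ℝ} (hab : a ≠ b) (c d : ℝ) :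
    IntervalIntegrable (fun x : ℝ => (√|x - a|)⁻¹ * (√|x - b|)⁻¹) volume c d := by
  refine IntervalIntegrable.mono_fun' (((intervalIntegrable_inv_sqrt_abs_sub a c d).add
    (intervalIntegrable_inv_sqrt_abs_sub b c d)).const_mul (√(|a - b| / 2))⁻¹)
    (by fun_prop) (Eventually.of_forall fun x => ?_)
  beta_reduce
  rw [Real.norm_of_nonneg (by positivity)]
  exact inv_sqrt_abs_sub_mul_le hab x

section Weight

variable {a₁ a₂ a₃ a₄ : ℝ}

/-- The quartic `∏ (x - aⱼ)` whose square root is the radical `R`. -/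
def branchPoly (a₁ a₂ a₃ a₄ x : ℝ) : ℝ :=
  (x - a₁) * (x - a₂) * (x - a₃) * (x - a₄)

/-- The weight `1 / |R(x)|` on the real line, equal to `0` at the branch points. -/
noncomputable def weight (a₁ a₂ a₃ a₄ x : ℝ) : ℝ :=
  (√|branchPoly a₁ a₂ a₃ a₄ x|)⁻¹

theorem surfaceRoot_ofReal_sq (x : ℝ) :
    surfaceRoot a₁ a₂ a₃ a₄ x ^ 2 = (branchPoly a₁ a₂ a₃ a₄ x : ℂ) := by
  rw [surfaceRoot_sq, branchPoly]
  push_cast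
  rfl

theorem norm_inv_surfaceRoot (x : ℝ) :
    ‖(surfaceRoot a₁ a₂ a₃ a₄ x)⁻¹‖ = weight a₁ a₂ a₃ a₄ x := by
  rw [weight, norm_inv, ← Real.norm_eq_abs, ← Complex.norm_real, ← surfaceRoot_ofReal_sq, norm_pow,
    Real.sqrt_sq (norm_nonneg _)]

theorem weight_eq_mul (x : ℝ) : weight a₁ a₂ a₃ a₄ x =
    (√|x - a₁|)⁻¹ * (√|x - a₂|)⁻¹ * ((√|x - a₃|)⁻¹ * (√|x - a₄|)⁻¹) := by
  rw [weight, branchPoly, mul_assoc, abs_mul, abs_mul, abs_mul, Real.sqrt_mul (by positivity),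
    Real.sqrt_mul (by positivity), Real.sqrt_mul (by positivity), mul_inv, mul_inv, mul_inv]

theorem intervalIntegrable_weight (h₁ : a₁ < a₂) (h₂ : a₂ < a₃) (h₃ : a₃ < a₄) (c d : ℝ) :
    IntervalIntegrable (weight a₁ a₂ a₃ a₄) volume c d := by
  have hpair {a b : ℝ} (hab : a < b) := intervalIntegrable_inv_sqrt_abs_sub_mul hab.ne c d
  have hsum := ((((hpair (h₁.trans h₂)).add (hpair (h₁.trans (h₂.trans h₃)))).add
    (hpair h₂)).add (hpair (h₂.trans h₃))).const_mul
    ((√(|a₁ - a₂| / 2))⁻¹ * (√(|a₃ - a₄| / 2))⁻¹)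
  refine hsum.mono_fun' (by unfold weight branchPoly; fun_prop) (Eventually.of_forall fun x => ?_)
  beta_reduce
  rw [weight_eq_mul, Real.norm_of_nonneg (by positivity)]
  calc _ ≤ _ := mul_le_mul (inv_sqrt_abs_sub_mul_le h₁.ne x) (inv_sqrt_abs_sub_mul_le h₃.ne x)
        (by positivity) (by positivity)
    _ = _ := by ring

theorem intervalIntegrable_mul_weight (h₁ : a₁ < a₂) (h₂ : a₂ < a₃) (h₃ : a₃ < a₄) {G : ℝ → ℝ}
    {c d : ℝ} (hG : ContinuousOn G (uIcc c d)) :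
    IntervalIntegrable (fun x => G x * weight a₁ a₂ a₃ a₄ x) volume c d :=
  (intervalIntegrable_weight h₁ h₂ h₃ c d).continuousOn_mul hG

theorem integrableOn_div_surfaceRoot (h₁ : a₁ < a₂) (h₂ : a₂ < a₃) (h₃ : a₃ < a₄) {p : ℂ → ℂ}
    (hp : Continuous p) (c d : ℝ) :
    IntegrableOn (fun x : ℝ => p x / surfaceRoot a₁ a₂ a₃ a₄ x) (Icc c d) := by
  have hweight : IntegrableOn (weight a₁ a₂ a₃ a₄) (Icc c d) :=
    (integrableOn_Icc_iff_integrableOn_Ioc enorm_ne_top).2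
      (intervalIntegrable_weight h₁ h₂ h₃ c d).1
  have hinv : IntegrableOn (fun x : ℝ => (surfaceRoot a₁ a₂ a₃ a₄ x)⁻¹) (Icc c d) :=
    hweight.mono'
      (measurable_surfaceRoot.comp Complex.measurable_ofReal).inv.aestronglyMeasurable
      (Eventually.of_forall fun x => (norm_inv_surfaceRoot x).le)
  simp_rw [div_eq_mul_inv]
  exact hinv.continuousOn_mul (hp.comp Complex.continuous_ofReal).continuousOn isCompact_Icc

end Weight

section Elliptic

variable {a₁ a₂ a₃ a₄ : ℝ}

theorem ellipticParameter_lt_one (h₁ : a₁ < a₂) (h₂ : a₂ < a₃) (h₃ : a₃ < a₄) :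
    ellipticParameter a₁ a₂ a₃ a₄ < 1 := by
  unfold ellipticParameter
  rw [div_lt_one (mul_pos (by linarith) (by linarith))]
  nlinarith [mul_pos (show 0 < a₄ - a₁ by linarith) (sub_pos.2 h₂)]

theorem one_sub_mul_sin_sq_pos {m : ℝ} (hm : m < 1) (θ : ℝ) : 0 < 1 - m * Real.sin θ ^ 2 := by
  rcases le_total m 0 with hm0 | hm0
  · nlinarith [sq_nonneg (Real.sin θ)]
  · nlinarith [Real.sin_sq_le_one θ]

theorem ellipticK_pos {m : ℝ} (hm : m < 1) : 0 < ellipticK m := by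
  have hpos (θ : ℝ) := Real.sqrt_pos.2 (one_sub_mul_sin_sq_pos hm θ)
  refine intervalIntegral.intervalIntegral_pos_of_pos_on
    (Continuous.intervalIntegrable ?_ _ _) (fun θ _ => one_div_pos.2 (hpos θ)) (by positivity)
  exact continuous_const.div (by fun_prop) fun θ => (hpos θ).ne'

/-- The denominator of `legendreSubst`. -/
noncomputable def legendreDen (a₁ a₂ a₄ θ : ℝ) : ℝ :=
  (a₄ - a₂) + (a₂ - a₁) * Real.sin θ ^ 2

/-- The substitution `x = x(θ)` of the band `[a₁, a₂]` by `[0, π/2]` that puts the integrals of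
`1 / |R|` into Legendre form. It is `sin² θ` followed by the Möbius map that sends
`0, 1, 1 / m, ∞` to `a₁, a₂, a₃, a₄`. -/
noncomputable def legendreSubst (a₁ a₂ a₄ θ : ℝ) : ℝ :=
  ((a₂ - a₁) * a₄ * Real.sin θ ^ 2 + (a₄ - a₂) * a₁) / legendreDen a₁ a₂ a₄ θ

theorem legendreDen_pos (h₁ : a₁ < a₂) (h₂ : a₂ < a₄) (θ : ℝ) : 0 < legendreDen a₁ a₂ a₄ θ :=
  add_pos_of_pos_of_nonneg (sub_pos.2 h₂) (mul_nonneg (sub_pos.2 h₁).le (sq_nonneg _))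

theorem legendreSubst_sub_left (h₁ : a₁ < a₂) (h₂ : a₂ < a₄) (θ : ℝ) :
    legendreSubst a₁ a₂ a₄ θ - a₁ =
      (a₂ - a₁) * (a₄ - a₁) * Real.sin θ ^ 2 / legendreDen a₁ a₂ a₄ θ := by
  have hD := (legendreDen_pos h₁ h₂ θ).ne'
  rw [legendreSubst, eq_div_iff hD, sub_mul, div_mul_cancel₀ _ hD, legendreDen]
  ring

theorem right_sub_legendreSubst (h₁ : a₁ < a₂) (h₂ : a₂ < a₄) (θ : ℝ) :
    a₂ - legendreSubst a₁ a₂ a₄ θ =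
      (a₄ - a₂) * (a₂ - a₁) * Real.cos θ ^ 2 / legendreDen a₁ a₂ a₄ θ := by
  have hD := (legendreDen_pos h₁ h₂ θ).ne'
  rw [legendreSubst, eq_div_iff hD, sub_mul, div_mul_cancel₀ _ hD, legendreDen, Real.cos_sq']
  ring

theorem third_sub_legendreSubst (h₁ : a₁ < a₂) (h₂ : a₂ < a₃) (h₃ : a₃ < a₄) (θ : ℝ) :
    a₃ - legendreSubst a₁ a₂ a₄ θ = (a₄ - a₂) * (a₃ - a₁) *
      (1 - ellipticParameter a₁ a₂ a₃ a₄ * Real.sin θ ^ 2) / legendreDen a₁ a₂ a₄ θ := by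
  have hD := (legendreDen_pos h₁ (h₂.trans h₃) θ).ne'
  have hm : (a₄ - a₂) * (a₃ - a₁) * ellipticParameter a₁ a₂ a₃ a₄ = (a₄ - a₃) * (a₂ - a₁) :=
    mul_div_cancel₀ _ (mul_pos (by linarith) (by linarith)).ne'
  rw [legendreSubst, eq_div_iff hD, sub_mul, div_mul_cancel₀ _ hD, legendreDen]
  linear_combination Real.sin θ ^ 2 * hm

theorem fourth_sub_legendreSubst (h₁ : a₁ < a₂) (h₂ : a₂ < a₄) (θ : ℝ) :
    a₄ - legendreSubst a₁ a₂ a₄ θ = (a₄ - a₂) * (a₄ - a₁) / legendreDen a₁ a₂ a₄ θ := by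
  have hD := (legendreDen_pos h₁ h₂ θ).ne'
  rw [legendreSubst, eq_div_iff hD, sub_mul, div_mul_cancel₀ _ hD, legendreDen]
  ring

theorem legendreSubst_zero (h₁ : a₁ < a₂) (h₂ : a₂ < a₄) : legendreSubst a₁ a₂ a₄ 0 = a₁ :=
  sub_eq_zero.1 (by simp [legendreSubst_sub_left h₁ h₂])

theorem legendreSubst_pi_div_two (h₁ : a₁ < a₂) (h₂ : a₂ < a₄) :
    legendreSubst a₁ a₂ a₄ (Real.pi / 2) = a₂ :=
  (sub_eq_zero.1 (by simp [right_sub_legendreSubst h₁ h₂])).symm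

theorem hasDerivAt_legendreSubst (h₁ : a₁ < a₂) (h₂ : a₂ < a₄) (θ : ℝ) :
    HasDerivAt (legendreSubst a₁ a₂ a₄)
      (2 * (a₂ - a₁) * (a₄ - a₁) * (a₄ - a₂) * Real.sin θ * Real.cos θ /
        legendreDen a₁ a₂ a₄ θ ^ 2) θ := by
  have hsin : HasDerivAt (fun θ => Real.sin θ ^ 2) (2 * Real.sin θ * Real.cos θ) θ := by
    simpa using (Real.hasDerivAt_sin θ).fun_pow 2
  have hden : HasDerivAt (legendreDen a₁ a₂ a₄) ((a₂ - a₁) * (2 * Real.sin θ * Real.cos θ)) θ :=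
    (hsin.const_mul (a₂ - a₁)).const_add (a₄ - a₂)
  have hnum := (hsin.const_mul ((a₂ - a₁) * a₄)).add_const ((a₄ - a₂) * a₁)
  refine (hnum.div hden (legendreDen_pos h₁ h₂ θ).ne').congr_deriv ?_
  congr 1
  rw [legendreDen]
  ring

theorem deriv_legendreSubst_pos (h₁ : a₁ < a₂) (h₂ : a₂ < a₄) {θ : ℝ}
    (hθ : θ ∈ Ioo 0 (Real.pi / 2)) : 0 < deriv (legendreSubst a₁ a₂ a₄) θ := by
  have hsin : 0 < Real.sin θ :=
    Real.sin_pos_of_pos_of_lt_pi hθ.1 (by linarith [hθ.2, Real.pi_pos])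
  have hcos : 0 < Real.cos θ := Real.cos_pos_of_mem_Ioo ⟨by linarith [hθ.1, Real.pi_pos], hθ.2⟩
  rw [(hasDerivAt_legendreSubst h₁ h₂ θ).deriv]
  refine div_pos ?_ (pow_pos (legendreDen_pos h₁ h₂ θ) 2)
  have := sub_pos.2 h₁
  have := sub_pos.2 h₂
  have := sub_pos.2 (h₁.trans h₂)
  positivity

theorem branchPoly_legendreSubst (h₁ : a₁ < a₂) (h₂ : a₂ < a₃) (h₃ : a₃ < a₄) (θ : ℝ) :
    branchPoly a₁ a₂ a₃ a₄ (legendreSubst a₁ a₂ a₄ θ) =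
      -((deriv (legendreSubst a₁ a₂ a₄) θ / 2) ^ 2 * ((a₄ - a₂) * (a₃ - a₁)) *
        (1 - ellipticParameter a₁ a₂ a₃ a₄ * Real.sin θ ^ 2)) := by
  have h₂₄ := h₂.trans h₃
  have hsigns (x : ℝ) : branchPoly a₁ a₂ a₃ a₄ x =
      -((x - a₁) * (a₂ - x) * (a₃ - x) * (a₄ - x)) := by
    rw [branchPoly]
    ring
  rw [hsigns, legendreSubst_sub_left h₁ h₂₄, right_sub_legendreSubst h₁ h₂₄,
    third_sub_legendreSubst h₁ h₂ h₃, fourth_sub_legendreSubst h₁ h₂₄,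
    (hasDerivAt_legendreSubst h₁ h₂₄ θ).deriv]
  ring

theorem weight_legendreSubst_mul_deriv (h₁ : a₁ < a₂) (h₂ : a₂ < a₃) (h₃ : a₃ < a₄) {θ : ℝ}
    (hθ : θ ∈ Ioo 0 (Real.pi / 2)) :
    weight a₁ a₂ a₃ a₄ (legendreSubst a₁ a₂ a₄ θ) * deriv (legendreSubst a₁ a₂ a₄) θ =
      2 / √((a₄ - a₂) * (a₃ - a₁)) *
        (1 / √(1 - ellipticParameter a₁ a₂ a₃ a₄ * Real.sin θ ^ 2)) := by
  have hδ := deriv_legendreSubst_pos h₁ (h₂.trans h₃) hθ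
  have hg : 0 < (a₄ - a₂) * (a₃ - a₁) := mul_pos (by linarith) (by linarith)
  have hμ := one_sub_mul_sin_sq_pos (ellipticParameter_lt_one h₁ h₂ h₃) θ
  rw [weight, branchPoly_legendreSubst h₁ h₂ h₃, abs_neg, abs_of_nonneg (by positivity),
    Real.sqrt_mul (by positivity), Real.sqrt_mul (by positivity), Real.sqrt_sq (by positivity)]
  have := Real.sqrt_pos.2 hg
  have := Real.sqrt_pos.2 hμ
  field_simp

theorem monotoneOn_legendreSubst (h₁ : a₁ < a₂) (h₂ : a₂ < a₄) :
    MonotoneOn (legendreSubst a₁ a₂ a₄) (Icc 0 (Real.pi / 2)) := by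
  have hdiff : Differentiable ℝ (legendreSubst a₁ a₂ a₄) := fun θ =>
    (hasDerivAt_legendreSubst h₁ h₂ θ).differentiableAt
  refine monotoneOn_of_deriv_nonneg (convex_Icc _ _) hdiff.continuous.continuousOn
    hdiff.differentiableOn fun θ hθ => ?_
  rw [interior_Icc] at hθ
  exact (deriv_legendreSubst_pos h₁ h₂ hθ).le

theorem legendreSubst_image_Icc (h₁ : a₁ < a₂) (h₂ : a₂ < a₄) :
    legendreSubst a₁ a₂ a₄ '' Icc 0 (Real.pi / 2) = Icc a₁ a₂ := by
  have hcont : ContinuousOn (legendreSubst a₁ a₂ a₄) (Icc 0 (Real.pi / 2)) := fun θ _ =>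
    (hasDerivAt_legendreSubst h₁ h₂ θ).continuousAt.continuousWithinAt
  rw [hcont.image_Icc_of_monotoneOn (by positivity) (monotoneOn_legendreSubst h₁ h₂),
    legendreSubst_zero h₁ h₂, legendreSubst_pi_div_two h₁ h₂]

theorem integral_mul_weight_eq_legendre (h₁ : a₁ < a₂) (h₂ : a₂ < a₃) (h₃ : a₃ < a₄)
    (G : ℝ → ℝ) :
    ∫ x in a₁..a₂, G x * weight a₁ a₂ a₃ a₄ x =
      2 / √((a₄ - a₂) * (a₃ - a₁)) * ∫ θ in (0 : ℝ)..(Real.pi / 2),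
        G (legendreSubst a₁ a₂ a₄ θ) *
          (1 / √(1 - ellipticParameter a₁ a₂ a₃ a₄ * Real.sin θ ^ 2)) := by
  have h₂₄ := h₂.trans h₃
  have hder (θ : ℝ) := (hasDerivAt_legendreSubst h₁ h₂₄ θ).differentiableAt.hasDerivAt
  rw [← intervalIntegral.integral_const_mul, intervalIntegral.integral_of_le h₁.le,
    intervalIntegral.integral_of_le (by positivity), ← integral_Icc_eq_integral_Ioc,
    integral_Ioc_eq_integral_Ioo, ← legendreSubst_image_Icc h₁ h₂₄,
    integral_image_eq_integral_deriv_smul_of_monotoneOn measurableSet_Icc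
      (fun θ _ => (hder θ).hasDerivWithinAt) (monotoneOn_legendreSubst h₁ h₂₄),
    integral_Icc_eq_integral_Ioo]
  refine setIntegral_congr_fun measurableSet_Ioo fun θ hθ => ?_
  simp only [smul_eq_mul]
  linear_combination G (legendreSubst a₁ a₂ a₄ θ) * weight_legendreSubst_mul_deriv h₁ h₂ h₃ hθ

theorem integral_weight (h₁ : a₁ < a₂) (h₂ : a₂ < a₃) (h₃ : a₃ < a₄) :
    ∫ x in a₁..a₂, weight a₁ a₂ a₃ a₄ x = 2 / √((a₄ - a₂) * (a₃ - a₁)) *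
      ellipticK (ellipticParameter a₁ a₂ a₃ a₄) := by
  simpa only [one_mul, ellipticK] using integral_mul_weight_eq_legendre h₁ h₂ h₃ fun _ => 1

theorem integral_weight_pos (h₁ : a₁ < a₂) (h₂ : a₂ < a₃) (h₃ : a₃ < a₄) :
    0 < ∫ x in a₁..a₂, weight a₁ a₂ a₃ a₄ x := by
  rw [integral_weight h₁ h₂ h₃]
  have hg : 0 < (a₄ - a₂) * (a₃ - a₁) := mul_pos (by linarith) (by linarith)
  exact mul_pos (div_pos two_pos (Real.sqrt_pos.2 hg))
    (ellipticK_pos (ellipticParameter_lt_one h₁ h₂ h₃))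

theorem integral_div_mul_weight (h₁ : a₁ < a₂) (h₂ : a₂ < a₃) (h₃ : a₃ < a₄) :
    ∫ x in a₁..a₂, (a₃ - x) / (a₄ - x) * weight a₁ a₂ a₃ a₄ x =
      2 / √((a₄ - a₂) * (a₃ - a₁)) *
        ((a₃ - a₁) / (a₄ - a₁) * ellipticE (ellipticParameter a₁ a₂ a₃ a₄)) := by
  rw [integral_mul_weight_eq_legendre h₁ h₂ h₃ fun x => (a₃ - x) / (a₄ - x), ellipticE,
    ← intervalIntegral.integral_const_mul ((a₃ - a₁) / (a₄ - a₁))]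
  congr 2
  funext θ
  have hμ := one_sub_mul_sin_sq_pos (ellipticParameter_lt_one h₁ h₂ h₃) θ
  rw [third_sub_legendreSubst h₁ h₂ h₃, fourth_sub_legendreSubst h₁ (h₂.trans h₃)]
  have := legendreDen_pos h₁ (h₂.trans h₃) θ
  have : 0 < a₄ - a₁ := by linarith
  have : 0 < a₄ - a₂ := by linarith
  have := Real.sqrt_pos.2 hμ
  field_simp
  rw [Real.sq_sqrt hμ.le]

end Elliptic

section Bands

variable {a₁ a₂ a₃ a₄ : ℝ}

/-- The numerator of the density of states, up to the factor `1 / π`. -/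
noncomputable def dosPoly (a₁ a₂ a₃ a₄ x : ℝ) : ℝ :=
  x ^ 2 - (1 / 2) * l₁ a₁ a₂ a₃ a₄ * x + constA a₁ a₂ a₃ a₄

/-- The numerator of the density of fluxes, up to the factor `1 / π`. -/
noncomputable def dofPoly (a₁ a₂ a₃ a₄ x : ℝ) : ℝ :=
  4 * x ^ 3 - 2 * l₁ a₁ a₂ a₃ a₄ * x ^ 2 + (2 * l₂ a₁ a₂ a₃ a₄ - l₁ a₁ a₂ a₃ a₄ ^ 2 / 2) * x +
    constB a₁ a₂ a₃ a₄

theorem hasDerivAt_branchPoly (x : ℝ) :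
    HasDerivAt (branchPoly a₁ a₂ a₃ a₄) (4 * x ^ 3 - 3 * l₁ a₁ a₂ a₃ a₄ * x ^ 2 +
      2 * l₂ a₁ a₂ a₃ a₄ * x - (a₁ * a₂ * a₃ + a₁ * a₂ * a₄ + a₁ * a₃ * a₄ + a₂ * a₃ * a₄)) x := by
  have hlin (a : ℝ) : HasDerivAt (fun x => x - a) 1 x := (hasDerivAt_id' x).sub_const a
  refine ((((hlin a₁).fun_mul (hlin a₂)).fun_mul (hlin a₃)).fun_mul (hlin a₄)).congr_deriv ?_
  rw [l₁, l₂]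
  ring

theorem continuous_deriv_branchPoly : Continuous (deriv (branchPoly a₁ a₂ a₃ a₄)) := by
  rw [show deriv (branchPoly a₁ a₂ a₃ a₄) = _ from
    funext fun x => (hasDerivAt_branchPoly (a₁ := a₁) x).deriv]
  fun_prop

theorem branchPoly_neg_of_mem_left (h₂ : a₂ ≤ a₃) (h₃ : a₃ ≤ a₄) {x : ℝ} (hx : x ∈ Ioo a₁ a₂) :
    branchPoly a₁ a₂ a₃ a₄ x < 0 := by
  have hx₂ := sub_neg.2 hx.2
  exact mul_neg_of_pos_of_neg (mul_pos_of_neg_of_neg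
    (mul_neg_of_pos_of_neg (sub_pos.2 hx.1) hx₂) (by linarith)) (by linarith)

theorem branchPoly_neg_of_mem_right (h₁ : a₁ ≤ a₂) (h₂ : a₂ ≤ a₃) {x : ℝ} (hx : x ∈ Ioo a₃ a₄) :
    branchPoly a₁ a₂ a₃ a₄ x < 0 := by
  have hx₃ := sub_pos.2 hx.1
  exact mul_neg_of_pos_of_neg (mul_pos (mul_pos (by linarith) (by linarith)) hx₃)
    (sub_neg.2 hx.2)

/-- The integrand is the exact differential of `-2 √(-∏ (x - aⱼ)) g`. -/
theorem integral_exact_mul_weight (h₁ : a₁ < a₂) (h₂ : a₂ < a₃) (h₃ : a₃ < a₄) {c d : ℝ}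
    (hcd : c ≤ d) (hc : branchPoly a₁ a₂ a₃ a₄ c = 0) (hd : branchPoly a₁ a₂ a₃ a₄ d = 0)
    (hneg : ∀ x ∈ Ioo c d, branchPoly a₁ a₂ a₃ a₄ x < 0) {g g' : ℝ → ℝ}
    (hg : ContinuousOn g (Icc c d)) (hg' : ContinuousOn g' (Icc c d))
    (hder : ∀ x ∈ Ioo c d, HasDerivAt g (g' x) x) :
    ∫ x in c..d, (deriv (branchPoly a₁ a₂ a₃ a₄) x * g x + 2 * branchPoly a₁ a₂ a₃ a₄ x * g' x) *
      weight a₁ a₂ a₃ a₄ x = 0 := by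
  have hPd (x : ℝ) : HasDerivAt (branchPoly a₁ a₂ a₃ a₄) (deriv (branchPoly a₁ a₂ a₃ a₄) x) x :=
    (hasDerivAt_branchPoly x).differentiableAt.hasDerivAt
  have hPc : Continuous (branchPoly a₁ a₂ a₃ a₄) := by
    unfold branchPoly
    fun_prop
  have hprimitive (x : ℝ) (hx : x ∈ Ioo c d) :
      HasDerivAt (fun x => -2 * (√(-branchPoly a₁ a₂ a₃ a₄ x) * g x))
        ((deriv (branchPoly a₁ a₂ a₃ a₄) x * g x + 2 * branchPoly a₁ a₂ a₃ a₄ x * g' x) *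
          weight a₁ a₂ a₃ a₄ x) x := by
    have hpos := neg_pos.2 (hneg x hx)
    refine ((((hPd x).fun_neg.sqrt hpos.ne').fun_mul (hder x hx)).const_mul (-2)).congr_deriv ?_
    rw [weight, abs_of_neg (hneg x hx)]
    have := Real.sqrt_pos.2 hpos
    field_simp
    rw [Real.sq_sqrt hpos.le]
    ring
  rw [intervalIntegral.integral_eq_sub_of_hasDerivAt_of_le hcd
    (continuousOn_const.mul (hPc.neg.sqrt.continuousOn.mul hg)) hprimitive
    (intervalIntegrable_mul_weight h₁ h₂ h₃ ?_)]
  · simp [hc, hd]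
  · rw [uIcc_of_le hcd]
    exact (continuous_deriv_branchPoly.continuousOn.mul hg).add
      ((continuous_const.mul hPc).continuousOn.mul hg')

theorem integral_deriv_branchPoly_mul_weight (h₁ : a₁ < a₂) (h₂ : a₂ < a₃) (h₃ : a₃ < a₄)
    {c d : ℝ} (hcd : c ≤ d) (hc : branchPoly a₁ a₂ a₃ a₄ c = 0)
    (hd : branchPoly a₁ a₂ a₃ a₄ d = 0) (hneg : ∀ x ∈ Ioo c d, branchPoly a₁ a₂ a₃ a₄ x < 0) :
    ∫ x in c..d, deriv (branchPoly a₁ a₂ a₃ a₄) x * weight a₁ a₂ a₃ a₄ x = 0 := by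
  simpa using integral_exact_mul_weight h₁ h₂ h₃ hcd hc hd hneg (g := fun _ => 1)
    (g' := fun _ => 0) continuousOn_const continuousOn_const fun x _ => hasDerivAt_const x 1

/-- Legendre's reduction: the exact differential of `√(-∏ (x - aⱼ)) / (a₄ - x)` relates the
integral of a quadratic polynomial to an integral of the second kind. -/
theorem integral_quadratic_mul_weight (h₁ : a₁ < a₂) (h₂ : a₂ < a₃) (h₃ : a₃ < a₄) :
    ∫ x in a₁..a₂, (x ^ 2 - (1 / 2) * l₁ a₁ a₂ a₃ a₄ * x + (1 / 2) * (a₃ * a₄ + a₂ * a₁)) *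
        weight a₁ a₂ a₃ a₄ x =
      (1 / 2) * (a₄ - a₁) * (a₄ - a₂) *
        ∫ x in a₁..a₂, (a₃ - x) / (a₄ - x) * weight a₁ a₂ a₃ a₄ x := by
  have hne : ∀ x ∈ Icc a₁ a₂, a₄ - x ≠ 0 := fun x hx => by linarith [hx.2]
  have hder : ∀ x ∈ Icc a₁ a₂, HasDerivAt (fun x => (a₄ - x)⁻¹) (((a₄ - x) ^ 2)⁻¹) x :=
    fun x hx => (((hasDerivAt_id' x).const_sub a₄).fun_inv (hne x hx)).congr_deriv (by simp)
  have hexact := integral_exact_mul_weight h₁ h₂ h₃ h₁.le (g := fun x => (a₄ - x)⁻¹)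
    (g' := fun x => ((a₄ - x) ^ 2)⁻¹) (by simp [branchPoly]) (by simp [branchPoly])
    (fun x hx => branchPoly_neg_of_mem_left h₂.le h₃.le hx)
    (ContinuousOn.inv₀ (by fun_prop) hne)
    (ContinuousOn.inv₀ (by fun_prop) fun x hx => pow_ne_zero 2 (hne x hx))
    fun x hx => hder x (Ioo_subset_Icc_self hx)
  have hdiv : IntervalIntegrable (fun x => (a₃ - x) / (a₄ - x) * weight a₁ a₂ a₃ a₄ x)
      volume a₁ a₂ := by
    refine intervalIntegrable_mul_weight h₁ h₂ h₃ (ContinuousOn.div (by fun_prop) (by fun_prop) ?_)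
    rwa [uIcc_of_le h₁.le]
  rw [← sub_eq_zero, ← intervalIntegral.integral_const_mul, ← intervalIntegral.integral_sub
    (intervalIntegrable_mul_weight h₁ h₂ h₃ (by fun_prop)) (hdiv.const_mul _),
    ← mul_zero (-(1 / 2) : ℝ), ← hexact, ← intervalIntegral.integral_const_mul]
  refine intervalIntegral.integral_congr fun x hx => ?_
  have := hne x (by rwa [uIcc_of_le h₁.le] at hx)
  simp only [(hasDerivAt_branchPoly x).deriv, branchPoly, l₁, l₂]
  field_simp
  ring

theorem integral_dosPoly_left (h₁ : a₁ < a₂) (h₂ : a₂ < a₃) (h₃ : a₃ < a₄) :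
    ∫ x in a₁..a₂, dosPoly a₁ a₂ a₃ a₄ x * weight a₁ a₂ a₃ a₄ x = 0 := by
  have hsplit (x : ℝ) : dosPoly a₁ a₂ a₃ a₄ x * weight a₁ a₂ a₃ a₄ x =
      (x ^ 2 - (1 / 2) * l₁ a₁ a₂ a₃ a₄ * x + (1 / 2) * (a₃ * a₄ + a₂ * a₁)) *
        weight a₁ a₂ a₃ a₄ x -
      (ellipticRatio a₁ a₂ a₃ a₄ / 2) * (a₃ - a₁) * (a₄ - a₂) * weight a₁ a₂ a₃ a₄ x := by
    rw [dosPoly, constA]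
    ring
  simp_rw [hsplit]
  rw [intervalIntegral.integral_sub (intervalIntegrable_mul_weight h₁ h₂ h₃ (by fun_prop))
    ((intervalIntegrable_weight h₁ h₂ h₃ a₁ a₂).const_mul _),
    intervalIntegral.integral_const_mul, integral_quadratic_mul_weight h₁ h₂ h₃,
    integral_div_mul_weight h₁ h₂ h₃, integral_weight h₁ h₂ h₃, ellipticRatio]
  have := (ellipticK_pos (ellipticParameter_lt_one h₁ h₂ h₃)).ne'
  have : a₄ - a₁ ≠ 0 := by linarith
  field_simp
  ring

theorem weight_neg (x : ℝ) :
    weight a₁ a₂ a₃ a₄ (-x) = weight (-a₄) (-a₃) (-a₂) (-a₁) x := by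
  rw [weight, weight, branchPoly, branchPoly]
  ring_nf

theorem dosPoly_neg (x : ℝ) :
    dosPoly a₁ a₂ a₃ a₄ (-x) = dosPoly (-a₄) (-a₃) (-a₂) (-a₁) x := by
  have hm : ellipticParameter (-a₄) (-a₃) (-a₂) (-a₁) = ellipticParameter a₁ a₂ a₃ a₄ := by
    unfold ellipticParameter
    congr 1 <;> ring
  rw [dosPoly, dosPoly, constA, constA, ellipticRatio, ellipticRatio, hm, l₁, l₁]
  ring

theorem integral_dosPoly_right (h₁ : a₁ < a₂) (h₂ : a₂ < a₃) (h₃ : a₃ < a₄) :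
    ∫ x in a₃..a₄, dosPoly a₁ a₂ a₃ a₄ x * weight a₁ a₂ a₃ a₄ x = 0 := by
  have h := integral_dosPoly_left (neg_lt_neg h₃) (neg_lt_neg h₂) (neg_lt_neg h₁)
  simp_rw [← dosPoly_neg, ← weight_neg] at h
  rw [intervalIntegral.integral_comp_neg
    (fun x => dosPoly a₁ a₂ a₃ a₄ x * weight a₁ a₂ a₃ a₄ x)] at h
  simpa only [neg_neg] using h

theorem dofPoly_eq_deriv_add (x : ℝ) : dofPoly a₁ a₂ a₃ a₄ x =
    deriv (branchPoly a₁ a₂ a₃ a₄) x + l₁ a₁ a₂ a₃ a₄ * dosPoly a₁ a₂ a₃ a₄ x := by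
  rw [(hasDerivAt_branchPoly x).deriv, dofPoly, dosPoly, constA, constB, l₁, l₂]
  ring

theorem integral_dofPoly_eq_zero (h₁ : a₁ < a₂) (h₂ : a₂ < a₃) (h₃ : a₃ < a₄) {c d : ℝ}
    (hderiv : ∫ x in c..d, deriv (branchPoly a₁ a₂ a₃ a₄) x * weight a₁ a₂ a₃ a₄ x = 0)
    (hdos : ∫ x in c..d, dosPoly a₁ a₂ a₃ a₄ x * weight a₁ a₂ a₃ a₄ x = 0) :
    ∫ x in c..d, dofPoly a₁ a₂ a₃ a₄ x * weight a₁ a₂ a₃ a₄ x = 0 := by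
  have hsplit (x : ℝ) : dofPoly a₁ a₂ a₃ a₄ x * weight a₁ a₂ a₃ a₄ x =
      deriv (branchPoly a₁ a₂ a₃ a₄) x * weight a₁ a₂ a₃ a₄ x +
        l₁ a₁ a₂ a₃ a₄ * (dosPoly a₁ a₂ a₃ a₄ x * weight a₁ a₂ a₃ a₄ x) := by
    rw [dofPoly_eq_deriv_add]
    ring
  simp_rw [hsplit]
  rw [intervalIntegral.integral_add
    (intervalIntegrable_mul_weight h₁ h₂ h₃ continuous_deriv_branchPoly.continuousOn)
    ((intervalIntegrable_mul_weight h₁ h₂ h₃ (by unfold dosPoly; fun_prop)).const_mul _),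
    intervalIntegral.integral_const_mul, hderiv, hdos, mul_zero, add_zero]

theorem integral_dofPoly_left (h₁ : a₁ < a₂) (h₂ : a₂ < a₃) (h₃ : a₃ < a₄) :
    ∫ x in a₁..a₂, dofPoly a₁ a₂ a₃ a₄ x * weight a₁ a₂ a₃ a₄ x = 0 :=
  integral_dofPoly_eq_zero h₁ h₂ h₃
    (integral_deriv_branchPoly_mul_weight h₁ h₂ h₃ h₁.le (by simp [branchPoly])
      (by simp [branchPoly]) fun _ hx => branchPoly_neg_of_mem_left h₂.le h₃.le hx)
    (integral_dosPoly_left h₁ h₂ h₃)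

theorem integral_dofPoly_right (h₁ : a₁ < a₂) (h₂ : a₂ < a₃) (h₃ : a₃ < a₄) :
    ∫ x in a₃..a₄, dofPoly a₁ a₂ a₃ a₄ x * weight a₁ a₂ a₃ a₄ x = 0 :=
  integral_dofPoly_eq_zero h₁ h₂ h₃
    (integral_deriv_branchPoly_mul_weight h₁ h₂ h₃ h₃.le (by simp [branchPoly])
      (by simp [branchPoly]) fun _ hx => branchPoly_neg_of_mem_right h₁.le h₂.le hx)
    (integral_dosPoly_right h₁ h₂ h₃)

theorem complexSqrt_sub_of_le {x a : ℝ} (h : a ≤ x) :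
    ((x : ℂ) - a).sqrt = (√|x - a| : ℂ) := by
  rw [← Complex.ofReal_sub, complexSqrt_ofReal (sub_nonneg.2 h), abs_of_nonneg (sub_nonneg.2 h)]

theorem complexSqrt_sub_of_ge {x a : ℝ} (h : x ≤ a) :
    ((x : ℂ) - a).sqrt = Complex.I * (√|x - a| : ℂ) := by
  rw [← Complex.ofReal_sub, complexSqrt_ofReal_of_nonpos (sub_nonpos.2 h), ← Complex.ofReal_neg,
    complexSqrt_ofReal (neg_nonneg.2 (sub_nonpos.2 h)), abs_of_nonpos (sub_nonpos.2 h)]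

theorem inv_surfaceRoot_left (h₂ : a₂ ≤ a₃) (h₃ : a₃ ≤ a₄) {x : ℝ} (hx : x ∈ Icc a₁ a₂) :
    (surfaceRoot a₁ a₂ a₃ a₄ x)⁻¹ = Complex.I * (weight a₁ a₂ a₃ a₄ x : ℂ) := by
  rw [surfaceRoot_eq_complexSqrt_mul (hx.1.trans hx.2) h₃, complexSqrt_sub_of_le hx.1,
    complexSqrt_sub_of_ge hx.2, complexSqrt_sub_of_ge (hx.2.trans h₂),
    complexSqrt_sub_of_ge (hx.2.trans (h₂.trans h₃)), weight_eq_mul]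
  push_cast
  simp only [mul_inv, Complex.inv_I]
  linear_combination (-Complex.I * (√|x - a₁| : ℂ)⁻¹ * (√|x - a₂| : ℂ)⁻¹ *
    (√|x - a₃| : ℂ)⁻¹ * (√|x - a₄| : ℂ)⁻¹) * Complex.I_sq

theorem inv_surfaceRoot_right (h₁ : a₁ ≤ a₂) (h₂ : a₂ ≤ a₃) {x : ℝ} (hx : x ∈ Icc a₃ a₄) :
    (surfaceRoot a₁ a₂ a₃ a₄ x)⁻¹ = -Complex.I * (weight a₁ a₂ a₃ a₄ x : ℂ) := by
  rw [surfaceRoot_eq_complexSqrt_mul h₁ (hx.1.trans hx.2), complexSqrt_sub_of_le hx.1,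
    complexSqrt_sub_of_ge hx.2, complexSqrt_sub_of_le (h₂.trans hx.1),
    complexSqrt_sub_of_le (h₁.trans (h₂.trans hx.1)), weight_eq_mul]
  push_cast
  simp only [mul_inv, Complex.inv_I]
  ring

theorem integral_div_surfaceRoot {c d : ℝ} {κ : ℂ} (hcd : c ≤ d)
    (hκ : ∀ x ∈ Icc c d, (surfaceRoot a₁ a₂ a₃ a₄ x)⁻¹ = κ * weight a₁ a₂ a₃ a₄ x) {P : ℂ → ℂ}
    {p : ℝ → ℝ} (hP : ∀ x : ℝ, P x = p x) :
    ∫ x in c..d, P x / surfaceRoot a₁ a₂ a₃ a₄ x =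
      κ * ((∫ x in c..d, p x * weight a₁ a₂ a₃ a₄ x : ℝ) : ℂ) := by
  rw [← intervalIntegral.integral_ofReal, ← intervalIntegral.integral_const_mul]
  refine intervalIntegral.integral_congr fun x hx => ?_
  rw [uIcc_of_le hcd] at hx
  simp only [hP, div_eq_mul_inv (p x : ℂ), hκ x hx, Complex.ofReal_mul]
  ring

end Bands

section Infinity

variable {a₁ a₂ a₃ a₄ : ℝ}

/-- The numerator of `π * genusOneDOS`. -/
noncomputable def dosNumerator (a₁ a₂ a₃ a₄ : ℝ) (z : ℂ) : ℂ :=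
  z ^ 2 - (1 / 2) * (l₁ a₁ a₂ a₃ a₄ : ℂ) * z + (constA a₁ a₂ a₃ a₄ : ℂ)

/-- The numerator of `π * genusOneDOF`. -/
noncomputable def dofNumerator (a₁ a₂ a₃ a₄ : ℝ) (z : ℂ) : ℂ :=
  4 * z ^ 3 - 2 * (l₁ a₁ a₂ a₃ a₄ : ℂ) * z ^ 2 +
    (2 * (l₂ a₁ a₂ a₃ a₄ : ℂ) - (l₁ a₁ a₂ a₃ a₄ : ℂ) ^ 2 / 2) * z + (constB a₁ a₂ a₃ a₄ : ℂ)

theorem dosNumerator_ofReal (x : ℝ) :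
    dosNumerator a₁ a₂ a₃ a₄ x = (dosPoly a₁ a₂ a₃ a₄ x : ℂ) := by
  simp [dosNumerator, dosPoly]

theorem dofNumerator_ofReal (x : ℝ) :
    dofNumerator a₁ a₂ a₃ a₄ x = (dofPoly a₁ a₂ a₃ a₄ x : ℂ) := by
  simp [dofNumerator, dofPoly]

theorem differentiable_dosNumerator : Differentiable ℂ (dosNumerator a₁ a₂ a₃ a₄) := by
  unfold dosNumerator
  fun_prop

theorem differentiable_dofNumerator : Differentiable ℂ (dofNumerator a₁ a₂ a₃ a₄) := by
  unfold dofNumerator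
  fun_prop

theorem tendsto_surfaceRoot_mul_add_div {p q : ℂ → ℂ} {n : ℕ} {k : ℂ}
    (hp : Tendsto (fun z => p z / z ^ (n + 1)) (Bornology.cobounded ℂ) (𝓝 k))
    (hq : Tendsto (fun z => q z / z ^ n) (Bornology.cobounded ℂ) (𝓝 k)) :
    Tendsto (fun z => surfaceRoot a₁ a₂ a₃ a₄ z *
      (p z * cutRoot (-1) 1 z + q z * surfaceRoot a₁ a₂ a₃ a₄ z) / z ^ (n + 4))
      (Bornology.cobounded ℂ) (𝓝 (2 * k)) := by
  have hR := tendsto_surfaceRoot_div a₁ a₂ a₃ a₄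
  have hprod := hR.mul ((hp.mul (tendsto_cutRoot_div (-1) 1)).add (hq.mul hR))
  rw [one_mul, mul_one, ← two_mul] at hprod
  refine hprod.congr' ?_
  filter_upwards [Bornology.eventually_ne_cobounded (0 : ℂ)] with z hz
  field_simp
  ring

/-- Rationalization: `p √(z² - 1) / R - q` is `p² (z² - 1) - q² R²` divided by
`R (p √(z² - 1) + q R)`, so its decay is a statement about polynomials. -/
theorem tendsto_mul_cutRoot_div_sub {p q : ℂ → ℂ} {n : ℕ} {k : ℂ} (hk : k ≠ 0)
    (hp : Tendsto (fun z => p z / z ^ (n + 1)) (Bornology.cobounded ℂ) (𝓝 k))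
    (hq : Tendsto (fun z => q z / z ^ n) (Bornology.cobounded ℂ) (𝓝 k))
    (hN : Tendsto (fun z => (p z ^ 2 * (z ^ 2 - 1) -
      q z ^ 2 * ((z - a₁) * (z - a₂) * (z - a₃) * (z - a₄))) / z ^ (n + 4))
      (Bornology.cobounded ℂ) (𝓝 0)) :
    Tendsto (fun z => p z * cutRoot (-1) 1 z / surfaceRoot a₁ a₂ a₃ a₄ z - q z)
      (Bornology.cobounded ℂ) (𝓝 0) := by
  have hk₂ : 2 * k ≠ 0 := mul_ne_zero two_ne_zero hk
  have hden := tendsto_surfaceRoot_mul_add_div (a₁ := a₁) (a₂ := a₂) (a₃ := a₃) (a₄ := a₄) hp hq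
  have hquot := hN.div hden hk₂
  rw [zero_div] at hquot
  refine hquot.congr' ?_
  filter_upwards [hden.eventually_ne hk₂, Bornology.eventually_ne_cobounded (0 : ℂ)] with z hz hz₀
  have hz' := left_ne_zero_of_mul hz
  have hR := left_ne_zero_of_mul hz'
  rw [Pi.div_apply, div_div_div_cancel_right₀ (pow_ne_zero _ hz₀), ← cutRoot_unit_sq,
    ← surfaceRoot_sq, div_eq_iff hz', div_sub' hR, div_mul_eq_mul_div, eq_div_iff hR]
  ring

theorem tendsto_of_eq_comp_inv {g f : ℂ → ℂ} {k : ℂ} (hf : Continuous f) (hk : f 0 = k)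
    (h : ∀ z ≠ 0, g z = f z⁻¹) : Tendsto g (Bornology.cobounded ℂ) (𝓝 k) := by
  rw [← hk]
  refine ((hf.tendsto 0).comp tendsto_inv₀_cobounded).congr' ?_
  filter_upwards [Bornology.eventually_ne_cobounded (0 : ℂ)] with z hz
  exact (h z hz).symm

theorem exists_prod_sub_branchPoints_eq (a₁ a₂ a₃ a₄ : ℝ) : ∃ e₃ e₄ : ℂ, ∀ z : ℂ,
    (z - a₁) * (z - a₂) * (z - a₃) * (z - a₄) =
      z ^ 4 - (l₁ a₁ a₂ a₃ a₄ : ℂ) * z ^ 3 + (l₂ a₁ a₂ a₃ a₄ : ℂ) * z ^ 2 - e₃ * z + e₄ := by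
  refine ⟨a₁ * a₂ * a₃ + a₁ * a₂ * a₄ + a₁ * a₃ * a₄ + a₂ * a₃ * a₄, a₁ * a₂ * a₃ * a₄,
    fun z => ?_⟩
  rw [l₁, l₂]
  push_cast
  ring

theorem tendsto_dosNumerator_mul_cutRoot_div_sub :
    Tendsto (fun z => dosNumerator a₁ a₂ a₃ a₄ z * cutRoot (-1) 1 z /
      surfaceRoot a₁ a₂ a₃ a₄ z - z) (Bornology.cobounded ℂ) (𝓝 0) := by
  obtain ⟨e₃, e₄, hprod⟩ := exists_prod_sub_branchPoints_eq a₁ a₂ a₃ a₄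
  simp only [dosNumerator]
  generalize (l₁ a₁ a₂ a₃ a₄ : ℂ) = L at *
  generalize (l₂ a₁ a₂ a₃ a₄ : ℂ) = M at *
  generalize (constA a₁ a₂ a₃ a₄ : ℂ) = A
  refine tendsto_mul_cutRoot_div_sub (n := 1) one_ne_zero ?_ ?_ ?_
  · refine tendsto_of_eq_comp_inv (f := fun w => 1 - (1 / 2) * L * w + A * w ^ 2) (by fun_prop)
      (by simp) fun z hz => ?_
    field
  · refine tendsto_of_eq_comp_inv (f := fun _ => 1) (by fun_prop) rfl fun z hz => ?_
    field
  · simp only [hprod]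
    refine tendsto_of_eq_comp_inv (f := fun w => w * (-1 + 2 * A - M + (1 / 4) * L ^ 2 +
      w * (e₃ + L - L * A) + w ^ 2 * (-2 * A + A ^ 2 - e₄ - (1 / 4) * L ^ 2) + w ^ 3 * (L * A) -
      w ^ 4 * A ^ 2)) (by fun_prop) (by simp) fun z hz => ?_
    field

theorem tendsto_dofNumerator_mul_cutRoot_div_sub :
    Tendsto (fun z => dofNumerator a₁ a₂ a₃ a₄ z * cutRoot (-1) 1 z /
      surfaceRoot a₁ a₂ a₃ a₄ z - (4 * z ^ 2 - 2)) (Bornology.cobounded ℂ) (𝓝 0) := by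
  obtain ⟨e₃, e₄, hprod⟩ := exists_prod_sub_branchPoints_eq a₁ a₂ a₃ a₄
  simp only [dofNumerator]
  generalize (l₁ a₁ a₂ a₃ a₄ : ℂ) = L at *
  generalize (l₂ a₁ a₂ a₃ a₄ : ℂ) = M at *
  generalize (constB a₁ a₂ a₃ a₄ : ℂ) = B
  refine tendsto_mul_cutRoot_div_sub (n := 2) (k := 4) (by norm_num) ?_ ?_ ?_
  · refine tendsto_of_eq_comp_inv (f := fun w => 4 - 2 * L * w + (2 * M - L ^ 2 / 2) * w ^ 2 +
      B * w ^ 3) (by fun_prop) (by simp) fun z hz => ?_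
    field
  · refine tendsto_of_eq_comp_inv (f := fun w => 4 - 2 * w ^ 2) (by fun_prop) (by simp)
      fun z hz => ?_
    field
  · simp only [hprod]
    refine tendsto_of_eq_comp_inv (f := fun w => w * (8 * B + 16 * e₃ - 8 * L * M + 2 * L ^ 3 +
      w * (-4 - 16 * e₄ + 4 * M ^ 2 - 4 * L * B - 2 * L ^ 2 * M + (1 / 4) * L ^ 4) +
      w ^ 2 * (-8 * B - 16 * e₃ + 4 * M * B + 4 * L + 8 * L * M - L ^ 2 * B - 2 * L ^ 3) +
      w ^ 3 * (B ^ 2 + 16 * e₄ - 4 * M - 4 * M ^ 2 + 4 * L * B + 2 * L ^ 2 * M -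
        (1 / 4) * L ^ 4) +
      w ^ 4 * (4 * e₃ - 4 * M * B + L ^ 2 * B) - w ^ 5 * (B ^ 2 + 4 * e₄))) (by fun_prop)
      (by simp) fun z hz => ?_
    field

end Infinity

theorem ExtendsAnalyticallyAt.add {D f : ℂ → ℂ} {z : ℂ} (hD : ExtendsAnalyticallyAt D z)
    (hf : AnalyticAt ℂ f z) : ExtendsAnalyticallyAt (fun w => D w + f w) z := by
  obtain ⟨H, hH, hDH⟩ := hD
  exact ⟨_, hH.add hf, hDH.mono fun w hw hw₀ => congrArg (· + f w) (hw hw₀)⟩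

theorem tendsto_ofReal_mul_I_cobounded :
    Tendsto (fun t : ℝ => (t : ℂ) * Complex.I) atTop (Bornology.cobounded ℂ) := by
  rw [← tendsto_norm_atTop_iff_cobounded]
  exact tendsto_abs_atTop_atTop.congr fun t => by simp

theorem eq_zero_of_tendsto_cobounded {D : ℂ → ℂ} (hD : ∀ z, ExtendsAnalyticallyAt D z)
    (hlim : Tendsto D (Bornology.cobounded ℂ) (𝓝 0)) {z : ℂ} (hz : z.im ≠ 0) : D z = 0 := by
  obtain ⟨c, hc⟩ := exists_eqOn_const_of_norm_le hD (C := 1)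
    ((NormedAddGroup.tendsto_nhds_zero.1 hlim 1 one_pos).mono fun z hz _ => hz.le)
  have hzero : Tendsto (fun _ : ℝ => c) atTop (𝓝 0) := by
    refine (hlim.comp tendsto_ofReal_mul_I_cobounded).congr' ?_
    filter_upwards [eventually_gt_atTop 0] with t ht
    exact hc _ (by simpa using ht.ne')
  rw [hc z hz, tendsto_nhds_unique hzero tendsto_const_nhds]

section Existence

variable {a₁ a₂ a₃ a₄ : ℝ}

theorem norm_cutRoot_unit (z : ℂ) : ‖cutRoot (-1) 1 z‖ = √‖z ^ 2 - 1‖ := by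
  rw [← cutRoot_unit_sq, norm_pow, Real.sqrt_sq (norm_nonneg _)]

theorem exists_surfaceRoot_sq_eq_sub_mul (h₁ : a₁ < a₂) (h₂ : a₂ < a₃) (h₃ : a₃ < a₄) {c : ℝ}
    (hc : (c : ℂ) ∈ branchPoints a₁ a₂ a₃ a₄) :
    ∃ Q : ℂ → ℂ, Continuous Q ∧ Q c ≠ 0 ∧
      ∀ z, surfaceRoot a₁ a₂ a₃ a₄ z ^ 2 = (z - c) * Q z := by
  have hne {a b : ℝ} (h : a ≠ b) : (a : ℂ) - b ≠ 0 := sub_ne_zero.2 (Complex.ofReal_injective.ne h)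
  have h₁₃ := h₁.trans h₂
  have h₂₄ := h₂.trans h₃
  have h₁₄ := h₁.trans h₂₄
  simp only [surfaceRoot_sq]
  rcases ofReal_mem_branchPoints.1 hc with rfl | rfl | rfl | rfl
  · exact ⟨fun z => (z - a₂) * (z - a₃) * (z - a₄), by fun_prop,
      mul_ne_zero (mul_ne_zero (hne h₁.ne) (hne h₁₃.ne)) (hne h₁₄.ne), fun z => by ring⟩
  · exact ⟨fun z => (z - a₁) * (z - a₃) * (z - a₄), by fun_prop,
      mul_ne_zero (mul_ne_zero (hne h₁.ne') (hne h₂.ne)) (hne h₂₄.ne), fun z => by ring⟩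
  · exact ⟨fun z => (z - a₁) * (z - a₂) * (z - a₄), by fun_prop,
      mul_ne_zero (mul_ne_zero (hne h₁₃.ne') (hne h₂.ne')) (hne h₃.ne), fun z => by ring⟩
  · exact ⟨fun z => (z - a₁) * (z - a₂) * (z - a₃), by fun_prop,
      mul_ne_zero (mul_ne_zero (hne h₁₄.ne') (hne h₂₄.ne')) (hne h₃.ne'), fun z => by ring⟩

theorem tendsto_im_div_surfaceRoot (h₁ : a₁ < a₂) (h₂ : a₂ < a₃) (h₃ : a₃ < a₄) (c : ℝ) :
    Tendsto (fun z : ℂ => (z.im : ℂ) / surfaceRoot a₁ a₂ a₃ a₄ z) (𝓝 (c : ℂ)) (𝓝 0) := by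
  obtain ⟨a, Q, hQ, hQc, hRQ⟩ : ∃ (a : ℝ) (Q : ℂ → ℂ), Continuous Q ∧ Q c ≠ 0 ∧
      ∀ z, surfaceRoot a₁ a₂ a₃ a₄ z ^ 2 = (z - a) * Q z := by
    by_cases hc : (c : ℂ) ∈ branchPoints a₁ a₂ a₃ a₄
    · exact ⟨c, exists_surfaceRoot_sq_eq_sub_mul h₁ h₂ h₃ hc⟩
    · refine ⟨a₄, fun z => (z - a₁) * (z - a₂) * (z - a₃), by fun_prop, fun h => ?_, fun z => ?_⟩
      · refine surfaceRoot_ne_zero hc (sq_eq_zero_iff.1 ?_)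
        rw [surfaceRoot_sq]
        exact mul_eq_zero_of_left h _
      · rw [surfaceRoot_sq]
        ring
  have hlim : Tendsto (fun z : ℂ => √(|z.im| / ‖Q z‖)) (𝓝 (c : ℂ)) (𝓝 0) := by
    have hcont : ContinuousAt (fun z : ℂ => √(|z.im| / ‖Q z‖)) (c : ℂ) :=
      (ContinuousAt.div (by fun_prop) hQ.norm.continuousAt (norm_ne_zero_iff.2 hQc)).sqrt
    simpa using hcont.tendsto
  refine squeeze_zero_norm (fun z => Real.le_sqrt_of_sq_le ?_) hlim
  have him : |z.im| ≤ ‖z - a‖ := by simpa using Complex.abs_im_le_norm (z - a)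
  rw [norm_div, div_pow, ← norm_pow (surfaceRoot _ _ _ _ z), hRQ, norm_mul, Complex.norm_real,
    Real.norm_eq_abs, sq, mul_div_mul_comm]
  exact mul_le_of_le_one_left (by positivity) (div_le_one_of_le₀ him (norm_nonneg _))

theorem interior_spectralSupport_subset_Ioo (h₀ : -1 ≤ a₁) (h₁ : a₁ < a₂) (h₂ : a₂ < a₃)
    (h₃ : a₃ < a₄) (h₄ : a₄ ≤ 1) : interior (spectralSupport a₁ a₂ a₃ a₄) ⊆ Ioo (-1) 1 :=
  interior_Icc (a := (-1 : ℝ)) ▸ interior_mono (spectralSupport_subset_Icc h₀ h₁ h₂ h₃ h₄)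

theorem notMem_bandSet_of_mem_interior (h₁ : a₁ < a₂) (h₂ : a₂ < a₃) (h₃ : a₃ < a₄) {x : ℝ}
    (hx : x ∈ interior (spectralSupport a₁ a₂ a₃ a₄)) : (x : ℂ) ∉ bandSet a₁ a₂ a₃ a₄ := by
  have hdisj : Disjoint (spectralSupport a₁ a₂ a₃ a₄) (Ioo a₁ a₂ ∪ Ioo a₃ a₄) := by
    rw [Set.disjoint_left]
    rintro y ((hy | hy) | hy) (hy' | hy') <;> linarith [hy.1, hy.2, hy'.1, hy'.2]
  have hclosure := (hdisj.mono_left interior_subset).closure_right isOpen_interior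
  rw [closure_union, closure_Ioo h₁.ne, closure_Ioo h₃.ne] at hclosure
  rintro ⟨y, hy, hyx⟩
  rw [Complex.ofReal_inj.1 hyx] at hy
  exact Set.disjoint_left.1 hclosure hx hy

theorem mem_interior_spectralSupport {x : ℝ} (hx : x ∈ spectralSupport a₁ a₂ a₃ a₄)
    (hb : (x : ℂ) ∉ branchPoints a₁ a₂ a₃ a₄) (hl : x ≠ -1) (hr : x ≠ 1) :
    x ∈ interior (spectralSupport a₁ a₂ a₃ a₄) := by
  simp only [ofReal_mem_branchPoints, not_or] at hb
  obtain ⟨hx₁, hx₂, hx₃, hx₄⟩ := hb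
  have hmem {c d : ℝ} (hsub : Icc c d ⊆ spectralSupport a₁ a₂ a₃ a₄) (hcd : x ∈ Icc c d)
      (hc : x ≠ c) (hd : x ≠ d) : x ∈ interior (spectralSupport a₁ a₂ a₃ a₄) :=
    interior_mono hsub (interior_Icc (a := c) ▸ ⟨hcd.1.lt_of_ne' hc, hcd.2.lt_of_ne hd⟩)
  rcases hx with (hx | hx) | hx
  · exact hmem (fun y hy => Or.inl (Or.inl hy)) hx hl hx₁
  · exact hmem (fun y hy => Or.inl (Or.inr hy)) hx hx₂ hx₃
  · exact hmem (fun y hy => Or.inr hy) hx hx₄ hr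

theorem mem_spectralSupport_of_mem_branchPoints (h₀ : -1 ≤ a₁) (h₂ : a₂ ≤ a₃) (h₄ : a₄ ≤ 1)
    {x : ℝ} (hx : (x : ℂ) ∈ branchPoints a₁ a₂ a₃ a₄) : x ∈ spectralSupport a₁ a₂ a₃ a₄ := by
  rcases ofReal_mem_branchPoints.1 hx with rfl | rfl | rfl | rfl
  · exact Or.inl (Or.inl ⟨h₀, le_rfl⟩)
  · exact Or.inl (Or.inr ⟨le_rfl, h₂⟩)
  · exact Or.inl (Or.inr ⟨h₂, le_rfl⟩)
  · exact Or.inr ⟨le_rfl, h₄⟩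

/-- The density `p / (π R)`, for a numerator `p`. -/
noncomputable def surfaceDensity (a₁ a₂ a₃ a₄ : ℝ) (p : ℂ → ℂ) (z : ℂ) : ℂ :=
  1 / (Real.pi : ℂ) * (p z / surfaceRoot a₁ a₂ a₃ a₄ z)

/-- The Cauchy transform over the spectral support of `u(w) √(1 - w²)`, the function to which the
condensate equation applies the finite Hilbert transform. -/
noncomputable def supportTransform (a₁ a₂ a₃ a₄ : ℝ) (u : ℂ → ℂ) (z : ℂ) : ℂ :=
  cauchyTransform (spectralSupport a₁ a₂ a₃ a₄) (fun w => u w * (√(1 - w ^ 2) : ℂ)) z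

theorem integrableOn_mul_sqrt_one_sub_sq (h₀ : -1 ≤ a₁) (h₁ : a₁ < a₂) (h₂ : a₂ < a₃)
    (h₃ : a₃ < a₄) (h₄ : a₄ ≤ 1) {u : ℝ → ℂ} (hu : IntegrableOn u (Icc (-1) 1)) :
    IntegrableOn (fun w => u w * (√(1 - w ^ 2) : ℂ)) (spectralSupport a₁ a₂ a₃ a₄) :=
  (hu.mul_continuousOn (by fun_prop) isCompact_Icc).mono_set
    (spectralSupport_subset_Icc h₀ h₁ h₂ h₃ h₄)

open Asymptotics in
theorem supportTransform_isBigO_inv (h₀ : -1 ≤ a₁) (h₁ : a₁ < a₂) (h₂ : a₂ < a₃)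
    (h₃ : a₃ < a₄) (h₄ : a₄ ≤ 1) {u : ℂ → ℂ}
    (hu : IntegrableOn (fun x : ℝ => u x) (Icc (-1) 1)) :
    supportTransform a₁ a₂ a₃ a₄ u =O[Bornology.cobounded ℂ] fun z => z⁻¹ :=
  cauchyTransform_isBigO_inv isClosed_spectralSupport.measurableSet
    (integrableOn_mul_sqrt_one_sub_sq h₀ h₁ h₂ h₃ h₄ hu)
    fun _ hw => abs_le.2 (spectralSupport_subset_Icc h₀ h₁ h₂ h₃ h₄ hw)

/-- On the spectral support `√(1 - w²)` is `∓ i` times the boundary values of `√(z² - 1)`, so the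
jump relation for `supportTransform u` has `π u √(z² - 1)` on both sides of the axis. -/
theorem exists_analyticAt_supportTransform_eq (h₀ : -1 ≤ a₁) (h₁ : a₁ < a₂) (h₂ : a₂ < a₃)
    (h₃ : a₃ < a₄) (h₄ : a₄ ≤ 1) {u : ℂ → ℂ}
    (hu : DifferentiableOn ℂ u (bandSet a₁ a₂ a₃ a₄)ᶜ)
    (hint : IntegrableOn (fun x : ℝ => u x) (Icc (-1) 1)) {x : ℝ}
    (hx : x ∈ interior (spectralSupport a₁ a₂ a₃ a₄)) :
    ∃ H : ℂ → ℂ, AnalyticAt ℂ H x ∧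
      HasFiniteHilbertTransform (spectralSupport a₁ a₂ a₃ a₄)
        (fun w => u w * (√(1 - w ^ 2) : ℂ)) x (1 / Real.pi * H x) ∧
      ∀ᶠ z in 𝓝 (x : ℂ), z.im ≠ 0 →
        supportTransform a₁ a₂ a₃ a₄ u z = H z + Real.pi * u z * cutRoot (-1) 1 z := by
  have hunit := interior_spectralSupport_subset_Ioo h₀ h₁ h₂ h₃ h₄ hx
  have hanalytic : AnalyticAt ℂ (fun z => u z * circleRoot z) x := by
    refine (hu.analyticAt (isClosed_bandSet.isOpen_compl.mem_nhds
      (notMem_bandSet_of_mem_interior h₁ h₂ h₃ hx))).mul ?_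
    rw [Complex.analyticAt_iff_eventually_differentiableAt]
    filter_upwards [(isOpen_Ioo.preimage Complex.continuous_re).mem_nhds hunit] with z hz
    exact differentiableAt_circleRoot hz
  obtain ⟨H, hH, hpv, hjump⟩ := exists_analyticAt_cauchyTransform_eq isClosed_spectralSupport
    (mem_interior_iff_mem_nhds.1 hx)
    (integrableOn_mul_sqrt_one_sub_sq h₀ h₁ h₂ h₃ h₄ hint) hanalytic
    (by filter_upwards [Ioo_mem_nhds hunit.1 hunit.2] with w hw
        rw [circleRoot_ofReal (Ioo_subset_Icc_self hw)])
  refine ⟨H, hH, hpv, hjump.mono fun z hz hz₀ => ?_⟩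
  rw [supportTransform]
  rcases hz₀.lt_or_gt with him | him
  · rw [hz.2 him, cutRoot_unit_of_im_neg him]
    ring
  · rw [hz.1 him, cutRoot_unit_of_im_pos him]
    ring

theorem integrableOn_surfaceDensity (h₁ : a₁ < a₂) (h₂ : a₂ < a₃) (h₃ : a₃ < a₄) {p : ℂ → ℂ}
    (hp : Continuous p) :
    IntegrableOn (fun x : ℝ => surfaceDensity a₁ a₂ a₃ a₄ p x) (Icc (-1) 1) :=
  (integrableOn_div_surfaceRoot h₁ h₂ h₃ hp _ _).const_mul _

theorem differentiableOn_surfaceDensity (h₁ : a₁ ≤ a₂) (h₃ : a₃ ≤ a₄) {p : ℂ → ℂ}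
    (hp : Differentiable ℂ p) :
    DifferentiableOn ℂ (surfaceDensity a₁ a₂ a₃ a₄ p) (bandSet a₁ a₂ a₃ a₄)ᶜ := fun z hz =>
  (((hp z).div (differentiableAt_surfaceRoot h₁ h₃ hz) (surfaceRoot_ne_zero
    fun hb => hz (branchPoints_subset_bandSet h₁ h₃ hb))).const_mul _).differentiableWithinAt

theorem pi_mul_surfaceDensity_mul (p : ℂ → ℂ) (z c : ℂ) :
    Real.pi * surfaceDensity a₁ a₂ a₃ a₄ p z * c = p z * c / surfaceRoot a₁ a₂ a₃ a₄ z := by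
  have hpi : (Real.pi : ℂ) ≠ 0 := Complex.ofReal_ne_zero.2 Real.pi_ne_zero
  rw [surfaceDensity]
  field

theorem extendsAnalyticallyAt_cauchyTransform_sub_of_forall_ne (h₀ : -1 ≤ a₁) (h₁ : a₁ ≤ a₂)
    (h₂ : a₂ ≤ a₃) (h₃ : a₃ ≤ a₄) (h₄ : a₄ ≤ 1) {f : ℝ → ℂ}
    (hf : IntegrableOn f (spectralSupport a₁ a₂ a₃ a₄)) {p : ℂ → ℂ} (hp : Differentiable ℂ p)
    {z : ℂ} (hz : ∀ x ∈ spectralSupport a₁ a₂ a₃ a₄, (x : ℂ) ≠ z) :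
    ExtendsAnalyticallyAt (fun z => cauchyTransform (spectralSupport a₁ a₂ a₃ a₄) f z -
      p z * cutRoot (-1) 1 z / surfaceRoot a₁ a₂ a₃ a₄ z) z := by
  have hR (w : ℂ) (hw : ∀ x ∈ spectralSupport a₁ a₂ a₃ a₄, (x : ℂ) ≠ w) :
      surfaceRoot a₁ a₂ a₃ a₄ w ≠ 0 := by
    refine surfaceRoot_ne_zero fun hb => ?_
    obtain ⟨x, -, rfl⟩ := branchPoints_subset_bandSet h₁ h₃ hb
    exact hw x (mem_spectralSupport_of_mem_branchPoints h₀ h₂ h₄ hb) rfl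
  refine ⟨fun z => cauchyTransform (spectralSupport a₁ a₂ a₃ a₄) f z -
    p z * supportRoot a₁ a₂ a₃ a₄ z / ((z - a₁) * (z - a₂) * (z - a₃) * (z - a₄)), ?_, ?_⟩
  · rw [Complex.analyticAt_iff_eventually_differentiableAt]
    filter_upwards [(isOpen_setOf_forall_ofReal_ne isClosed_spectralSupport).mem_nhds hz]
      with w hw
    refine (differentiableAt_cauchyTransform isClosed_spectralSupport hf hw).sub
      (((hp w).mul (differentiableAt_supportRoot h₀ h₂ h₄ hw)).div (by fun_prop) ?_)
    rw [← surfaceRoot_sq]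
    exact pow_ne_zero 2 (hR w hw)
  · refine Eventually.of_forall fun w hw => ?_
    have := hR w fun x _ => ofReal_ne_of_im_ne_zero hw x
    beta_reduce
    rw [← surfaceRoot_sq, ← surfaceRoot_mul_cutRoot_unit h₀ h₁ h₂ h₃ h₄]
    field

theorem tendsto_im_mul_cauchyTransform_sub (h₁ : a₁ < a₂) (h₂ : a₂ < a₃) (h₃ : a₃ < a₄)
    {Γ : Set ℝ} {f : ℝ → ℂ} (hf : IntegrableOn f Γ) {p : ℂ → ℂ} (hp : Continuous p) (c : ℝ) :
    Tendsto (fun z => (z.im : ℂ) * (cauchyTransform Γ f z -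
      p z * cutRoot (-1) 1 z / surfaceRoot a₁ a₂ a₃ a₄ z)) (𝓝 (c : ℂ)) (𝓝 0) := by
  have hcont : Continuous fun z : ℂ => ‖p z‖ * √‖z ^ 2 - 1‖ := by fun_prop
  have hroot := (tendsto_im_div_surfaceRoot h₁ h₂ h₃ c).norm.mul (hcont.tendsto (c : ℂ))
  rw [norm_zero, zero_mul] at hroot
  have hquot : Tendsto (fun z : ℂ => (z.im : ℂ) / surfaceRoot a₁ a₂ a₃ a₄ z *
      (p z * cutRoot (-1) 1 z)) (𝓝 (c : ℂ)) (𝓝 0) := by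
    refine tendsto_zero_iff_norm_tendsto_zero.2 (hroot.congr fun z => ?_)
    rw [norm_mul, norm_mul (p z), norm_cutRoot_unit]
  have hsub := (tendsto_im_mul_cauchyTransform hf c).sub hquot
  rw [sub_zero] at hsub
  exact hsub.congr fun z => by ring

theorem extendsAnalyticallyAt_supportTransform_sub (h₀ : -1 ≤ a₁) (h₁ : a₁ < a₂)
    (h₂ : a₂ < a₃) (h₃ : a₃ < a₄) (h₄ : a₄ ≤ 1) {p : ℂ → ℂ} (hp : Differentiable ℂ p) (z : ℂ) :
    ExtendsAnalyticallyAt (fun z =>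
      supportTransform a₁ a₂ a₃ a₄ (surfaceDensity a₁ a₂ a₃ a₄ p) z -
        p z * cutRoot (-1) 1 z / surfaceRoot a₁ a₂ a₃ a₄ z) z := by
  have hint := integrableOn_surfaceDensity h₁ h₂ h₃ hp.continuous
  have hint' := integrableOn_mul_sqrt_one_sub_sq h₀ h₁ h₂ h₃ h₄ hint
  refine extendsAnalyticallyAt_of_finite (S := {a₁, a₂, a₃, a₄, -1, 1}) (toFinite _)
    (fun w hw => ?_)
    (fun c _ => tendsto_im_mul_cauchyTransform_sub h₁ h₂ h₃ hint' hp.continuous c) z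
  by_cases hwΓ : ∃ x ∈ spectralSupport a₁ a₂ a₃ a₄, (x : ℂ) = w
  · obtain ⟨x, hx, rfl⟩ := hwΓ
    have hxS : x ∉ ({a₁, a₂, a₃, a₄, -1, 1} : Set ℝ) := fun h => hw (mem_image_of_mem _ h)
    simp only [mem_insert_iff, mem_singleton_iff, not_or] at hxS
    obtain ⟨hx₁, hx₂, hx₃, hx₄, hl, hr⟩ := hxS
    obtain ⟨H, hH, -, hCT⟩ := exists_analyticAt_supportTransform_eq h₀ h₁ h₂ h₃ h₄
      (differentiableOn_surfaceDensity h₁.le h₃.le hp) hint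
      (mem_interior_spectralSupport hx (by simp [ofReal_mem_branchPoints, *]) hl hr)
    refine ⟨H, hH, hCT.mono fun w hw hw₀ => ?_⟩
    exact sub_eq_iff_eq_add.2 (by rw [← pi_mul_surfaceDensity_mul]; exact hw hw₀)
  · push Not at hwΓ
    exact extendsAnalyticallyAt_cauchyTransform_sub_of_forall_ne h₀ h₁.le h₂.le h₃.le h₄ hint' hp
      hwΓ

theorem supportTransform_surfaceDensity (h₀ : -1 ≤ a₁) (h₁ : a₁ < a₂) (h₂ : a₂ < a₃)
    (h₃ : a₃ < a₄) (h₄ : a₄ ≤ 1) {p q : ℂ → ℂ} (hp : Differentiable ℂ p)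
    (hq : Differentiable ℂ q)
    (hlim : Tendsto (fun z => p z * cutRoot (-1) 1 z / surfaceRoot a₁ a₂ a₃ a₄ z - q z)
      (Bornology.cobounded ℂ) (𝓝 0)) {z : ℂ} (hz : z.im ≠ 0) :
    supportTransform a₁ a₂ a₃ a₄ (surfaceDensity a₁ a₂ a₃ a₄ p) z =
      p z * cutRoot (-1) 1 z / surfaceRoot a₁ a₂ a₃ a₄ z - q z := by
  have hdecay := ((supportTransform_isBigO_inv h₀ h₁ h₂ h₃ h₄
    (integrableOn_surfaceDensity h₁ h₂ h₃ hp.continuous)).trans_tendsto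
      tendsto_inv₀_cobounded).sub hlim
  rw [sub_zero] at hdecay
  have hzero := eq_zero_of_tendsto_cobounded
    (fun z => (extendsAnalyticallyAt_supportTransform_sub h₀ h₁ h₂ h₃ h₄ hp z).add
      (hq.analyticAt z)) (hdecay.congr fun w => by ring) hz
  linear_combination hzero

theorem hasFiniteHilbertTransform_surfaceDensity (h₀ : -1 ≤ a₁) (h₁ : a₁ < a₂) (h₂ : a₂ < a₃)
    (h₃ : a₃ < a₄) (h₄ : a₄ ≤ 1) {p q : ℂ → ℂ} (hp : Differentiable ℂ p)
    (hq : Differentiable ℂ q)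
    (hlim : Tendsto (fun z => p z * cutRoot (-1) 1 z / surfaceRoot a₁ a₂ a₃ a₄ z - q z)
      (Bornology.cobounded ℂ) (𝓝 0)) {x : ℝ}
    (hx : x ∈ interior (spectralSupport a₁ a₂ a₃ a₄)) :
    HasFiniteHilbertTransform (spectralSupport a₁ a₂ a₃ a₄)
      (fun w => surfaceDensity a₁ a₂ a₃ a₄ p w * (√(1 - w ^ 2) : ℂ)) x (1 / Real.pi * -q x) := by
  obtain ⟨H, hH, hpv, hCT⟩ := exists_analyticAt_supportTransform_eq h₀ h₁ h₂ h₃ h₄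
    (differentiableOn_surfaceDensity h₁.le h₃.le hp)
    (integrableOn_surfaceDensity h₁ h₂ h₃ hp.continuous) hx
  have hHq : ∀ᶠ z in 𝓝[{w : ℂ | w.im ≠ 0}] (x : ℂ), -q z = H z := by
    rw [eventually_nhdsWithin_iff]
    filter_upwards [hCT] with z hz hz₀
    linear_combination hz hz₀ - supportTransform_surfaceDensity h₀ h₁ h₂ h₃ h₄ hp hq hlim hz₀ +
      pi_mul_surfaceDensity_mul (a₁ := a₁) (a₂ := a₂) (a₃ := a₃) (a₄ := a₄) p z (cutRoot (-1) 1 z)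
  have hlim_neg : Tendsto (fun z => -q z) (𝓝[{w : ℂ | w.im ≠ 0}] (x : ℂ)) (𝓝 (-q x)) :=
    (hq.continuous.neg.tendsto (x : ℂ)).mono_left nhdsWithin_le_nhds
  rwa [tendsto_nhds_unique (hH.continuousAt.tendsto.mono_left nhdsWithin_le_nhds)
    (hlim_neg.congr' hHq)] at hpv

end Existence

section Solutions

variable {a₁ a₂ a₃ a₄ : ℝ}

theorem ae_ofReal_notMem_branchPoints : ∀ᵐ x : ℝ, (x : ℂ) ∉ branchPoints a₁ a₂ a₃ a₄ := by
  filter_upwards [volume.ae_ne a₁, volume.ae_ne a₂, volume.ae_ne a₃, volume.ae_ne a₄]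
    with x hx₁ hx₂ hx₃ hx₄
  simp [ofReal_mem_branchPoints, *]

theorem ofReal_notMem_branchPoints_of_mem_Ioo (h₁ : a₁ ≤ a₂) (h₂ : a₂ ≤ a₃) (h₃ : a₃ ≤ a₄)
    {x : ℝ} (hx : x ∈ Ioo a₁ a₂ ∪ Ioo a₃ a₄) : (x : ℂ) ∉ branchPoints a₁ a₂ a₃ a₄ := by
  rw [ofReal_mem_branchPoints]
  rintro (h | h | h | h) <;> rcases hx with hx | hx <;> linarith [hx.1, hx.2]

theorem mem_Ioo_of_ofReal_mem_bandSet {x : ℝ} (hx : (x : ℂ) ∈ bandSet a₁ a₂ a₃ a₄)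
    (hb : (x : ℂ) ∉ branchPoints a₁ a₂ a₃ a₄) : x ∈ Ioo a₁ a₂ ∪ Ioo a₃ a₄ := by
  obtain ⟨y, hy, hyx⟩ := hx
  obtain rfl := Complex.ofReal_injective hyx
  simp only [ofReal_mem_branchPoints, not_or] at hb
  obtain ⟨hy₁, hy₂, hy₃, hy₄⟩ := hb
  exact hy.imp (fun h => ⟨h.1.lt_of_ne' hy₁, h.2.lt_of_ne hy₂⟩)
    fun h => ⟨h.1.lt_of_ne' hy₃, h.2.lt_of_ne hy₄⟩

theorem im_eq_zero_of_mem_branchPoints {z : ℂ} (hz : z ∈ branchPoints a₁ a₂ a₃ a₄) :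
    z.im = 0 := by
  rcases hz with rfl | rfl | rfl | rfl <;> exact Complex.ofReal_im _

theorem HasFiniteHilbertTransform.unique {Γ : Set ℝ} {f : ℝ → ℂ} {x : ℝ} {h k : ℂ}
    (hh : HasFiniteHilbertTransform Γ f x h) (hk : HasFiniteHilbertTransform Γ f x k) : h = k :=
  tendsto_nhds_unique hh hk

theorem HasFiniteHilbertTransform.congr_ae {Γ : Set ℝ} {f f' : ℝ → ℂ} {x : ℝ} {h : ℂ}
    (hf : HasFiniteHilbertTransform Γ f x h) (hff' : f =ᵐ[volume] f') :
    HasFiniteHilbertTransform Γ f' x h :=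
  hf.congr fun _ => congrArg _ (integral_congr_ae (ae_restrict_of_ae
    (hff'.mono fun w hw => congrArg (· / ((w - x : ℝ) : ℂ)) hw)))

theorem HasFiniteHilbertTransform.sub {Γ : Set ℝ} (hΓ : MeasurableSet Γ) {f f' : ℝ → ℂ} {x : ℝ}
    {h h' : ℂ} (hf : HasFiniteHilbertTransform Γ f x h) (hf' : HasFiniteHilbertTransform Γ f' x h')
    (hint : IntegrableOn f Γ) (hint' : IntegrableOn f' Γ) :
    HasFiniteHilbertTransform Γ (fun w => f w - f' w) x (h - h') := by
  have htrunc {f : ℝ → ℂ} (hint : IntegrableOn f Γ) {ε : ℝ} (hε : 0 < ε) :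
      IntegrableOn (fun w => f w / ((w - x : ℝ) : ℂ)) (Γ \ Metric.ball x ε) := by
    simp only [Complex.ofReal_sub]
    refine integrableOn_div_ofReal_sub (hΓ.diff Metric.isOpen_ball.measurableSet)
      (hint.mono_set sdiff_subset) hε fun w hw => ?_
    rw [← Complex.ofReal_sub, Complex.norm_real, ← dist_eq_norm]
    exact not_lt.1 hw.2
  refine (Tendsto.sub hf hf').congr' ?_
  filter_upwards [self_mem_nhdsWithin] with ε hε
  rw [← mul_sub, ← integral_sub (htrunc hint hε) (htrunc hint' hε)]
  simp only [sub_div]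

theorem IsCondensateSolution.congr (h₁ : a₁ ≤ a₂) (h₂ : a₂ ≤ a₃) (h₃ : a₃ ≤ a₄) {g : ℝ → ℝ}
    {u v : ℂ → ℂ} (hv : IsCondensateSolution a₁ a₂ a₃ a₄ g v)
    (huv : EqOn u v (branchPoints a₁ a₂ a₃ a₄)ᶜ) : IsCondensateSolution a₁ a₂ a₃ a₄ g u := by
  have hae : (fun x : ℝ => v x) =ᵐ[volume] fun x : ℝ => u x :=
    ae_ofReal_notMem_branchPoints.mono fun x hx => (huv hx).symm
  have hint (c d : ℝ) : ∫ x in c..d, u (x : ℂ) = ∫ x in c..d, v (x : ℂ) :=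
    intervalIntegral.integral_congr_ae (hae.mono fun x hx _ => hx.symm)
  refine ⟨?_, fun x hx => ?_, hv.integrableOn.congr_fun_ae (ae_restrict_of_ae hae),
    fun x hx => ?_, (hint _ _).trans hv.vanish_left, (hint _ _).trans hv.vanish_right⟩
  · exact hv.differentiableOn.congr fun z hz =>
      huv fun hb => hz (branchPoints_subset_bandSet h₁ h₃ hb)
  · rw [huv (ofReal_notMem_branchPoints_of_mem_Ioo h₁ h₂ h₃ hx)]
    refine (hv.boundaryValue x hx).congr' ?_
    filter_upwards [self_mem_nhdsWithin] with z hz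
    exact (huv fun hb => ne_of_gt hz (im_eq_zero_of_mem_branchPoints hb)).symm
  · obtain ⟨h, hh, hg⟩ := hv.hilbert x hx
    exact ⟨h, hh.congr_ae (hae.mul .rfl), hg⟩

theorem IsCondensateSolution.sub (h₀ : -1 ≤ a₁) (h₁ : a₁ < a₂) (h₂ : a₂ < a₃) (h₃ : a₃ < a₄)
    (h₄ : a₄ ≤ 1) {g g' : ℝ → ℝ} {u v : ℂ → ℂ} (hu : IsCondensateSolution a₁ a₂ a₃ a₄ g u)
    (hv : IsCondensateSolution a₁ a₂ a₃ a₄ g' v) :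
    IsCondensateSolution a₁ a₂ a₃ a₄ (fun x => g x - g' x) (fun z => u z - v z) := by
  have hinterval {u : ℝ → ℂ} (hu : IntegrableOn u (Icc (-1) 1)) {c d : ℝ} (hcd : c ≤ d)
      (hc : -1 ≤ c) (hd : d ≤ 1) : IntervalIntegrable u volume c d :=
    (intervalIntegrable_iff_integrableOn_Icc_of_le hcd).2 (hu.mono_set (Icc_subset_Icc hc hd))
  refine ⟨hu.differentiableOn.sub hv.differentiableOn,
    fun x hx => (hu.boundaryValue x hx).sub (hv.boundaryValue x hx),
    hu.integrableOn.sub hv.integrableOn, fun x hx => ?_, ?_, ?_⟩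
  · obtain ⟨h, hh, hg⟩ := hu.hilbert x hx
    obtain ⟨h', hh', hg'⟩ := hv.hilbert x hx
    refine ⟨h - h', ?_, by rw [mul_sub, hg, hg', Complex.ofReal_sub]⟩
    simp only [sub_mul]
    exact hh.sub isClosed_spectralSupport.measurableSet hh'
      (integrableOn_mul_sqrt_one_sub_sq h₀ h₁ h₂ h₃ h₄ hu.integrableOn)
      (integrableOn_mul_sqrt_one_sub_sq h₀ h₁ h₂ h₃ h₄ hv.integrableOn)
  · rw [intervalIntegral.integral_sub (hinterval hu.integrableOn h₁.le h₀ (by linarith))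
      (hinterval hv.integrableOn h₁.le h₀ (by linarith)), hu.vanish_left, hv.vanish_left, sub_zero]
  · rw [intervalIntegral.integral_sub (hinterval hu.integrableOn h₃.le (by linarith) h₄)
      (hinterval hv.integrableOn h₃.le (by linarith) h₄), hu.vanish_right, hv.vanish_right,
      sub_zero]

theorem integral_surfaceDensity_eq_zero {c d : ℝ} {κ : ℂ} (hcd : c ≤ d)
    (hκ : ∀ x ∈ Icc c d, (surfaceRoot a₁ a₂ a₃ a₄ x)⁻¹ = κ * weight a₁ a₂ a₃ a₄ x) {p : ℂ → ℂ}
    {r : ℝ → ℝ} (hpr : ∀ x : ℝ, p x = r x)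
    (hr : ∫ x in c..d, r x * weight a₁ a₂ a₃ a₄ x = 0) :
    ∫ x in c..d, surfaceDensity a₁ a₂ a₃ a₄ p x = 0 := by
  simp only [surfaceDensity]
  rw [intervalIntegral.integral_const_mul, integral_div_surfaceRoot hcd hκ hpr, hr,
    Complex.ofReal_zero, mul_zero, mul_zero]

theorem isCondensateSolution_surfaceDensity (h₀ : -1 ≤ a₁) (h₁ : a₁ < a₂) (h₂ : a₂ < a₃)
    (h₃ : a₃ < a₄) (h₄ : a₄ ≤ 1) {p q : ℂ → ℂ} {r g : ℝ → ℝ} (hp : Differentiable ℂ p)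
    (hq : Differentiable ℂ q)
    (hlim : Tendsto (fun z => p z * cutRoot (-1) 1 z / surfaceRoot a₁ a₂ a₃ a₄ z - q z)
      (Bornology.cobounded ℂ) (𝓝 0)) (hpr : ∀ x : ℝ, p x = r x) (hqg : ∀ x : ℝ, -q x = g x)
    (hleft : ∫ x in a₁..a₂, r x * weight a₁ a₂ a₃ a₄ x = 0)
    (hright : ∫ x in a₃..a₄, r x * weight a₁ a₂ a₃ a₄ x = 0) :
    IsCondensateSolution a₁ a₂ a₃ a₄ g (surfaceDensity a₁ a₂ a₃ a₄ p) := by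
  refine ⟨differentiableOn_surfaceDensity h₁.le h₃.le hp, fun x hx => ?_,
    integrableOn_surfaceDensity h₁ h₂ h₃ hp.continuous, fun x hx =>
      ⟨_, hasFiniteHilbertTransform_surfaceDensity h₀ h₁ h₂ h₃ h₄ hp hq hlim hx, ?_⟩,
    integral_surfaceDensity_eq_zero h₁.le (fun _ => inv_surfaceRoot_left h₂.le h₃.le) hpr hleft,
    integral_surfaceDensity_eq_zero h₃.le (fun _ => inv_surfaceRoot_right h₁.le h₂.le) hpr hright⟩
  · exact (((hp.continuous.tendsto (x : ℂ)).mono_left nhdsWithin_le_nhds).div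
      (tendsto_surfaceRoot_upper h₁.le h₃.le x) (surfaceRoot_ne_zero
        (ofReal_notMem_branchPoints_of_mem_Ioo h₁.le h₂.le h₃.le hx))).const_mul _
  · have : (Real.pi : ℂ) ≠ 0 := Complex.ofReal_ne_zero.2 Real.pi_ne_zero
    rw [hqg]
    field

theorem isCondensateSolution_genusOneDOS (h₀ : -1 ≤ a₁) (h₁ : a₁ < a₂) (h₂ : a₂ < a₃)
    (h₃ : a₃ < a₄) (h₄ : a₄ ≤ 1) :
    IsCondensateSolution a₁ a₂ a₃ a₄ (fun x => -x) (genusOneDOS a₁ a₂ a₃ a₄) :=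
  isCondensateSolution_surfaceDensity h₀ h₁ h₂ h₃ h₄ differentiable_dosNumerator
    differentiable_id tendsto_dosNumerator_mul_cutRoot_div_sub dosNumerator_ofReal
    (fun x => by simp) (integral_dosPoly_left h₁ h₂ h₃) (integral_dosPoly_right h₁ h₂ h₃)

theorem isCondensateSolution_genusOneDOF (h₀ : -1 ≤ a₁) (h₁ : a₁ < a₂) (h₂ : a₂ < a₃)
    (h₃ : a₃ < a₄) (h₄ : a₄ ≤ 1) :
    IsCondensateSolution a₁ a₂ a₃ a₄ (fun x => 2 - 4 * x ^ 2) (genusOneDOF a₁ a₂ a₃ a₄) :=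
  isCondensateSolution_surfaceDensity h₀ h₁ h₂ h₃ h₄ differentiable_dofNumerator
    (q := fun z => 4 * z ^ 2 - 2) (by fun_prop) tendsto_dofNumerator_mul_cutRoot_div_sub
    dofNumerator_ofReal (fun x => by push_cast; ring) (integral_dofPoly_left h₁ h₂ h₃)
    (integral_dofPoly_right h₁ h₂ h₃)

end Solutions

section Uniqueness

variable {a₁ a₂ a₃ a₄ : ℝ}

theorem eqOn_im_ne_zero_of_eventually_nhds_ofReal {F G : ℂ → ℂ}
    (hF : DifferentiableOn ℂ F {z | z.im ≠ 0}) (hG : DifferentiableOn ℂ G {z | z.im ≠ 0}) {x : ℝ}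
    (hFG : ∀ᶠ z in 𝓝 (x : ℂ), z.im ≠ 0 → F z = G z) : EqOn F G {z | z.im ≠ 0} := by
  have hhalf {V : Set ℂ} (hV : IsOpen V) (hconv : Convex ℝ V) (him : ∀ z ∈ V, z.im ≠ 0)
      (hx : (x : ℂ) ∈ closure V) : EqOn F G V := by
    obtain ⟨w, hw, hwV⟩ :=
      (hFG.eventually_nhds.and_frequently (mem_closure_iff_frequently.1 hx)).exists
    refine ((hF.mono him).analyticOnNhd hV).eqOn_of_preconnected_of_eventuallyEq
      ((hG.mono him).analyticOnNhd hV) hconv.isPreconnected hwV ?_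
    filter_upwards [hw, hV.mem_nhds hwV] with z hz hzV
    exact hz (him z hzV)
  intro z hz
  rcases lt_or_gt_of_ne hz with hneg | hpos
  · exact hhalf (isOpen_lt Complex.continuous_im continuous_const) (convex_halfSpace_im_lt 0)
      (fun w hw => ne_of_lt hw) (by simp [Complex.closure_setOfPred_im_lt]) hneg
  · exact hhalf (isOpen_lt continuous_const Complex.continuous_im) (convex_halfSpace_im_gt 0)
      (fun w hw => ne_of_gt hw) (by simp [Complex.closure_setOfPred_lt_im]) hpos

theorem eventually_eq_zero_of_eventually_ofReal {H : ℂ → ℂ} {x : ℝ}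
    (hH : AnalyticAt ℂ H x) (hreal : ∀ᶠ y : ℝ in 𝓝 x, H y = 0) : ∀ᶠ z in 𝓝 (x : ℂ), H z = 0 := by
  have hofReal : Tendsto ((↑) : ℝ → ℂ) (𝓝[≠] x) (𝓝[≠] (x : ℂ)) :=
    Complex.continuous_ofReal.continuousWithinAt.tendsto_nhdsWithin
      fun _ hy => Complex.ofReal_injective.ne hy
  exact hH.frequently_zero_iff_eventually_zero.1
    (hofReal.frequently (hreal.filter_mono nhdsWithin_le_nhds).frequently)

theorem IsCondensateSolution.exists_analyticAt_supportTransform_eq (h₀ : -1 ≤ a₁) (h₁ : a₁ < a₂)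
    (h₂ : a₂ < a₃) (h₃ : a₃ < a₄) (h₄ : a₄ ≤ 1) {g : ℝ → ℝ} {u : ℂ → ℂ}
    (hu : IsCondensateSolution a₁ a₂ a₃ a₄ g u) {x : ℝ}
    (hx : x ∈ interior (spectralSupport a₁ a₂ a₃ a₄)) :
    ∃ H : ℂ → ℂ, AnalyticAt ℂ H x ∧ (∀ᶠ y : ℝ in 𝓝 x, H y = g y) ∧
      ∀ᶠ z in 𝓝 (x : ℂ), z.im ≠ 0 →
        supportTransform a₁ a₂ a₃ a₄ u z = H z + Real.pi * u z * cutRoot (-1) 1 z := by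
  obtain ⟨H, hH, -, hCT⟩ := DefNLS.exists_analyticAt_supportTransform_eq h₀ h₁ h₂ h₃ h₄
    hu.differentiableOn hu.integrableOn hx
  refine ⟨H, hH, ?_, hCT⟩
  have hofReal := Complex.continuous_ofReal.tendsto x
  filter_upwards [isOpen_interior.mem_nhds hx, hofReal.eventually hH.eventually_analyticAt,
    hofReal.eventually hCT.eventually_nhds] with y hy hHy hCTy
  obtain ⟨H', hH', hpv, hCT'⟩ := DefNLS.exists_analyticAt_supportTransform_eq h₀ h₁ h₂ h₃ h₄
    hu.differentiableOn hu.integrableOn hy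
  obtain ⟨h, hh, hg⟩ := hu.hilbert y hy
  have hHH' : H =ᶠ[𝓝[{z | z.im ≠ 0}] (y : ℂ)] H' := by
    rw [EventuallyEq, eventually_nhdsWithin_iff]
    filter_upwards [hCTy, hCT'] with z hz hz' hz₀
    exact add_right_cancel ((hz hz₀).symm.trans (hz' hz₀))
  have : H y = H' y := tendsto_nhds_unique
    ((hHy.continuousAt.tendsto.mono_left nhdsWithin_le_nhds).congr' hHH')
    (hH'.continuousAt.tendsto.mono_left nhdsWithin_le_nhds)
  rw [this, ← hg, hh.unique hpv, ← mul_assoc, mul_one_div_cancel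
    (Complex.ofReal_ne_zero.2 Real.pi_ne_zero), one_mul]

theorem IsCondensateSolution.supportTransform_eq (h₀ : -1 ≤ a₁) (h₁ : a₁ < a₂) (h₂ : a₂ < a₃)
    (h₃ : a₃ < a₄) (h₄ : a₄ ≤ 1) {φ : ℂ → ℂ}
    (hφ : IsCondensateSolution a₁ a₂ a₃ a₄ (fun _ => 0) φ) {z : ℂ} (hz : z.im ≠ 0) :
    supportTransform a₁ a₂ a₃ a₄ φ z = Real.pi * φ z * cutRoot (-1) 1 z := by
  have hmid : (a₂ + a₃) / 2 ∈ interior (spectralSupport a₁ a₂ a₃ a₄) := by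
    refine interior_mono (fun y hy => Or.inl (Or.inr hy)) (interior_Icc (a := a₂) ▸ ?_)
    constructor <;> linarith
  obtain ⟨H, hH, hreal, hCT⟩ := hφ.exists_analyticAt_supportTransform_eq h₀ h₁ h₂ h₃ h₄ hmid
  have hH₀ := eventually_eq_zero_of_eventually_ofReal hH (hreal.mono fun y hy => by simpa using hy)
  refine eqOn_im_ne_zero_of_eventually_nhds_ofReal (fun w hw => ?_) (fun w hw => ?_)
    (G := fun z => Real.pi * φ z * cutRoot (-1) 1 z) (hCT.mp (hH₀.mono fun w hHw hw hw₀ => ?_)) hz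
  · exact (differentiableAt_cauchyTransform isClosed_spectralSupport
      (integrableOn_mul_sqrt_one_sub_sq h₀ h₁ h₂ h₃ h₄ hφ.integrableOn)
      fun x _ => ofReal_ne_of_im_ne_zero hw x).differentiableWithinAt
  · exact (((hφ.differentiableOn.differentiableAt (isClosed_bandSet.isOpen_compl.mem_nhds
      (notMem_bandSet_of_im_ne_zero hw))).const_mul _).mul (differentiableAt_cutRoot (by norm_num)
        fun x _ => ofReal_ne_of_im_ne_zero hw x)).differentiableWithinAt
  · rw [hw hw₀, hHw, zero_add]

theorem IsCondensateSolution.mul_surfaceRoot_eq (h₀ : -1 ≤ a₁) (h₁ : a₁ < a₂) (h₂ : a₂ < a₃)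
    (h₃ : a₃ < a₄) (h₄ : a₄ ≤ 1) {φ : ℂ → ℂ}
    (hφ : IsCondensateSolution a₁ a₂ a₃ a₄ (fun _ => 0) φ) {z : ℂ} (hz : z.im ≠ 0) :
    φ z * surfaceRoot a₁ a₂ a₃ a₄ z =
      supportTransform a₁ a₂ a₃ a₄ φ z / Real.pi * (supportRoot a₁ a₂ a₃ a₄ z / (z ^ 2 - 1)) := by
  have : (Real.pi : ℂ) ≠ 0 := Complex.ofReal_ne_zero.2 Real.pi_ne_zero
  have hunit := sq_sub_one_ne_zero_of_im_ne_zero hz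
  rw [hφ.supportTransform_eq h₀ h₁ h₂ h₃ h₄ hz,
    ← surfaceRoot_mul_cutRoot_unit h₀ h₁.le h₂.le h₃.le h₄]
  rw [← cutRoot_unit_sq] at hunit ⊢
  have : cutRoot (-1) 1 z ≠ 0 := (pow_ne_zero_iff two_ne_zero).1 hunit
  field

theorem differentiableAt_supportTransform_div_mul (h₀ : -1 ≤ a₁) (h₁ : a₁ < a₂) (h₂ : a₂ < a₃)
    (h₃ : a₃ < a₄) (h₄ : a₄ ≤ 1) {u : ℂ → ℂ}
    (hu : IntegrableOn (fun x : ℝ => u x) (Icc (-1) 1)) {z : ℂ}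
    (hz : ∀ x ∈ spectralSupport a₁ a₂ a₃ a₄, (x : ℂ) ≠ z) (hunit : z ^ 2 ≠ 1) :
    DifferentiableAt ℂ (fun z => supportTransform a₁ a₂ a₃ a₄ u z / Real.pi *
      (supportRoot a₁ a₂ a₃ a₄ z / (z ^ 2 - 1))) z :=
  ((differentiableAt_cauchyTransform isClosed_spectralSupport
    (integrableOn_mul_sqrt_one_sub_sq h₀ h₁ h₂ h₃ h₄ hu) hz).div_const _).mul
    ((differentiableAt_supportRoot h₀ h₂.le h₄ hz).div (by fun_prop) (sub_ne_zero.2 hunit))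

theorem notMem_spectralSupport_of_mem_Ioo {x : ℝ} (h₁ : a₁ < a₂) (h₂ : a₂ < a₃) (h₃ : a₃ < a₄)
    (hx : x ∈ Ioo a₁ a₂ ∪ Ioo a₃ a₄) : x ∉ spectralSupport a₁ a₂ a₃ a₄ := by
  rintro ((h | h) | h) <;> rcases hx with hx | hx <;> linarith [hx.1, hx.2, h.1, h.2]

theorem ofReal_sq_ne_one_of_mem_Ioo (h₀ : -1 ≤ a₁) (h₁ : a₁ < a₂) (h₂ : a₂ < a₃) (h₃ : a₃ < a₄)
    (h₄ : a₄ ≤ 1) {x : ℝ} (hx : x ∈ Ioo a₁ a₂ ∪ Ioo a₃ a₄) : (x : ℂ) ^ 2 ≠ 1 := by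
  have hsq : x ^ 2 < 1 := by rcases hx with hx | hx <;> nlinarith [hx.1, hx.2]
  exact_mod_cast hsq.ne

theorem IsCondensateSolution.extendsAnalyticallyAt_mul_surfaceRoot (h₀ : -1 ≤ a₁) (h₁ : a₁ < a₂)
    (h₂ : a₂ < a₃) (h₃ : a₃ < a₄) (h₄ : a₄ ≤ 1) {φ : ℂ → ℂ}
    (hφ : IsCondensateSolution a₁ a₂ a₃ a₄ (fun _ => 0) φ) {z : ℂ}
    (hz : z ∉ branchPoints a₁ a₂ a₃ a₄) :
    ExtendsAnalyticallyAt (fun z => φ z * surfaceRoot a₁ a₂ a₃ a₄ z) z := by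
  by_cases hband : z ∈ bandSet a₁ a₂ a₃ a₄
  · obtain ⟨x, -, rfl⟩ := id hband
    have hx := mem_Ioo_of_ofReal_mem_bandSet hband hz
    refine ⟨_, ?_, Eventually.of_forall fun w hw => hφ.mul_surfaceRoot_eq h₀ h₁ h₂ h₃ h₄ hw⟩
    rw [Complex.analyticAt_iff_eventually_differentiableAt]
    filter_upwards [(isOpen_setOf_forall_ofReal_ne isClosed_spectralSupport).mem_nhds
        fun y hy hyx =>
          notMem_spectralSupport_of_mem_Ioo h₁ h₂ h₃ hx (Complex.ofReal_injective hyx ▸ hy),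
      (continuous_pow 2).continuousAt.eventually_ne
        (ofReal_sq_ne_one_of_mem_Ioo h₀ h₁ h₂ h₃ h₄ hx)] with w hw hunit
    exact differentiableAt_supportTransform_div_mul h₀ h₁ h₂ h₃ h₄ hφ.integrableOn hw hunit
  · exact ⟨_, (hφ.differentiableOn.mul fun w hw =>
      (differentiableAt_surfaceRoot h₁.le h₃.le hw).differentiableWithinAt).analyticAt
        (isClosed_bandSet.isOpen_compl.mem_nhds hband), Eventually.of_forall fun _ _ => rfl⟩

theorem exists_continuousAt_sub_div_sq_sub_one_eq (c : ℝ) :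
    ∃ b : ℂ → ℂ, ContinuousAt b c ∧ ∀ z : ℂ, z.im ≠ 0 → (z - c) / (z ^ 2 - 1) = b z := by
  have hpole (d : ℝ) : ContinuousAt (fun z : ℂ => (d - c) / (z - d)) (c : ℂ) := by
    rcases eq_or_ne c d with rfl | hne
    · simpa using continuousAt_const
    · exact continuousAt_const.div (by fun_prop)
        (sub_ne_zero.2 (Complex.ofReal_injective.ne hne))
  refine ⟨fun z => ((1 : ℝ) - c) / (z - (1 : ℝ)) / 2 - ((-1 : ℝ) - c) / (z - (-1 : ℝ)) / 2,
    ((hpole 1).div_const 2).sub ((hpole (-1)).div_const 2), fun z hz => ?_⟩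
  have := sq_sub_one_ne_zero_of_im_ne_zero hz
  have := sub_ne_zero.2 (ofReal_ne_of_im_ne_zero hz 1).symm
  have := sub_ne_zero.2 (ofReal_ne_of_im_ne_zero hz (-1)).symm
  push_cast at *
  field_simp
  ring

theorem exists_continuousAt_surfaceRoot_sq_div_eq (h₁ : a₁ < a₂) (h₂ : a₂ < a₃) (h₃ : a₃ < a₄)
    {c : ℝ} (hc : (c : ℂ) ∈ branchPoints a₁ a₂ a₃ a₄) :
    ∃ b : ℂ → ℂ, ContinuousAt b c ∧
      ∀ z : ℂ, z.im ≠ 0 → surfaceRoot a₁ a₂ a₃ a₄ z ^ 2 / (z ^ 2 - 1) = b z := by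
  obtain ⟨Q, hQ, -, hRQ⟩ := exists_surfaceRoot_sq_eq_sub_mul h₁ h₂ h₃ hc
  obtain ⟨b, hb, hbz⟩ := exists_continuousAt_sub_div_sq_sub_one_eq c
  refine ⟨_, hb.mul hQ.continuousAt, fun z hz => ?_⟩
  rw [hRQ, Pi.mul_apply, ← hbz z hz]
  ring

theorem norm_supportRoot_div (h₀ : -1 ≤ a₁) (h₁ : a₁ ≤ a₂) (h₂ : a₂ ≤ a₃) (h₃ : a₃ ≤ a₄)
    (h₄ : a₄ ≤ 1) {z : ℂ} (hz : z.im ≠ 0) :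
    ‖supportRoot a₁ a₂ a₃ a₄ z / (z ^ 2 - 1)‖ =
      √‖surfaceRoot a₁ a₂ a₃ a₄ z ^ 2 / (z ^ 2 - 1)‖ := by
  have := sq_sub_one_ne_zero_of_im_ne_zero hz
  rw [eq_comm, Real.sqrt_eq_iff_eq_sq (norm_nonneg _) (norm_nonneg _), ← norm_pow, div_pow,
    ← surfaceRoot_mul_cutRoot_unit h₀ h₁ h₂ h₃ h₄, mul_pow, cutRoot_unit_sq]
  congr 1
  field

theorem IsCondensateSolution.tendsto_im_mul_mul_surfaceRoot (h₀ : -1 ≤ a₁) (h₁ : a₁ < a₂)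
    (h₂ : a₂ < a₃) (h₃ : a₃ < a₄) (h₄ : a₄ ≤ 1) {φ : ℂ → ℂ}
    (hφ : IsCondensateSolution a₁ a₂ a₃ a₄ (fun _ => 0) φ) {c : ℝ}
    (hc : (c : ℂ) ∈ branchPoints a₁ a₂ a₃ a₄) :
    Tendsto (fun z : ℂ => (z.im : ℂ) * (φ z * surfaceRoot a₁ a₂ a₃ a₄ z)) (𝓝 (c : ℂ)) (𝓝 0) := by
  obtain ⟨b, hb, hbz⟩ := exists_continuousAt_surfaceRoot_sq_div_eq h₁ h₂ h₃ hc
  have hCT : Tendsto (fun z : ℂ => (z.im : ℂ) * supportTransform a₁ a₂ a₃ a₄ φ z) (𝓝 (c : ℂ))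
      (𝓝 0) :=
    tendsto_im_mul_cauchyTransform
      (integrableOn_mul_sqrt_one_sub_sq h₀ h₁ h₂ h₃ h₄ hφ.integrableOn) c
  have hlim := (hCT.div_const (Real.pi : ℂ)).norm.mul hb.norm.sqrt.tendsto
  rw [zero_div, norm_zero, zero_mul] at hlim
  refine squeeze_zero_norm (fun z => ?_) hlim
  rcases eq_or_ne z.im 0 with hz | hz
  · rw [hz, Complex.ofReal_zero, zero_mul, norm_zero]
    positivity
  · rw [hφ.mul_surfaceRoot_eq h₀ h₁ h₂ h₃ h₄ hz, ← hbz z hz,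
      ← norm_supportRoot_div h₀ h₁.le h₂.le h₃.le h₄ hz, ← norm_mul]
    exact (congrArg norm (by ring)).le

theorem surfaceRoot_div_cutRoot_unit_isBigO :
    (fun z => surfaceRoot a₁ a₂ a₃ a₄ z / cutRoot (-1) 1 z) =O[Bornology.cobounded ℂ] id := by
  refine Asymptotics.isBigO_of_div_tendsto_nhds ?_ 1 ?_
  · filter_upwards [Bornology.eventually_ne_cobounded (0 : ℂ)] with z hz hz₀
    exact absurd hz₀ hz
  · have hlim := (tendsto_surfaceRoot_div a₁ a₂ a₃ a₄).div (tendsto_cutRoot_div (-1) 1) one_ne_zero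
    rw [div_one] at hlim
    refine hlim.congr' ?_
    filter_upwards [Bornology.eventually_ne_cobounded (0 : ℂ)] with z hz
    rw [Pi.div_apply, Pi.div_apply, id]
    field

theorem IsCondensateSolution.exists_norm_mul_surfaceRoot_le (h₀ : -1 ≤ a₁) (h₁ : a₁ < a₂)
    (h₂ : a₂ < a₃) (h₃ : a₃ < a₄) (h₄ : a₄ ≤ 1) {φ : ℂ → ℂ}
    (hφ : IsCondensateSolution a₁ a₂ a₃ a₄ (fun _ => 0) φ) :
    ∃ C, ∀ᶠ z in Bornology.cobounded ℂ, z.im ≠ 0 → ‖φ z * surfaceRoot a₁ a₂ a₃ a₄ z‖ ≤ C := by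
  obtain ⟨C, hC⟩ := ((supportTransform_isBigO_inv h₀ h₁ h₂ h₃ h₄ hφ.integrableOn).mul
    (surfaceRoot_div_cutRoot_unit_isBigO (a₁ := a₁) (a₂ := a₂) (a₃ := a₃) (a₄ := a₄))).bound
  refine ⟨C / Real.pi, ?_⟩
  filter_upwards [hC, Bornology.eventually_ne_cobounded (0 : ℂ)] with z hz hz₀ him
  rw [id, inv_mul_cancel₀ hz₀, norm_one, mul_one, hφ.supportTransform_eq h₀ h₁ h₂ h₃ h₄ him] at hz
  have hcut : cutRoot (-1) 1 z ≠ 0 := (pow_ne_zero_iff two_ne_zero).1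
    (cutRoot_unit_sq z ▸ sq_sub_one_ne_zero_of_im_ne_zero him)
  rw [le_div_iff₀' Real.pi_pos]
  refine le_trans (le_of_eq ?_) hz
  rw [mul_assoc, mul_assoc, mul_div_cancel₀ _ hcut, norm_mul (Real.pi : ℂ), Complex.norm_real,
    Real.norm_of_nonneg Real.pi_pos.le]

/-- Off the real axis `φ R` is `(1 / π)` times the support transform of `φ` times
`R / √(z² - 1)`, which is analytic across the bands: hence `φ R` is entire and bounded. -/
theorem IsCondensateSolution.exists_mul_surfaceRoot_eq (h₀ : -1 ≤ a₁) (h₁ : a₁ < a₂)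
    (h₂ : a₂ < a₃) (h₃ : a₃ < a₄) (h₄ : a₄ ≤ 1) {φ : ℂ → ℂ}
    (hφ : IsCondensateSolution a₁ a₂ a₃ a₄ (fun _ => 0) φ) :
    ∃ k, ∀ z ∉ branchPoints a₁ a₂ a₃ a₄, φ z * surfaceRoot a₁ a₂ a₃ a₄ z = k := by
  have hS : ((↑) '' ({a₁, a₂, a₃, a₄} : Set ℝ) : Set ℂ) = branchPoints a₁ a₂ a₃ a₄ := by
    simp only [image_insert_eq, image_singleton, branchPoints]
  have hext := extendsAnalyticallyAt_of_finite (toFinite {a₁, a₂, a₃, a₄})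
    (fun z hz => hφ.extendsAnalyticallyAt_mul_surfaceRoot h₀ h₁ h₂ h₃ h₄ (hS ▸ hz))
    fun c hc => hφ.tendsto_im_mul_mul_surfaceRoot h₀ h₁ h₂ h₃ h₄ (hS ▸ mem_image_of_mem _ hc)
  obtain ⟨C, hC⟩ := hφ.exists_norm_mul_surfaceRoot_le h₀ h₁ h₂ h₃ h₄
  obtain ⟨k, hk⟩ := exists_eqOn_const_of_norm_le hext hC
  refine ⟨k, fun z hz => ?_⟩
  by_cases hband : z ∈ bandSet a₁ a₂ a₃ a₄
  · obtain ⟨x, -, rfl⟩ := id hband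
    have hlim := (hφ.boundaryValue x (mem_Ioo_of_ofReal_mem_bandSet hband hz)).mul
      (tendsto_surfaceRoot_upper h₁.le h₃.le x)
    have : (𝓝[{z : ℂ | 0 < z.im}] (x : ℂ)).NeBot :=
      mem_closure_iff_nhdsWithin_neBot.1 (by simp [Complex.closure_setOfPred_lt_im])
    refine tendsto_nhds_unique hlim (tendsto_const_nhds.congr' ?_)
    filter_upwards [self_mem_nhdsWithin] with w hw
    exact (hk w (ne_of_gt hw)).symm
  · have hcont := ((hφ.differentiableOn.differentiableAt
      (isClosed_bandSet.isOpen_compl.mem_nhds hband)).mul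
        (differentiableAt_surfaceRoot h₁.le h₃.le hband)).continuousAt
    refine tendsto_nhds_unique (hcont.tendsto.mono_left (nhdsWithin_le_nhds (s := {w | w.im ≠ 0})))
      (tendsto_const_nhds.congr' ?_)
    filter_upwards [self_mem_nhdsWithin] with w hw
    exact (hk w hw).symm

/-- The band condition kills the one-parameter family `k / R`, as `1 / R` has constant phase on a
band. -/
theorem IsCondensateSolution.eq_zero (h₀ : -1 ≤ a₁) (h₁ : a₁ < a₂) (h₂ : a₂ < a₃) (h₃ : a₃ < a₄)
    (h₄ : a₄ ≤ 1) {φ : ℂ → ℂ} (hφ : IsCondensateSolution a₁ a₂ a₃ a₄ (fun _ => 0) φ) {z : ℂ}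
    (hz : z ∉ branchPoints a₁ a₂ a₃ a₄) : φ z = 0 := by
  obtain ⟨k, hk⟩ := hφ.exists_mul_surfaceRoot_eq h₀ h₁ h₂ h₃ h₄
  have hφk (w : ℂ) (hw : w ∉ branchPoints a₁ a₂ a₃ a₄) :
      φ w = k * (1 / surfaceRoot a₁ a₂ a₃ a₄ w) := by
    rw [mul_one_div, eq_div_iff (surfaceRoot_ne_zero hw), hk w hw]
  have hband : ∫ x in a₁..a₂, φ x =
      k * (Complex.I * (∫ x in a₁..a₂, weight a₁ a₂ a₃ a₄ x : ℝ)) := by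
    have hinv := integral_div_surfaceRoot h₁.le (fun _ => inv_surfaceRoot_left h₂.le h₃.le)
      (P := fun _ => 1) (p := fun _ => 1) (by simp)
    simp only [one_mul] at hinv
    rw [← hinv, ← intervalIntegral.integral_const_mul]
    refine intervalIntegral.integral_congr_ae ?_
    filter_upwards [ae_ofReal_notMem_branchPoints] with x hx _ using hφk x hx
  have hpos := integral_weight_pos h₁ h₂ h₃
  have hk₀ : k = 0 := (mul_eq_zero.1 (hband.symm.trans hφ.vanish_left)).resolve_right
    (mul_ne_zero Complex.I_ne_zero (Complex.ofReal_ne_zero.2 hpos.ne'))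
  rw [hφk z hz, hk₀, zero_mul]

theorem IsCondensateSolution.eqOn (h₀ : -1 ≤ a₁) (h₁ : a₁ < a₂) (h₂ : a₂ < a₃) (h₃ : a₃ < a₄)
    (h₄ : a₄ ≤ 1) {g : ℝ → ℝ} {u v : ℂ → ℂ} (hu : IsCondensateSolution a₁ a₂ a₃ a₄ g u)
    (hv : IsCondensateSolution a₁ a₂ a₃ a₄ g v) : EqOn u v (branchPoints a₁ a₂ a₃ a₄)ᶜ := by
  have hsub := hu.sub h₀ h₁ h₂ h₃ h₄ hv
  simp only [sub_self] at hsub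
  exact fun z hz => sub_eq_zero.1 (hsub.eq_zero h₀ h₁ h₂ h₃ h₄ hz)

theorem isCondensateSolution_iff_eqOn (h₀ : -1 ≤ a₁) (h₁ : a₁ < a₂) (h₂ : a₂ < a₃) (h₃ : a₃ < a₄)
    (h₄ : a₄ ≤ 1) {g : ℝ → ℝ} {v : ℂ → ℂ} (hv : IsCondensateSolution a₁ a₂ a₃ a₄ g v)
    (u : ℂ → ℂ) :
    IsCondensateSolution a₁ a₂ a₃ a₄ g u ↔ EqOn u v (branchPoints a₁ a₂ a₃ a₄)ᶜ :=
  ⟨fun hu => hu.eqOn h₀ h₁ h₂ h₃ h₄ hv, hv.congr h₁.le h₂.le h₃.le⟩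

end Uniqueness

section EffectiveVelocity

variable {a₁ a₂ a₃ a₄ : ℝ}

theorem exists_mem_Ioo_eq_zero_of_integral_mul_eq_zero {c d : ℝ} (hcd : c < d) {f w : ℝ → ℝ}
    (hf : ContinuousOn f (Icc c d)) (hw : IntervalIntegrable w volume c d)
    (hpos : ∀ x ∈ Ioo c d, 0 < w x) (h : ∫ x in c..d, f x * w x = 0) : ∃ x ∈ Ioo c d, f x = 0 := by
  have hfw : IntervalIntegrable (fun x => f x * w x) volume c d :=
    hw.continuousOn_mul (by rwa [uIcc_of_le hcd.le])
  obtain ⟨x, hx, hmean⟩ := exists_eq_const_mul_setIntegral_of_nonneg (μ := volume)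
    (isConnected_Ioo hcd) measurableSet_Ioo (hf.mono Ioo_subset_Icc_self)
    (hw.1.mono_set Ioo_subset_Ioc_self) (hfw.1.mono_set Ioo_subset_Ioc_self)
    fun x hx => (hpos x hx).le
  rw [← integral_Ioc_eq_integral_Ioo, ← integral_Ioc_eq_integral_Ioo,
    ← intervalIntegral.integral_of_le hcd.le, ← intervalIntegral.integral_of_le hcd.le, h] at hmean
  exact ⟨x, hx, (mul_eq_zero.1 hmean.symm).resolve_right
    (intervalIntegral.intervalIntegral_pos_of_pos_on hw hpos hcd).ne'⟩

theorem exists_dosPoly_eq_zero (h₁ : a₁ < a₂) (h₂ : a₂ < a₃) (h₃ : a₃ < a₄) {c d : ℝ} (hcd : c < d)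
    (hneg : ∀ x ∈ Ioo c d, branchPoly a₁ a₂ a₃ a₄ x < 0)
    (hint : ∫ x in c..d, dosPoly a₁ a₂ a₃ a₄ x * weight a₁ a₂ a₃ a₄ x = 0) :
    ∃ x ∈ Ioo c d, dosPoly a₁ a₂ a₃ a₄ x = 0 :=
  exists_mem_Ioo_eq_zero_of_integral_mul_eq_zero hcd (by unfold dosPoly; fun_prop)
    (intervalIntegrable_weight h₁ h₂ h₃ c d)
    (fun x hx => inv_pos.2 (Real.sqrt_pos.2 (abs_pos.2 (hneg x hx).ne))) hint

theorem dosPoly_eq_mul_of_eq_zero {x y : ℝ} (hxy : x ≠ y) (hx : dosPoly a₁ a₂ a₃ a₄ x = 0)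
    (hy : dosPoly a₁ a₂ a₃ a₄ y = 0) (z : ℝ) : dosPoly a₁ a₂ a₃ a₄ z = (z - x) * (z - y) := by
  rw [dosPoly] at hx hy ⊢
  have hsum : x + y = (1 / 2) * l₁ a₁ a₂ a₃ a₄ :=
    mul_left_cancel₀ (sub_ne_zero.2 hxy) (by linear_combination hx - hy)
  linear_combination hx + (z - x) * hsum

/-- The band conditions put one zero of the quadratic into each open band. -/
theorem dosPoly_ne_zero (h₁ : a₁ < a₂) (h₂ : a₂ < a₃) (h₃ : a₃ < a₄) {z : ℝ}
    (hz : z ∈ spectralSupport a₁ a₂ a₃ a₄) : dosPoly a₁ a₂ a₃ a₄ z ≠ 0 := by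
  obtain ⟨x, hx, hx₀⟩ := exists_dosPoly_eq_zero h₁ h₂ h₃ h₁
    (fun _ => branchPoly_neg_of_mem_left h₂.le h₃.le) (integral_dosPoly_left h₁ h₂ h₃)
  obtain ⟨y, hy, hy₀⟩ := exists_dosPoly_eq_zero h₁ h₂ h₃ h₃
    (fun _ => branchPoly_neg_of_mem_right h₁.le h₂.le) (integral_dosPoly_right h₁ h₂ h₃)
  have hband {t : ℝ} (ht : t ∈ Ioo a₁ a₂ ∪ Ioo a₃ a₄) : z - t ≠ 0 := fun h =>
    notMem_spectralSupport_of_mem_Ioo h₁ h₂ h₃ ht (sub_eq_zero.1 h ▸ hz)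
  rw [dosPoly_eq_mul_of_eq_zero (by linarith [hx.2, hy.1] : x < y).ne hx₀ hy₀]
  exact mul_ne_zero (hband (.inl hx)) (hband (.inr hy))

theorem dofPoly_eq_sub (x : ℝ) : dofPoly a₁ a₂ a₃ a₄ x =
    4 * x * dosPoly a₁ a₂ a₃ a₄ x - (constC a₁ a₂ a₃ a₄ * x - constB a₁ a₂ a₃ a₄) := by
  rw [dofPoly, dosPoly, constA, constC, l₁, l₂]
  ring

theorem genusOneDOS_ofReal (x : ℝ) : genusOneDOS a₁ a₂ a₃ a₄ x =
    1 / Real.pi * (dosPoly a₁ a₂ a₃ a₄ x / surfaceRoot a₁ a₂ a₃ a₄ x) := by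
  rw [← dosNumerator_ofReal]
  rfl

theorem genusOneDOF_ofReal (x : ℝ) : genusOneDOF a₁ a₂ a₃ a₄ x =
    1 / Real.pi * (dofPoly a₁ a₂ a₃ a₄ x / surfaceRoot a₁ a₂ a₃ a₄ x) := by
  rw [← dofNumerator_ofReal]
  rfl

theorem genusOneDOS_ofReal_ne_zero {x : ℝ} (hx : dosPoly a₁ a₂ a₃ a₄ x ≠ 0)
    (hxb : (x : ℂ) ∉ branchPoints a₁ a₂ a₃ a₄) : genusOneDOS a₁ a₂ a₃ a₄ x ≠ 0 := by
  rw [genusOneDOS_ofReal]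
  exact mul_ne_zero (one_div_ne_zero (Complex.ofReal_ne_zero.2 Real.pi_ne_zero))
    (div_ne_zero (Complex.ofReal_ne_zero.2 hx) (surfaceRoot_ne_zero hxb))

theorem genusOneDOF_div_genusOneDOS {x : ℝ} (hx : dosPoly a₁ a₂ a₃ a₄ x ≠ 0)
    (hxb : (x : ℂ) ∉ branchPoints a₁ a₂ a₃ a₄) :
    genusOneDOF a₁ a₂ a₃ a₄ x / genusOneDOS a₁ a₂ a₃ a₄ x =
      (4 * x - (constC a₁ a₂ a₃ a₄ * x - constB a₁ a₂ a₃ a₄) / dosPoly a₁ a₂ a₃ a₄ x : ℝ) := by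
  have hpi : (Real.pi : ℂ) ≠ 0 := Complex.ofReal_ne_zero.2 Real.pi_ne_zero
  rw [genusOneDOF_ofReal, genusOneDOS_ofReal, mul_div_mul_left _ _ (one_div_ne_zero hpi),
    div_div_div_cancel_right₀ (surfaceRoot_ne_zero hxb), dofPoly_eq_sub, ← Complex.ofReal_div,
    sub_div, mul_div_cancel_right₀ _ hx]

end EffectiveVelocity

end DefNLS

theorem mainTheorem8 (a₁ a₂ a₃ a₄ : ℝ) (h₀ : -1 ≤ a₁) (h₁ : a₁ < a₂) (h₂ : a₂ < a₃)
    (h₃ : a₃ < a₄) (h₄ : a₄ ≤ 1) :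
    (∀ u : ℂ → ℂ, DefNLS.IsCondensateSolution a₁ a₂ a₃ a₄ (fun x => -x) u ↔
      Set.EqOn u (DefNLS.genusOneDOS a₁ a₂ a₃ a₄) (DefNLS.branchPoints a₁ a₂ a₃ a₄)ᶜ) ∧
    (∀ v : ℂ → ℂ, DefNLS.IsCondensateSolution a₁ a₂ a₃ a₄ (fun x => 2 - 4 * x ^ 2) v ↔
      Set.EqOn v (DefNLS.genusOneDOF a₁ a₂ a₃ a₄) (DefNLS.branchPoints a₁ a₂ a₃ a₄)ᶜ) ∧
    (∀ u v : ℂ → ℂ, DefNLS.IsCondensateSolution a₁ a₂ a₃ a₄ (fun x => -x) u →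
      DefNLS.IsCondensateSolution a₁ a₂ a₃ a₄ (fun x => 2 - 4 * x ^ 2) v →
      ∀ z ∈ DefNLS.spectralSupport a₁ a₂ a₃ a₄,
        z ^ 2 - (1 / 2) * DefNLS.l₁ a₁ a₂ a₃ a₄ * z + DefNLS.constA a₁ a₂ a₃ a₄ ≠ 0 ∧
        ((z : ℂ) ∉ DefNLS.branchPoints a₁ a₂ a₃ a₄ →
          u z ≠ 0 ∧
          DefNLS.effectiveVelocity u v z =
            ((4 * z - (DefNLS.constC a₁ a₂ a₃ a₄ * z - DefNLS.constB a₁ a₂ a₃ a₄) /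
              (z ^ 2 - (1 / 2) * DefNLS.l₁ a₁ a₂ a₃ a₄ * z + DefNLS.constA a₁ a₂ a₃ a₄) : ℝ) :
                ℂ))) := by
  have hdos := DefNLS.isCondensateSolution_genusOneDOS h₀ h₁ h₂ h₃ h₄
  have hdof := DefNLS.isCondensateSolution_genusOneDOF h₀ h₁ h₂ h₃ h₄
  refine ⟨DefNLS.isCondensateSolution_iff_eqOn h₀ h₁ h₂ h₃ h₄ hdos,
    DefNLS.isCondensateSolution_iff_eqOn h₀ h₁ h₂ h₃ h₄ hdof, fun u v hu hv z hz => ?_⟩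
  have hne : DefNLS.dosPoly a₁ a₂ a₃ a₄ z ≠ 0 := DefNLS.dosPoly_ne_zero h₁ h₂ h₃ hz
  refine ⟨hne, fun hzb => ?_⟩
  rw [DefNLS.effectiveVelocity, hu.eqOn h₀ h₁ h₂ h₃ h₄ hdos hzb, hv.eqOn h₀ h₁ h₂ h₃ h₄ hdof hzb]
  exact ⟨DefNLS.genusOneDOS_ofReal_ne_zero hne hzb, DefNLS.genusOneDOF_div_genusOneDOS hne hzb⟩
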